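/- Let $d\ge 1$, $\hbar>0$, and let $\Phi\in L^\infty(\mathbf R^d)$ be real-valued and even. Write $\mathfrak H_n=L^2((\mathbf R^d)^n)$, $\mathfrak H=\mathfrak H_1$, and let $\|\cdot\|_{\mathcal L^1}$ be the trace norm. Let $F_0$ be a density operator on $\mathfrak H$ (that is, $F_0=F_0^*\ge 0$ and $\operatorname{trace}F_0=1$). Let $t\mapsto F(t)$, $t\ge 0$, be the (mild, trace-norm continuous) solution of the Hartree equation $$i\hbar\,\partial_tF(t)=\Big[-\tfrac12\hbar^2\Delta+\Phi\star\rho(t,\cdot),\,F(t)\Big],\qquad \rho(t,x)=F(t,x,x),\qquad F(0)=F_0 .$$ For each $N\ge 1$, let $t\mapsto F^N(t)$, $t\ge 0$, be the (mild, trace-norm continuous) solution of the $N$-body von Neumann equation $$i\hbar\,\partial_tF^N(t)=[H_N,F^N(t)],\qquad F^N(0)=F_0^{\otimes N},\qquad H_N=-\tfrac12\hbar^2\sum_{k=1}^N\Delta_{x_k}+\frac1{2N}\sum_{k,l=1}^N\Phi(x_k-x_l).$$ For $1\le j\le N$, let $F^N_j(t)$ be the $j$-particle marginal of $F^N(t)$,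 i.e. the trace-class operator on $\mathfrak H_j$ such that $$\operatorname{trace}\big[F^N(t)(A_1\otimes\cdots\otimes A_j\otimes I_{\mathfrak H_{N-j}})\big]=\operatorname{trace}\big[F^N_j(t)(A_1\otimes\cdots\otimes A_j)\big]$$ for all bounded operators $A_1,\dots,A_j$ on $\mathfrak H$. Then, for each $j\ge 1$, there exists $N_0(j)\ge 1$, depending only on $j$, such that $$\|F^N_j(t)-F(t)^{\otimes j}\|_{\mathcal L^1(\mathfrak H_j)}\le\frac{2^{\,j+1+16t\|\Phi\|_{L^\infty}/\hbar}}{N^{\,2^{-1-16t\|\Phi\|_{L^\infty}/\hbar}\,\log 2}}$$ for all $t\ge 0$ and all integers $N\ge\max\Big(N_0(j),\exp\big(2^{16\|\Phi\|_{L^\infty}t/\hbar+1}\,j\big)\Big)$. -/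

import Mathlib

open MeasureTheory Filter Topology
open scoped ENNReal FourierTransform

noncomputable section

namespace MeanField

/-! ### Trace and trace norm of operators on a Hilbert space -/

section Trace

variable {H : Type*} [NormedAddCommGroup H] [InnerProductSpace ℂ H] [CompleteSpace H]

/-- The index set of a chosen Hilbert basis of `H`. -/
def basisSet (H : Type*) [NormedAddCommGroup H] [InnerProductSpace ℂ H] [CompleteSpace H] :
    Set H :=
  (exists_hilbertBasis ℂ H).choose

/-- A chosen Hilbert basis of `H`. -/
def basis (H : Type*) [NormedAddCommGroup H] [InnerProductSpace ℂ H] [CompleteSpace H] :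
    HilbertBasis (basisSet H) ℂ H :=
  (exists_hilbertBasis ℂ H).choose_spec.choose

/-- The trace norm `trace |A|`, where `|A| = (A* A) ^ (1/2)`; it is `∞` exactly when `A` is not of
trace class. -/
def traceNorm (A : H →L[ℂ] H) : ℝ≥0∞ :=
  ∑' i, ENNReal.ofReal (inner ℂ (basis H i) (CFC.abs A (basis H i))).re

/-- The trace `∑ ⟨e_i, A e_i⟩`; it is only used for operators of trace class, for which the series
converges absolutely and does not depend on the basis. -/
def trace (A : H →L[ℂ] H) : ℂ :=
  ∑' i, inner ℂ (basis H i) (A (basis H i))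

/-- Density operators: nonnegative (in particular self-adjoint) operators of trace one. -/
structure IsDensityOperator (A : H →L[ℂ] H) : Prop where
  isPositive : A.IsPositive
  traceNorm_lt_top : traceNorm A < ∞
  trace_eq_one : trace A = 1

end Trace

/-! ### Operators on `L²` spaces -/

/-- The complex Hilbert space `L²(X)`. -/
abbrev L2 (X : Type*) [MeasureSpace X] : Type _ := Lp ℂ 2 (volume : Measure X)

/-- Bounded operators on `L²(X)`. -/
abbrev Op (X : Type*) [MeasureSpace X] : Type _ := L2 X →L[ℂ] L2 X

open Classical in
/-- The operator of multiplication by an essentially bounded function `f`. -/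
def mulOp {X : Type*} [MeasureSpace X] (f : X → ℂ) : Op X :=
  if h : MemLp f ∞ (volume : Measure X) then
    (ContinuousLinearMap.mul ℂ ℂ).holderL (volume : Measure X) ∞ 2 2 (h.toLp f)
  else 0

section Evolution

variable {X : Type*} [NormedAddCommGroup X] [InnerProductSpace ℝ X] [FiniteDimensional ℝ X]
  [MeasurableSpace X] [BorelSpace X]

/-- The free Schrödinger group `U(t) = exp (i ħ t Δ / 2)`, the solution of
`i ħ U'(t) = - (ħ² / 2) Δ U(t)`, `U(0) = 1`. With the convention
`𝓕 f ξ = ∫ exp (- 2 π i x · ξ) f x dx`, the Laplacian has the symbol `- 4 π² |ξ|²`. -/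
def freeGroup (ħ t : ℝ) : Op X :=
  (Lp.fourierTransformₗᵢ X ℂ).symm.toContinuousLinearEquiv.toContinuousLinearMap ∘L
    mulOp (fun ξ : X =>
      Complex.exp (-(2 * (Real.pi : ℂ) ^ 2 * Complex.I * (ħ : ℂ) * (t : ℂ) * ((‖ξ‖ ^ 2 : ℝ) : ℂ)))) ∘L
    (Lp.fourierTransformₗᵢ X ℂ).toContinuousLinearEquiv.toContinuousLinearMap

/-- The free evolution of operators, `S(t) A = U(t) A U(-t)`. -/
def freeEvolution (ħ t : ℝ) (A : Op X) : Op X :=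
  freeGroup ħ t ∘L A ∘L freeGroup ħ (-t)

/-- `D` is a (mild) solution on `[0, ∞)` of the von Neumann equation
`i ħ D'(t) = [- (ħ² / 2) Δ + W(t), D(t)]`, `D(0) = D₀`, where `W(t)` are bounded operators:
`D` is a continuous curve for the trace norm and satisfies
`D(t) = S(t) D₀ + (i ħ)⁻¹ ∫₀ᵗ S(t - τ) [W(τ), D(τ)] dτ`, the integral being taken in the weak
operator sense. -/
structure IsVonNeumannSolution (ħ : ℝ) (W : ℝ → Op X) (D₀ : Op X) (D : ℝ → Op X) : Prop where
  traceNorm_lt_top : ∀ t, 0 ≤ t → traceNorm (D t) < ∞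
  continuous : ∀ t, 0 ≤ t →
    Tendsto (fun s => traceNorm (D s - D t)) (𝓝[Set.Ici 0] t) (𝓝 0)
  duhamel : ∀ t, 0 ≤ t → ∀ φ ψ : L2 X,
    inner ℂ φ (D t ψ) = inner ℂ φ (freeEvolution ħ t D₀ ψ) +
      (Complex.I * (ħ : ℂ))⁻¹ * ∫ τ in (0 : ℝ)..t,
        inner ℂ φ (freeEvolution ħ (t - τ) (W τ ∘L D τ - D τ ∘L W τ) ψ)

end Evolution

/-! ### Many-particle spaces -/

/-- The one-particle space `ℝ^d`. -/
abbrev Space (d : ℕ) : Type := EuclideanSpace ℝ (Fin d)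

/-- The configuration space `(ℝ^d)^n = ℝ^(n d)` of `n` particles. -/
abbrev Conf (d n : ℕ) : Type := EuclideanSpace ℝ (Fin n × Fin d)

/-- The position `x_i ∈ ℝ^d` of the `i`-th particle in the configuration `x`. -/
def pos {d n : ℕ} (x : Conf d n) (i : Fin n) : Space d :=
  WithLp.toLp 2 fun k => x (i, k)

/-- Lebesgue measure on `(ℝ^d)^n` is the product of the Lebesgue measures on the factors. -/
theorem measurePreserving_pos (d n : ℕ) :
    MeasurePreserving (fun (x : Conf d n) (i : Fin n) => pos x i) := by
  have h1 : MeasurePreserving (MeasurableEquiv.curry (Fin n) (Fin d) ℝ) := by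
    refine MeasurePreserving.symm (MeasurableEquiv.curry (Fin n) (Fin d) ℝ).symm ⟨?_, ?_⟩
    · exact (MeasurableEquiv.curry (Fin n) (Fin d) ℝ).symm.measurable
    · refine (Measure.pi_eq fun s hs => ?_).symm
      rw [MeasurableEquiv.map_apply]
      have : (MeasurableEquiv.curry (Fin n) (Fin d) ℝ).symm ⁻¹' (Set.univ.pi s) =
          Set.univ.pi fun i => Set.univ.pi fun k => s (i, k) := by
        ext x
        simp [MeasurableEquiv.curry, Function.uncurry, Set.mem_pi]
      rw [this, volume_pi_pi]
      simp_rw [volume_pi_pi]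
      rw [Fintype.prod_prod_type]
  have h2 : MeasurePreserving
      (fun (y : Fin n → Fin d → ℝ) (i : Fin n) => (WithLp.toLp 2 (y i) : Space d)) :=
    volume_preserving_pi fun _ => PiLp.volume_preserving_toLp (Fin d)
  exact (h2.comp h1).comp (PiLp.volume_preserving_ofLp (Fin n × Fin d))

theorem memLp_tensor {d n : ℕ} (ψ : Fin n → L2 (Space d)) :
    MemLp (fun x : Conf d n => ∏ i, ψ i (pos x i)) 2 := by
  have hm := measurePreserving_pos d n
  have key : MemLp (fun y : Fin n → Space d => ∏ i, ψ i (y i)) 2 := by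
    have hmeas : AEStronglyMeasurable (fun y : Fin n → Space d => ∏ i, ψ i (y i)) volume := by
      refine Finset.aestronglyMeasurable_fun_prod _ fun i _ => ?_
      exact (Lp.aestronglyMeasurable (ψ i)).comp_quasiMeasurePreserving
        (Measure.quasiMeasurePreserving_eval _ i)
    rw [memLp_two_iff_integrable_sq_norm hmeas]
    simp_rw [norm_prod, ← Finset.prod_pow]
    exact Integrable.fintype_prod fun i =>
      (memLp_two_iff_integrable_sq_norm (Lp.aestronglyMeasurable (ψ i))).1 (Lp.memLp (ψ i))
  exact key.comp_measurePreserving hm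

/-- The vector `ψ₁ ⊗ ⋯ ⊗ ψ_n` of `L²((ℝ^d)^n)`, i.e. the function `x ↦ ∏ i, ψ_i (x_i)`. -/
def tensorVec {d n : ℕ} (ψ : Fin n → L2 (Space d)) : L2 (Conf d n) :=
  (memLp_tensor ψ).toLp _

open Classical in
/-- The operator `A₁ ⊗ ⋯ ⊗ A_n` on `L²((ℝ^d)^n) = L²(ℝ^d)^{⊗ n}`: the unique bounded operator that
maps `ψ₁ ⊗ ⋯ ⊗ ψ_n` to `A₁ ψ₁ ⊗ ⋯ ⊗ A_n ψ_n`. -/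
def tensorOp {d n : ℕ} (A : Fin n → Op (Space d)) : Op (Conf d n) :=
  if h : ∃ T : Op (Conf d n), ∀ ψ : Fin n → L2 (Space d),
      T (tensorVec ψ) = tensorVec fun i => A i (ψ i) then h.choose else 0

/-- The tensor power `A^{⊗ n}`. -/
def tensorPow {d : ℕ} (A : Op (Space d)) (n : ℕ) : Op (Conf d n) :=
  tensorOp fun _ => A

/-- The family `A₁, …, A_j, I, …, I` of `N` operators. -/
def extendByOne {d j : ℕ} (N : ℕ) (A : Fin j → Op (Space d)) : Fin N → Op (Space d) :=
  fun k => if h : k.val < j then A ⟨k.val, h⟩ else ContinuousLinearMap.id ℂ _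

/-- `Dj` is the `j`-particle marginal of the `N`-particle operator `D`. -/
def IsMarginal {d N j : ℕ} (D : Op (Conf d N)) (Dj : Op (Conf d j)) : Prop :=
  traceNorm Dj < ∞ ∧ ∀ A : Fin j → Op (Space d),
    trace (D ∘L tensorOp (extendByOne N A)) = trace (Dj ∘L tensorOp A)

open Classical in
/-- The `j`-particle marginal of the `N`-particle trace-class operator `D` (for `j ≤ N`): the unique
trace-class operator `D_j` with
`trace (D (A₁ ⊗ ⋯ ⊗ A_j ⊗ I ⊗ ⋯ ⊗ I)) = trace (D_j (A₁ ⊗ ⋯ ⊗ A_j))` for all bounded `A_i`. -/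
def marginal {d N : ℕ} (j : ℕ) (D : Op (Conf d N)) : Op (Conf d j) :=
  if h : ∃ Dj : Op (Conf d j), IsMarginal D Dj then h.choose else 0

/-! ### The `N`-body equation and the Hartree equation -/

/-- The mean-field potential `V_N(x) = (1 / 2N) ∑_{k, l} Φ(x_k - x_l)`. -/
def meanFieldPotential {d : ℕ} (Φ : Space d → ℝ) (N : ℕ) (x : Conf d N) : ℝ :=
  1 / (2 * (N : ℝ)) * ∑ k : Fin N, ∑ l : Fin N, Φ (pos x k - pos x l)

/-- `D` solves `i ħ D' = [H_N, D]`, `D(0) = D₀`, with `H_N = - (ħ² / 2) Δ + V_N`. -/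
def IsNBodySolution {d : ℕ} (ħ : ℝ) (Φ : Space d → ℝ) (N : ℕ) (D₀ : Op (Conf d N))
    (D : ℝ → Op (Conf d N)) : Prop :=
  IsVonNeumannSolution ħ (fun _ => mulOp fun x => (meanFieldPotential Φ N x : ℂ)) D₀ D

/-- `ρ ∈ L¹(ℝ^d)` is the position density `ρ(x) = F(x, x)` of the trace-class operator `F`, i.e.
`∫ f ρ = trace (f F)` for every essentially bounded function `f`, acting by multiplication.
This determines `ρ` almost everywhere. -/
def IsPositionDensity {d : ℕ} (F : Op (Space d)) (ρ : Space d → ℂ) : Prop :=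
  Integrable ρ ∧ ∀ f : Space d → ℂ, MemLp f ∞ → ∫ x, f x * ρ x = trace (mulOp f ∘L F)

/-- The mean-field potential `Φ ⋆ ρ`. -/
def hartreePotential {d : ℕ} (Φ : Space d → ℝ) (ρ : Space d → ℂ) : Space d → ℂ :=
  convolution Φ ρ (ContinuousLinearMap.lsmul ℝ ℝ) volume

/-- `F` solves the Hartree equation `i ħ F' = [- (ħ² / 2) Δ + Φ ⋆ ρ_F, F]`, `F(0) = F₀`, where
`ρ_F(t, x) = F(t, x, x)`. -/
def IsHartreeSolution {d : ℕ} (ħ : ℝ) (Φ : Space d → ℝ) (F₀ : Op (Space d))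
    (F : ℝ → Op (Space d)) : Prop :=
  ∃ ρ : ℝ → Space d → ℂ, (∀ t, 0 ≤ t → IsPositionDensity (F t) (ρ t)) ∧
    IsVonNeumannSolution ħ (fun t => mulOp (hartreePotential Φ (ρ t))) F₀ F

/-- The norm of `Φ` in `L^∞(ℝ^d)`. -/
def supNorm {d : ℕ} (Φ : Space d → ℝ) : ℝ :=
  (eLpNorm Φ ∞ volume).toReal

end MeanField

end

/-!
# Convergence of the `N`-body von Neumann equation to the Hartree equation in trace norm

The estimate is obtained in the dual formulation: the trace norm of a trace class operator `D` is the
supremum of `|trace (B D)|` over the contractions `B`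
(`MeanField.TraceClass.exists_tr_rmul_eq_norm`). For the marginals this means that only expectations
of observables of the first `j` particles have to be compared
(`MeanField.traceNorm_marginal_sub_le`). An observable of a set `S` of particles is encoded as an
operator that commutes with all one-particle operators at the other sites (`MeanField.IsLocal`).

*Dynamics.* After conjugation with the free Schrödinger group, both mild equations become ordinary
differential equations in the Banach space of trace class operators, with bounded generators
(`MeanField.IsVonNeumannSolution.exists_interaction`). Commutators with self-adjoint potentials do not
increase the trace norm (`MeanField.norm_le_of_hasDerivAt_comm`). For the Hartree equation,
self-adjointness of the potential is not part of the notion of a solution; it follows from a Gronwall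
argument, as the potential depends on the state in a Lipschitz manner
(`MeanField.adj_eq_of_hartree`). Thus all states stay in the unit ball.

*Hierarchy.* In a product state, the potential `Φ(x_k - x_l)` may be replaced by its average
`(Φ ⋆ ρ)(x_k)` inside expectations with operators that do not act on the particle `l`
(`MeanField.tr_tensorTC_pairOp`). Let `Δ_B(t)` be the difference of the expectations of an observable
`B` of a set `S` of `j` particles in the `N`-body state and in the product of Hartree states. In its derivative,
pairs of particles outside `S` drop out, the pairs inside `S` contribute `O(j² / N)`, and the
averaging identity turns each remaining pair into a `Δ` for an observable of `j + 1` particles. With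
`κ = ‖Φ‖ / ħ` the result is
`|d/dt Δ_B| ≤ κ (2 j sup |Δ_C| + 3 j² / N) ‖B‖`, where the supremum is over the observables `C` of norm at
most one of the particles in `S` and one further particle
(`MeanField.exists_hasDerivAt_deviation`).

*Rate.* On a time interval of length `1 / (8 κ)` the hierarchy has a supersolution `ε(t) r(t) ^ j` with
`r` growing from `2` to `4` (`MeanField.SatisfiesHierarchy.norm_le`). The geometric mean with the
trivial bound `|Δ_B| ≤ 2 ‖B‖` turns `4 ^ j` back into `2 ^ j` and halves the exponent of `N`, so that the
argument can be repeated (`MeanField.SatisfiesHierarchy.norm_le_iterate`). After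
`⌊8 κ t⌋ + 1` steps the bound `4 N ^ (-2 ^ (-⌊8 κ t⌋ - 1)) 2 ^ j` is reached, which is at most the
asserted rate as soon as `N ≥ 128` (`MeanField.iterate_bound_le`).
-/

noncomputable section

set_option linter.unusedSectionVars false

namespace MeanField

/-! ### Polar decomposition and nuclear representations -/

section Nuclear

variable {H : Type*} [NormedAddCommGroup H] [InnerProductSpace ℂ H] [CompleteSpace H]

theorem isPositive_abs (A : H →L[ℂ] H) : (CFC.abs A).IsPositive :=
  (ContinuousLinearMap.nonneg_iff_isPositive _).1 (CFC.abs_nonneg A)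

theorem inner_abs_abs (A : H →L[ℂ] H) (x y : H) :
    inner ℂ (CFC.abs A x) (CFC.abs A y) = inner ℂ (A x) (A y) := by
  have h1 : CFC.abs A (CFC.abs A y) = (ContinuousLinearMap.adjoint A) (A y) := by
    have := congrArg (fun T : H →L[ℂ] H => T y) (CFC.abs_mul_abs A)
    simpa [ContinuousLinearMap.star_eq_adjoint] using this
  rw [(isPositive_abs A).inner_left_eq_inner_right, h1, ContinuousLinearMap.adjoint_inner_right]

theorem norm_abs_apply (A : H →L[ℂ] H) (x : H) : ‖CFC.abs A x‖ = ‖A x‖ := by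
  have h := inner_abs_abs A x x
  simp only [inner_self_eq_norm_sq_to_K] at h
  have h2 : ‖CFC.abs A x‖ ^ 2 = ‖A x‖ ^ 2 := by exact_mod_cast h
  exact (sq_eq_sq₀ (norm_nonneg _) (norm_nonneg _)).1 h2

/-- Polar decomposition: `A = U |A|` and `|A| = U* A` for a contraction `U`, which is isometric on
the closure of the range of `|A|` and vanishes on its orthogonal complement. -/
theorem exists_polar (A : H →L[ℂ] H) : ∃ U : H →L[ℂ] H, ‖U‖ ≤ 1 ∧
    (∀ x, U (CFC.abs A x) = A x) ∧ ∀ x y, inner ℂ (U x) (A y) = inner ℂ x (CFC.abs A y) := by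
  set P := CFC.abs A with hP
  let K : Submodule ℂ H := (LinearMap.range P.toLinearMap).topologicalClosure
  have hPK : ∀ x, P x ∈ K := fun x => Submodule.le_topologicalClosure _ ⟨x, rfl⟩
  have : CompleteSpace K := (Submodule.isClosed_topologicalClosure _).completeSpace_coe
  let e : H →ₗ[ℂ] K := P.toLinearMap.codRestrict K hPK
  have he : DenseRange e := by
    intro y
    rw [Metric.mem_closure_iff]
    intro ε hε
    obtain ⟨z, ⟨x, rfl⟩, hz⟩ := Metric.mem_closure_iff.1 y.2 ε hε
    exact ⟨e x, ⟨x, rfl⟩, hz⟩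
  have hn : ∀ x, ‖A.toLinearMap x‖ ≤ 1 * ‖e x‖ := fun x => by
    rw [one_mul]
    exact (norm_abs_apply A x).symm.le
  let V : K →L[ℂ] H := A.toLinearMap.extendOfNorm e
  have hV : ∀ x, V (e x) = A x := fun x => LinearMap.extendOfNorm_eq he ⟨1, hn⟩ x
  have hV1 : ‖V‖ ≤ 1 := LinearMap.opNorm_extendOfNorm_le he zero_le_one hn
  have hUP : ∀ x, (V ∘L K.orthogonalProjectionOnto) (P x) = A x := by
    intro x
    have : K.orthogonalProjectionOnto (P x) = e x :=
      Submodule.orthogonalProjectionOnto_mem_subspace_eq_self (e x)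
    simp [this, hV]
  refine ⟨V ∘L K.orthogonalProjectionOnto, ?_, hUP, ?_⟩
  · refine (ContinuousLinearMap.opNorm_comp_le _ _).trans ?_
    calc ‖V‖ * ‖K.orthogonalProjectionOnto‖ ≤ 1 * 1 :=
          by
            gcongr
            exact K.orthogonalProjectionOnto_norm_le
      _ = 1 := one_mul 1
  · intro x y
    have key : ∀ k : K, inner ℂ (V k) (A y) = inner ℂ (k : H) (P y) := by
      intro k
      refine he.induction_on (p := fun k : K => inner ℂ (V k) (A y) = inner ℂ (k : H) (P y)) k
        (isClosed_eq (by fun_prop) (by fun_prop)) fun z => ?_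
      rw [hV]
      exact (inner_abs_abs A z y).symm
    rw [ContinuousLinearMap.comp_apply, key]
    have h2 := K.inner_starProjection_left_eq_right x (P y)
    rw [Submodule.starProjection_eq_self_iff.2 (hPK y)] at h2
    exact h2

/-- `A = ∑ |a_i⟩⟨b_i|` in the weak sense, with `∑ ‖a_i‖ ‖b_i‖ < ∞`. -/
structure IsNuclearRep {ι : Type*} (A : H →L[ℂ] H) (a b : ι → H) : Prop where
  summable : Summable fun i => ‖a i‖ * ‖b i‖
  hasSum : ∀ x y, HasSum (fun i => inner ℂ x (a i) * inner ℂ (b i) y) (inner ℂ x (A y))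

/-- Bessel's inequality in the form `∑ |⟨x, e_i⟩ ⟨e_i, y⟩| ≤ ‖x‖ ‖y‖`. -/
theorem summable_and_tsum_norm_inner_mul_inner_le {κ : Type*} {e : κ → H} (he : Orthonormal ℂ e)
    (x y : H) :
    Summable (fun i => ‖inner ℂ x (e i)‖ * ‖inner ℂ (e i) y‖) ∧
      ∑' i, ‖inner ℂ x (e i)‖ * ‖inner ℂ (e i) y‖ ≤ ‖x‖ * ‖y‖ := by
  have hx := he.inner_products_summable x
  have hy := he.inner_products_summable y
  have hx1 : ∑' i, ‖inner ℂ (e i) x‖ ^ 2 ≤ ‖x‖ ^ 2 := Orthonormal.tsum_inner_products_le x he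
  have hy1 : ∑' i, ‖inner ℂ (e i) y‖ ^ 2 ≤ ‖y‖ ^ 2 := Orthonormal.tsum_inner_products_le y he
  have h := Real.summable_and_inner_le_Lp_mul_Lq_tsum_of_nonneg Real.HolderConjugate.two_two
    (f := fun i => ‖inner ℂ x (e i)‖) (g := fun i => ‖inner ℂ (e i) y‖)
    (fun i => norm_nonneg _) (fun i => norm_nonneg _)
    (by simpa [norm_inner_symm x] using hx) (by simpa using hy)
  refine ⟨h.1, h.2.trans ?_⟩
  simp only [Real.rpow_ofNat, norm_inner_symm x]
  rw [← Real.sqrt_eq_rpow, ← Real.sqrt_eq_rpow]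
  refine mul_le_mul ?_ ?_ (Real.sqrt_nonneg _) (norm_nonneg _)
  · exact Real.sqrt_le_iff.2 ⟨norm_nonneg _, hx1⟩
  · exact Real.sqrt_le_iff.2 ⟨norm_nonneg _, hy1⟩

/-- The trace of a nuclear operator, computed in any Hilbert basis. The series converges absolutely. -/
theorem IsNuclearRep.hasSum_basis {ι κ : Type*} {A : H →L[ℂ] H} {a b : ι → H}
    (h : IsNuclearRep A a b) (e : HilbertBasis κ ℂ H) :
    HasSum (fun k => inner ℂ (e k) (A (e k))) (∑' i, inner ℂ (b i) (a i)) := by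
  have hs : Summable fun p : ι × κ =>
      inner ℂ (e p.2) (a p.1) * inner ℂ (b p.1) (e p.2) := by
    apply Summable.of_norm
    rw [summable_prod_of_nonneg (fun p => norm_nonneg _)]
    have hb := fun i => summable_and_tsum_norm_inner_mul_inner_le e.orthonormal (b i) (a i)
    constructor
    · intro i
      simpa [mul_comm] using (hb i).1
    · refine Summable.of_nonneg_of_le (fun i => tsum_nonneg fun k => norm_nonneg _) (fun i => ?_)
        h.summable
      have := (hb i).2
      simp only [norm_mul]
      rw [mul_comm ‖a i‖]
      simpa [mul_comm] using this
  have h1 : HasSum (fun i => inner ℂ (b i) (a i))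
      (∑' p : ι × κ, inner ℂ (e p.2) (a p.1) * inner ℂ (b p.1) (e p.2)) := by
    refine hs.hasSum.prod_fiberwise fun i => ?_
    simpa [mul_comm] using e.hasSum_inner_mul_inner (b i) (a i)
  rw [h1.tsum_eq]
  have h2 := (Equiv.prodComm κ ι).hasSum_iff.2 hs.hasSum
  exact h2.prod_fiberwise fun k => h.hasSum (e k) (e k)

theorem IsNuclearRep.trace_eq {ι : Type*} {A : H →L[ℂ] H} {a b : ι → H}
    (h : IsNuclearRep A a b) : trace A = ∑' i, inner ℂ (b i) (a i) :=
  (h.hasSum_basis (basis H)).tsum_eq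

theorem IsNuclearRep.norm_trace_le {ι : Type*} {A : H →L[ℂ] H} {a b : ι → H}
    (h : IsNuclearRep A a b) : ‖trace A‖ ≤ ∑' i, ‖a i‖ * ‖b i‖ := by
  rw [h.trace_eq]
  exact tsum_of_norm_bounded h.summable.hasSum fun i =>
    (norm_inner_le_norm _ _).trans (mul_comm _ _).le

theorem IsNuclearRep.comp_left {ι : Type*} {A : H →L[ℂ] H} {a b : ι → H}
    (h : IsNuclearRep A a b) (B : H →L[ℂ] H) : IsNuclearRep (B ∘L A) (fun i => B (a i)) b where
  summable := Summable.of_nonneg_of_le (fun i => by positivity)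
    (fun i => by
      rw [← mul_assoc]
      exact mul_le_mul_of_nonneg_right (B.le_opNorm _) (norm_nonneg _)) (h.summable.mul_left ‖B‖)
  hasSum x y := by
    simpa [ContinuousLinearMap.adjoint_inner_left] using
      h.hasSum (ContinuousLinearMap.adjoint B x) y

theorem IsNuclearRep.comp_right {ι : Type*} {A : H →L[ℂ] H} {a b : ι → H}
    (h : IsNuclearRep A a b) (B : H →L[ℂ] H) :
    IsNuclearRep (A ∘L B) a (fun i => ContinuousLinearMap.adjoint B (b i)) where
  summable := Summable.of_nonneg_of_le (fun i => by positivity)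
    (fun i => by
      have := (ContinuousLinearMap.adjoint B).le_opNorm (b i)
      rw [LinearIsometryEquiv.norm_map] at this
      calc _ ≤ ‖a i‖ * (‖B‖ * ‖b i‖) := mul_le_mul_of_nonneg_left this (norm_nonneg _)
        _ = ‖B‖ * (‖a i‖ * ‖b i‖) := by ring) (h.summable.mul_left ‖B‖)
  hasSum x y := by
    simpa [ContinuousLinearMap.adjoint_inner_left] using h.hasSum x (B y)

theorem IsNuclearRep.adjoint {ι : Type*} {A : H →L[ℂ] H} {a b : ι → H}
    (h : IsNuclearRep A a b) : IsNuclearRep (ContinuousLinearMap.adjoint A) b a where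
  summable := by simpa [mul_comm] using h.summable
  hasSum x y := by
    have := (h.hasSum y x).map (starRingEnd ℂ) Complex.continuous_conj
    simpa [Function.comp_def, mul_comm, ContinuousLinearMap.adjoint_inner_right] using this

/-- The trace norm is at most the cost `∑ ‖a_i‖ ‖b_i‖` of any nuclear representation. -/
theorem IsNuclearRep.traceNorm_le {ι : Type*} {A : H →L[ℂ] H} {a b : ι → H}
    (h : IsNuclearRep A a b) : traceNorm A ≤ ENNReal.ofReal (∑' i, ‖a i‖ * ‖b i‖) := by
  obtain ⟨U, hU1, -, hU⟩ := exists_polar A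
  have h2 := h.comp_left (ContinuousLinearMap.adjoint U)
  have hs := h2.hasSum_basis (basis H)
  have h3 : ∀ k, inner ℂ (basis H k) ((ContinuousLinearMap.adjoint U ∘L A) (basis H k)) =
      inner ℂ (basis H k) (CFC.abs A (basis H k)) := fun k => by
    rw [← hU, ContinuousLinearMap.comp_apply, ContinuousLinearMap.adjoint_inner_right]
  simp_rw [h3] at hs
  have hre := Complex.hasSum_re hs
  have hpos : ∀ k, 0 ≤ (inner ℂ (basis H k) (CFC.abs A (basis H k))).re :=
    fun k => (isPositive_abs A).re_inner_nonneg_right _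
  rw [traceNorm, ← ENNReal.ofReal_tsum_of_nonneg hpos hre.summable, hre.tsum_eq]
  apply ENNReal.ofReal_le_ofReal
  refine (Complex.re_le_norm _).trans ?_
  refine tsum_of_norm_bounded h.summable.hasSum fun i => ?_
  rw [ContinuousLinearMap.adjoint_inner_right, mul_comm]
  refine (norm_inner_le_norm _ _).trans (mul_le_mul_of_nonneg_right ?_ (norm_nonneg _))
  exact (U.le_opNorm _).trans (mul_le_of_le_one_left (norm_nonneg _) hU1)

/-- An operator of trace class has the nuclear representation
`∑ |U |A|^{1/2} e_i⟩⟨|A|^{1/2} e_i|`, which realizes the trace norm. -/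
theorem exists_isNuclearRep {A : H →L[ℂ] H} (hA : traceNorm A < ∞) :
    ∃ a b : basisSet H → H, IsNuclearRep A a b ∧
      ∑' i, ‖a i‖ * ‖b i‖ ≤ (traceNorm A).toReal := by
  obtain ⟨U, hU1, hUA, -⟩ := exists_polar A
  set P := CFC.abs A
  set Q : H →L[ℂ] H := CFC.sqrt P
  have hQ : Q.IsPositive := (ContinuousLinearMap.nonneg_iff_isPositive _).1 (CFC.sqrt_nonneg P)
  have hQQ : Q * Q = P := CFC.sqrt_mul_sqrt_self P (CFC.abs_nonneg A)
  have hn : ∀ x, (inner ℂ x (P x)).re = ‖Q x‖ ^ 2 := fun x => by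
    rw [← hQQ, mul_apply_eq_comp, ← hQ.inner_left_eq_inner_right]
    exact inner_self_eq_norm_sq (𝕜 := ℂ) (Q x)
  have htr : traceNorm A = ∑' i, ENNReal.ofReal (‖Q (basis H i)‖ ^ 2) :=
    tsum_congr fun i => by rw [← hn]
  have hsum : Summable fun i => ‖Q (basis H i)‖ ^ 2 := by
    have := ENNReal.summable_toReal (htr ▸ hA.ne)
    simpa [ENNReal.toReal_ofReal, sq_nonneg] using this
  have hle : ∀ i, ‖U (Q (basis H i))‖ * ‖Q (basis H i)‖ ≤ ‖Q (basis H i)‖ ^ 2 := fun i => by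
    rw [sq]
    exact mul_le_mul_of_nonneg_right
      ((U.le_opNorm _).trans (mul_le_of_le_one_left (norm_nonneg _) hU1)) (norm_nonneg _)
  refine ⟨fun i => U (Q (basis H i)), fun i => Q (basis H i), ⟨?_, ?_⟩, ?_⟩
  · exact Summable.of_nonneg_of_le (fun i => by positivity) hle hsum
  · intro x y
    have h := (basis H).hasSum_inner_mul_inner (Q (ContinuousLinearMap.adjoint U x)) (Q y)
    have h2 : inner ℂ (Q (ContinuousLinearMap.adjoint U x)) (Q y) = inner ℂ x (A y) := by
      rw [hQ.inner_left_eq_inner_right, ← mul_apply_eq_comp, hQQ,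
        ContinuousLinearMap.adjoint_inner_left, hUA]
    rw [h2] at h
    have h3 : ∀ i, inner ℂ x (U (Q (basis H i))) * inner ℂ (Q (basis H i)) y =
        inner ℂ (Q (ContinuousLinearMap.adjoint U x)) (basis H i) * inner ℂ (basis H i) (Q y) := by
      intro i
      rw [hQ.inner_left_eq_inner_right (basis H i) y,
        hQ.inner_left_eq_inner_right (ContinuousLinearMap.adjoint U x),
        ContinuousLinearMap.adjoint_inner_left]
    simpa only [h3] using h
  · rw [htr, ← ENNReal.ofReal_tsum_of_nonneg (fun i => sq_nonneg _) hsum,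
      ENNReal.toReal_ofReal (tsum_nonneg fun i => sq_nonneg _)]
    exact Summable.tsum_le_tsum hle
      (Summable.of_nonneg_of_le (fun i => by positivity) hle hsum) hsum

theorem IsNuclearRep.norm_le {ι : Type*} {A : H →L[ℂ] H} {a b : ι → H}
    (h : IsNuclearRep A a b) : ‖A‖ ≤ ∑' i, ‖a i‖ * ‖b i‖ := by
  refine ContinuousLinearMap.opNorm_le_of_re_inner_le (tsum_nonneg fun i => by positivity)
    fun x y hx hy => ?_
  refine (RCLike.re_le_norm _).trans ?_
  rw [norm_inner_symm, ← (h.hasSum y x).tsum_eq]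
  refine tsum_of_norm_bounded h.summable.hasSum fun i => ?_
  rw [norm_mul]
  refine mul_le_mul ?_ ?_ (norm_nonneg _) (norm_nonneg _)
  · exact (norm_inner_le_norm _ _).trans (by rw [hy, one_mul])
  · exact (norm_inner_le_norm _ _).trans (by rw [hx, mul_one])

/-- The trace is cyclic. -/
theorem IsNuclearRep.trace_comp_comm {ι : Type*} {A : H →L[ℂ] H} {a b : ι → H}
    (h : IsNuclearRep A a b) (B : H →L[ℂ] H) : trace (A ∘L B) = trace (B ∘L A) := by
  rw [(h.comp_left B).trace_eq, (h.comp_right B).trace_eq]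
  simp [ContinuousLinearMap.adjoint_inner_left]

/-- The trace norm of `A` is attained by pairing `A` with a contraction. -/
theorem exists_trace_comp_eq_traceNorm {A : H →L[ℂ] H} (hA : traceNorm A < ∞) :
    ∃ B : H →L[ℂ] H, ‖B‖ ≤ 1 ∧ trace (A ∘L B) = ((traceNorm A).toReal : ℂ) := by
  obtain ⟨U, hU1, -, hU⟩ := exists_polar A
  obtain ⟨a, b, hab, -⟩ := exists_isNuclearRep hA
  refine ⟨ContinuousLinearMap.adjoint U, by simpa using hU1, ?_⟩
  rw [hab.trace_comp_comm, trace]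
  have h3 : ∀ k, inner ℂ (basis H k) ((ContinuousLinearMap.adjoint U ∘L A) (basis H k)) =
      (((ENNReal.ofReal (inner ℂ (basis H k) (CFC.abs A (basis H k))).re).toReal : ℝ) : ℂ) := by
    intro k
    have hp := (isPositive_abs A).inner_nonneg_right (basis H k)
    rw [Complex.nonneg_iff] at hp
    rw [ContinuousLinearMap.comp_apply, ContinuousLinearMap.adjoint_inner_right, hU,
      ENNReal.toReal_ofReal hp.1]
    exact Complex.ext rfl hp.2.symm
  simp_rw [h3]
  rw [← Complex.ofReal_tsum, traceNorm, ENNReal.tsum_toReal_eq fun k => ENNReal.ofReal_ne_top]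

end Nuclear

/-! ### The normed space of trace class operators -/

section TraceClass

variable {H : Type*} [NormedAddCommGroup H] [InnerProductSpace ℂ H] [CompleteSpace H]

theorem IsNuclearRep.add {ι κ : Type*} {A B : H →L[ℂ] H} {a b : ι → H} {c d : κ → H}
    (h : IsNuclearRep A a b) (h' : IsNuclearRep B c d) :
    IsNuclearRep (A + B) (Sum.elim a c) (Sum.elim b d) where
  summable := (HasSum.sum (f := fun i => ‖Sum.elim a c i‖ * ‖Sum.elim b d i‖)
    h.summable.hasSum h'.summable.hasSum).summable
  hasSum x y := by
    rw [add_apply, inner_add_right]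
    exact HasSum.sum (f := fun i => inner ℂ x (Sum.elim a c i) * inner ℂ (Sum.elim b d i) y)
      (h.hasSum x y) (h'.hasSum x y)

theorem IsNuclearRep.traceNorm_lt_top {ι : Type*} {A : H →L[ℂ] H} {a b : ι → H}
    (h : IsNuclearRep A a b) : traceNorm A < ∞ :=
  h.traceNorm_le.trans_lt ENNReal.ofReal_lt_top

theorem isNuclearRep_zero : IsNuclearRep (0 : H →L[ℂ] H) (fun _ : Empty => 0) (fun _ => 0) where
  summable := summable_empty
  hasSum x y := by simp

theorem isNuclearRep_rankOne (x y : H) :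
    IsNuclearRep (InnerProductSpace.rankOne ℂ x y) (fun _ : Unit => x) (fun _ => y) where
  summable := (hasSum_unique _).summable
  hasSum u v := by
    simp [mul_comm]

/-- The operators of trace class, as a subspace of the bounded operators. -/
def traceClassSubmodule (H : Type*) [NormedAddCommGroup H] [InnerProductSpace ℂ H]
    [CompleteSpace H] : Submodule ℂ (H →L[ℂ] H) where
  carrier := {A | traceNorm A < ∞}
  zero_mem' := isNuclearRep_zero.traceNorm_lt_top
  add_mem' hA hB := by
    obtain ⟨a, b, h, -⟩ := exists_isNuclearRep hA
    obtain ⟨c, d, h', -⟩ := exists_isNuclearRep hB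
    exact (h.add h').traceNorm_lt_top
  smul_mem' c A hA := by
    obtain ⟨a, b, h, -⟩ := exists_isNuclearRep hA
    have := h.comp_left (c • ContinuousLinearMap.id ℂ H)
    simpa using this.traceNorm_lt_top

/-- The space of trace class operators, normed by the trace norm. It is a type of its own, because
the subspace of `H →L[ℂ] H` would carry the operator norm. -/
structure TraceClass (H : Type*) [NormedAddCommGroup H] [InnerProductSpace ℂ H]
    [CompleteSpace H] where
  /-- A trace class operator from its underlying bounded operator. -/
  mk ::
  /-- The underlying bounded operator. -/
  op : H →L[ℂ] H
  traceNorm_op_lt_top : traceNorm op < ∞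

namespace TraceClass

@[simp] theorem op_mk (A : H →L[ℂ] H) (hA : traceNorm A < ∞) : (mk A hA).op = A := rfl

theorem op_injective : Function.Injective (op : TraceClass H → (H →L[ℂ] H)) := by
  rintro ⟨A, hA⟩ ⟨B, hB⟩ h
  congr

instance : Zero (TraceClass H) := ⟨⟨0, (traceClassSubmodule H).zero_mem⟩⟩
instance : Add (TraceClass H) :=
  ⟨fun A B => ⟨A.op + B.op, (traceClassSubmodule H).add_mem A.2 B.2⟩⟩
instance : Neg (TraceClass H) := ⟨fun A => ⟨-A.op, (traceClassSubmodule H).neg_mem A.2⟩⟩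
instance : Sub (TraceClass H) :=
  ⟨fun A B => ⟨A.op - B.op, (traceClassSubmodule H).sub_mem A.2 B.2⟩⟩
instance : SMul ℂ (TraceClass H) :=
  ⟨fun c A => ⟨c • A.op, (traceClassSubmodule H).smul_mem c A.2⟩⟩
instance : SMul ℕ (TraceClass H) :=
  ⟨fun c A => ⟨c • A.op, (traceClassSubmodule H).toAddSubmonoid.nsmul_mem A.2 c⟩⟩
instance : SMul ℤ (TraceClass H) :=
  ⟨fun c A => ⟨c • A.op, (traceClassSubmodule H).toAddSubgroup.zsmul_mem A.2 c⟩⟩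

@[simp] theorem op_zero : (0 : TraceClass H).op = 0 := rfl
@[simp] theorem op_add (A B : TraceClass H) : (A + B).op = A.op + B.op := rfl
@[simp] theorem op_sub (A B : TraceClass H) : (A - B).op = A.op - B.op := rfl
@[simp] theorem op_smul (c : ℂ) (A : TraceClass H) : (c • A).op = c • A.op := rfl

instance : AddCommGroup (TraceClass H) :=
  op_injective.addCommGroup op rfl (fun _ _ => rfl) (fun _ => rfl) (fun _ _ => rfl)
    (fun _ _ => rfl) (fun _ _ => rfl)

/-- The inclusion into the bounded operators as an additive map. -/
def opHom : TraceClass H →+ (H →L[ℂ] H) where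
  toFun := op
  map_zero' := rfl
  map_add' _ _ := rfl

instance : Module ℂ (TraceClass H) := op_injective.module ℂ opHom fun _ _ => rfl

@[simp] theorem op_sum {ι : Type*} (s : Finset ι) (A : ι → TraceClass H) :
    (∑ i ∈ s, A i).op = ∑ i ∈ s, (A i).op := map_sum opHom A s

instance : Norm (TraceClass H) := ⟨fun A => (traceNorm A.op).toReal⟩

theorem norm_def (A : TraceClass H) : ‖A‖ = (traceNorm A.op).toReal := rfl

theorem ofReal_norm (A : TraceClass H) : ENNReal.ofReal ‖A‖ = traceNorm A.op :=
  ENNReal.ofReal_toReal A.traceNorm_op_lt_top.ne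

theorem exists_rep (A : TraceClass H) : ∃ a b : basisSet H → H, IsNuclearRep A.op a b ∧
    ∑' i, ‖a i‖ * ‖b i‖ ≤ ‖A‖ :=
  exists_isNuclearRep A.traceNorm_op_lt_top

theorem _root_.MeanField.IsNuclearRep.norm_traceClass_le {ι : Type*} {A : TraceClass H} {a b : ι → H}
    (h : IsNuclearRep A.op a b) : ‖A‖ ≤ ∑' i, ‖a i‖ * ‖b i‖ :=
  ENNReal.toReal_le_of_le_ofReal (tsum_nonneg fun i => by positivity) h.traceNorm_le

theorem norm_op_le (A : TraceClass H) : ‖A.op‖ ≤ ‖A‖ := by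
  obtain ⟨a, b, h, h'⟩ := A.exists_rep
  exact h.norm_le.trans h'

theorem norm_trace_le (A : TraceClass H) : ‖trace A.op‖ ≤ ‖A‖ := by
  obtain ⟨a, b, h, h'⟩ := A.exists_rep
  exact h.norm_trace_le.trans h'

/-- Left multiplication by a bounded operator, as a linear map. -/
def lmulₗ (B : H →L[ℂ] H) : TraceClass H →ₗ[ℂ] TraceClass H where
  toFun A := mk (B ∘L A.op) (by
    obtain ⟨a, b, h, -⟩ := A.exists_rep
    exact (h.comp_left B).traceNorm_lt_top)
  map_add' A A' := op_injective (by simp)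
  map_smul' c A := op_injective (by simp)

/-- Right multiplication by a bounded operator, as a linear map. -/
def rmulₗ (B : H →L[ℂ] H) : TraceClass H →ₗ[ℂ] TraceClass H where
  toFun A := mk (A.op ∘L B) (by
    obtain ⟨a, b, h, -⟩ := A.exists_rep
    exact (h.comp_right B).traceNorm_lt_top)
  map_add' A A' := op_injective (by simp)
  map_smul' c A := op_injective (by simp)

theorem norm_lmulₗ_le (B : H →L[ℂ] H) (A : TraceClass H) : ‖lmulₗ B A‖ ≤ ‖B‖ * ‖A‖ := by
  obtain ⟨a, b, h, h'⟩ := A.exists_rep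
  have h2 : IsNuclearRep (lmulₗ B A).op _ _ := h.comp_left B
  refine h2.norm_traceClass_le.trans ?_
  refine le_trans ?_ (mul_le_mul_of_nonneg_left h' (norm_nonneg B))
  rw [← tsum_mul_left]
  refine h2.summable.tsum_le_tsum (fun i => ?_) (h.summable.mul_left _)
  rw [← mul_assoc]
  exact mul_le_mul_of_nonneg_right (B.le_opNorm _) (norm_nonneg _)

theorem norm_rmulₗ_le (B : H →L[ℂ] H) (A : TraceClass H) : ‖rmulₗ B A‖ ≤ ‖B‖ * ‖A‖ := by
  obtain ⟨a, b, h, h'⟩ := A.exists_rep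
  have h2 : IsNuclearRep (rmulₗ B A).op _ _ := h.comp_right B
  refine h2.norm_traceClass_le.trans ?_
  refine le_trans ?_ (mul_le_mul_of_nonneg_left h' (norm_nonneg B))
  rw [← tsum_mul_left]
  refine h2.summable.tsum_le_tsum (fun i => ?_) (h.summable.mul_left _)
  have := (ContinuousLinearMap.adjoint B).le_opNorm (b i)
  rw [LinearIsometryEquiv.norm_map] at this
  calc _ ≤ ‖a i‖ * (‖B‖ * ‖b i‖) := mul_le_mul_of_nonneg_left this (norm_nonneg _)
    _ = ‖B‖ * (‖a i‖ * ‖b i‖) := by ring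

theorem core : NormedSpace.Core ℂ (TraceClass H) where
  norm_nonneg A := ENNReal.toReal_nonneg
  norm_smul c A := by
    have key : ∀ (c : ℂ) (A : TraceClass H), ‖c • A‖ ≤ ‖c‖ * ‖A‖ := fun c A => by
      have h1 : c • A = lmulₗ (c • ContinuousLinearMap.id ℂ H) A := op_injective (by simp [lmulₗ])
      rw [h1]
      refine (norm_lmulₗ_le _ _).trans (mul_le_mul_of_nonneg_right ?_ ENNReal.toReal_nonneg)
      rw [norm_smul]
      exact mul_le_of_le_one_right (norm_nonneg _) ContinuousLinearMap.norm_id_le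
    refine le_antisymm (key c A) ?_
    rcases eq_or_ne c 0 with rfl | hc
    · rw [norm_zero, zero_mul]
      exact ENNReal.toReal_nonneg
    · have := key c⁻¹ (c • A)
      rw [smul_smul, inv_mul_cancel₀ hc, one_smul, norm_inv] at this
      rwa [inv_mul_eq_div, le_div_iff₀ (norm_pos_iff.2 hc), mul_comm] at this
  norm_triangle A B := by
    obtain ⟨a, b, h, h1⟩ := A.exists_rep
    obtain ⟨c, d, h', h1'⟩ := B.exists_rep
    have h2 : IsNuclearRep (A + B).op _ _ := h.add h'
    refine h2.norm_traceClass_le.trans (le_trans (le_of_eq ?_) (add_le_add h1 h1'))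
    exact (HasSum.sum (f := fun i => ‖Sum.elim a c i‖ * ‖Sum.elim b d i‖)
      h.summable.hasSum h'.summable.hasSum).tsum_eq
  norm_eq_zero_iff A := by
    constructor
    · intro h
      apply op_injective
      have := norm_op_le A
      rw [h] at this
      simpa using this
    · rintro rfl
      have h := (isNuclearRep_zero (H := H)).traceNorm_le
      have h0 : traceNorm (0 : H →L[ℂ] H) = 0 := by simpa using h
      rw [norm_def, op_zero, h0, ENNReal.toReal_zero]

instance : NormedAddCommGroup (TraceClass H) := NormedAddCommGroup.ofCore core

instance : NormedSpace ℂ (TraceClass H) := NormedSpace.ofCore core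

/-- The trace as a continuous linear functional. -/
def tr : TraceClass H →L[ℂ] ℂ :=
  LinearMap.mkContinuous
    { toFun := fun A => trace A.op
      map_add' := fun A B => by
        obtain ⟨a, b, h, h1⟩ := A.exists_rep
        obtain ⟨c, d, h', h1'⟩ := B.exists_rep
        rw [op_add, trace, trace, trace, ← (h.hasSum_basis (basis H)).summable.tsum_add
          (h'.hasSum_basis (basis H)).summable]
        simp
      map_smul' := fun c A => by
        simp [trace, tsum_mul_left] } 1
    fun A => (norm_trace_le A).trans (one_mul _).ge

theorem tr_apply (A : TraceClass H) : tr A = trace A.op := rfl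

theorem norm_tr_le (A : TraceClass H) : ‖tr A‖ ≤ ‖A‖ := norm_trace_le A

/-- Left multiplication by a bounded operator. -/
def lmul (B : H →L[ℂ] H) : TraceClass H →L[ℂ] TraceClass H :=
  (lmulₗ B).mkContinuous ‖B‖ (norm_lmulₗ_le B)

/-- Right multiplication by a bounded operator. -/
def rmul (B : H →L[ℂ] H) : TraceClass H →L[ℂ] TraceClass H :=
  (rmulₗ B).mkContinuous ‖B‖ (norm_rmulₗ_le B)

@[simp] theorem op_lmul (B : H →L[ℂ] H) (A : TraceClass H) : (lmul B A).op = B ∘L A.op := rfl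

@[simp] theorem op_rmul (B : H →L[ℂ] H) (A : TraceClass H) : (rmul B A).op = A.op ∘L B := rfl

theorem norm_lmul_le (B : H →L[ℂ] H) (A : TraceClass H) : ‖lmul B A‖ ≤ ‖B‖ * ‖A‖ :=
  norm_lmulₗ_le B A

theorem norm_rmul_le (B : H →L[ℂ] H) (A : TraceClass H) : ‖rmul B A‖ ≤ ‖B‖ * ‖A‖ :=
  norm_rmulₗ_le B A

theorem tr_lmul (B : H →L[ℂ] H) (A : TraceClass H) : tr (lmul B A) = tr (rmul B A) := by
  obtain ⟨a, b, h, -⟩ := A.exists_rep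
  exact (h.trace_comp_comm B).symm

theorem norm_tr_rmul_le (B : H →L[ℂ] H) (A : TraceClass H) : ‖tr (rmul B A)‖ ≤ ‖B‖ * ‖A‖ :=
  (norm_tr_le _).trans (norm_rmul_le _ _)

/-- The trace norm is attained by pairing with a contraction. -/
theorem exists_tr_rmul_eq_norm (A : TraceClass H) :
    ∃ B : H →L[ℂ] H, ‖B‖ ≤ 1 ∧ tr (rmul B A) = (‖A‖ : ℂ) :=
  exists_trace_comp_eq_traceNorm A.traceNorm_op_lt_top

/-- The rank one operator `|x⟩⟨y|`. -/
def rankOne (x y : H) : TraceClass H :=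
  mk (InnerProductSpace.rankOne ℂ x y) (isNuclearRep_rankOne x y).traceNorm_lt_top

@[simp] theorem op_rankOne (x y : H) : (rankOne x y).op = InnerProductSpace.rankOne ℂ x y := rfl

theorem tr_rankOne (x y : H) : tr (rankOne x y) = inner ℂ y x := by
  rw [tr_apply, op_rankOne, (isNuclearRep_rankOne x y).trace_eq]
  simp

/-- The partial sums of a nuclear representation converge in trace norm. -/
theorem hasSum_rankOne {ι : Type*} {A : TraceClass H} {a b : ι → H}
    (h : IsNuclearRep A.op a b) : HasSum (fun i => rankOne (a i) (b i)) A := by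
  have hsum : ∀ s : Finset ι, ‖A - ∑ i ∈ s, rankOne (a i) (b i)‖ ≤
      ∑' i : {i // i ∉ s}, ‖a i‖ * ‖b i‖ := by
    intro s
    have hrep : IsNuclearRep (A - ∑ i ∈ s, rankOne (a i) (b i)).op
        (fun i : {i // i ∉ s} => a i) (fun i => b i) := by
      refine ⟨h.summable.subtype _, fun x y => ?_⟩
      have h2 : inner ℂ x ((A - ∑ i ∈ s, rankOne (a i) (b i)).op y) =
          inner ℂ x (A.op y) - ∑ i ∈ s, inner ℂ x (a i) * inner ℂ (b i) y := by
        simp [mul_comm]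
      rw [h2]
      refine (s.hasSum_compl_iff (f := fun i => inner ℂ x (a i) * inner ℂ (b i) y)).2 ?_
      simpa using h.hasSum x y
    exact hrep.norm_traceClass_le
  rw [HasSum, tendsto_iff_norm_sub_tendsto_zero]
  refine squeeze_zero (fun s => norm_nonneg _) (fun s => ?_)
    (tendsto_tsum_compl_atTop_zero fun i => ‖a i‖ * ‖b i‖)
  rw [norm_sub_rev]
  exact hsum s

/-- A continuous linear map on trace class operators is determined by the rank one operators. -/
theorem clm_ext {E : Type*} [NormedAddCommGroup E] [NormedSpace ℂ E]
    {f g : TraceClass H →L[ℂ] E} (h : ∀ x y, f (rankOne x y) = g (rankOne x y)) : f = g := by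
  ext A
  obtain ⟨a, b, hab, -⟩ := A.exists_rep
  have h1 := (hasSum_rankOne hab).mapL f
  have h2 := (hasSum_rankOne hab).mapL g
  simp_rw [h] at h1
  exact h1.unique h2

/-- The adjoint as a real linear isometry of the trace class. -/
def adj : TraceClass H →L[ℝ] TraceClass H :=
  LinearMap.mkContinuous
    { toFun := fun A => mk (ContinuousLinearMap.adjoint A.op) (by
        obtain ⟨a, b, h, -⟩ := A.exists_rep
        exact h.adjoint.traceNorm_lt_top)
      map_add' := fun A B => op_injective (by simp)
      map_smul' := fun c A => op_injective (by
        have h1 : ∀ B : TraceClass H, c • B = (c : ℂ) • B := fun B => (Complex.coe_smul c B).symm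
        have h2 : (c • A).op = (c : ℂ) • A.op := congrArg op (h1 A)
        refine (congrArg ContinuousLinearMap.adjoint h2).trans ?_
        refine Eq.trans ?_ (congrArg op (h1 _)).symm
        show ContinuousLinearMap.adjoint ((c : ℂ) • A.op) = (c : ℂ) • ContinuousLinearMap.adjoint A.op
        rw [map_smulₛₗ, Complex.conj_ofReal]) } 1
    fun A => by
      obtain ⟨a, b, h, h1⟩ := A.exists_rep
      rw [one_mul]
      refine le_trans ?_ h1
      simp_rw [mul_comm ‖a _‖]
      exact IsNuclearRep.norm_traceClass_le (A := mk _ _) h.adjoint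

@[simp] theorem op_adj (A : TraceClass H) : (adj A).op = ContinuousLinearMap.adjoint A.op := rfl

/-- Left multiplication by a bounded strongly convergent family converges in trace norm. -/
theorem tendsto_lmul {α : Type*} {l : Filter α} [l.IsCountablyGenerated] {B : α → H →L[ℂ] H}
    {B₀ : H →L[ℂ] H} {C : ℝ} (hC : ∀ᶠ i in l, ‖B i‖ ≤ C)
    (h : ∀ x, Tendsto (fun i => B i x) l (𝓝 (B₀ x))) (A : TraceClass H) :
    Tendsto (fun i => lmul (B i) A) l (𝓝 (lmul B₀ A)) := by
  obtain ⟨a, b, hab, -⟩ := A.exists_rep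
  have hle : ∀ i, ‖lmul (B i) A - lmul B₀ A‖ ≤ ∑' k, ‖B i (a k) - B₀ (a k)‖ * ‖b k‖ := by
    intro i
    have hrep : IsNuclearRep (lmul (B i) A - lmul B₀ A).op (fun k => B i (a k) - B₀ (a k)) b := by
      have := hab.comp_left (B i - B₀)
      simpa [ContinuousLinearMap.sub_comp] using this
    exact hrep.norm_traceClass_le
  rw [tendsto_iff_norm_sub_tendsto_zero]
  refine squeeze_zero (fun s => norm_nonneg _) hle ?_
  have h0 : Tendsto (fun i => ∑' k, ‖B i (a k) - B₀ (a k)‖ * ‖b k‖) l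
      (𝓝 (∑' k, (fun _ : basisSet H => (0 : ℝ)) k)) := by
    refine tendsto_tsum_of_dominated_convergence
      (bound := fun k => (C + ‖B₀‖) * (‖a k‖ * ‖b k‖)) (hab.summable.mul_left _) (fun k => ?_) ?_
    · have := (tendsto_iff_norm_sub_tendsto_zero.1 (h (a k))).mul_const ‖b k‖
      simpa using this
    · filter_upwards [hC] with i hi k
      rw [Real.norm_of_nonneg (by positivity), ← mul_assoc]
      refine mul_le_mul_of_nonneg_right ?_ (norm_nonneg _)
      refine (norm_sub_le _ _).trans ?_
      rw [add_mul]
      exact add_le_add (((B i).le_opNorm _).trans (mul_le_mul_of_nonneg_right hi (norm_nonneg _)))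
        (B₀.le_opNorm _)
  simpa using h0

theorem adj_lmul_adj (B : H →L[ℂ] H) (A : TraceClass H) :
    adj (lmul (ContinuousLinearMap.adjoint B) (adj A)) = rmul B A :=
  op_injective (by simp [ContinuousLinearMap.adjoint_comp])

/-- Right multiplication by a bounded family with strongly convergent adjoints converges in trace
norm. -/
theorem tendsto_rmul {α : Type*} {l : Filter α} [l.IsCountablyGenerated] {B : α → H →L[ℂ] H}
    {B₀ : H →L[ℂ] H} {C : ℝ} (hC : ∀ᶠ i in l, ‖B i‖ ≤ C)
    (h : ∀ x, Tendsto (fun i => ContinuousLinearMap.adjoint (B i) x) l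
      (𝓝 (ContinuousLinearMap.adjoint B₀ x))) (A : TraceClass H) :
    Tendsto (fun i => rmul (B i) A) l (𝓝 (rmul B₀ A)) := by
  have := tendsto_lmul (C := C) (hC.mono fun i hi => by simpa using hi) h (adj A)
  have h2 := (adj.continuous.tendsto _).comp this
  simpa [Function.comp_def, adj_lmul_adj] using h2

end TraceClass

end TraceClass

/-! ### Hilbert space tensor products, ampliations and partial traces -/

section Tensor

variable {H₁ H₂ K : Type*}
  [NormedAddCommGroup H₁] [InnerProductSpace ℂ H₁] [CompleteSpace H₁]
  [NormedAddCommGroup H₂] [InnerProductSpace ℂ H₂] [CompleteSpace H₂]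
  [NormedAddCommGroup K] [InnerProductSpace ℂ K] [CompleteSpace K]

/-- `K` is the Hilbert space tensor product of `H₁` and `H₂`, with `m x y = x ⊗ y`. -/
structure IsTensorProduct (m : H₁ →ₗ[ℂ] H₂ →ₗ[ℂ] K) : Prop where
  inner_map : ∀ x y x' y', inner ℂ (m x y) (m x' y') = inner ℂ x x' * inner ℂ y y'
  dense : (Submodule.span ℂ (Set.range fun p : H₁ × H₂ => m p.1 p.2)).topologicalClosure = ⊤

namespace IsTensorProduct

variable {m : H₁ →ₗ[ℂ] H₂ →ₗ[ℂ] K}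

theorem norm_map (hm : IsTensorProduct m) (x : H₁) (y : H₂) : ‖m x y‖ = ‖x‖ * ‖y‖ := by
  have h := hm.inner_map x y x y
  simp only [inner_self_eq_norm_sq_to_K] at h
  have h2 : ‖m x y‖ ^ 2 = (‖x‖ * ‖y‖) ^ 2 := by
    rw [mul_pow]
    exact_mod_cast h
  exact (sq_eq_sq₀ (norm_nonneg _) (by positivity)).1 h2

/-- The map `y ↦ x ⊗ y`. -/
def rightL (hm : IsTensorProduct m) (x : H₁) : H₂ →L[ℂ] K :=
  (m x).mkContinuous ‖x‖ fun y => (hm.norm_map x y).le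

/-- The map `x ↦ x ⊗ y`. -/
def leftL (hm : IsTensorProduct m) (y : H₂) : H₁ →L[ℂ] K :=
  (m.flip y).mkContinuous ‖y‖ fun x => by
    rw [mul_comm]
    exact (hm.norm_map x y).le

@[simp] theorem rightL_apply (hm : IsTensorProduct m) (x : H₁) (y : H₂) : hm.rightL x y = m x y :=
  rfl

@[simp] theorem leftL_apply (hm : IsTensorProduct m) (x : H₁) (y : H₂) : hm.leftL y x = m x y :=
  rfl

/-- The isometric embedding `x ↦ x ⊗ e_c`, where `e_c` belongs to the chosen Hilbert basis. -/
def emb (hm : IsTensorProduct m) (c : basisSet H₂) : H₁ →ₗᵢ[ℂ] K where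
  toLinearMap := m.flip (basis H₂ c)
  norm_map' x := by
    rw [LinearMap.flip_apply, hm.norm_map, (basis H₂).orthonormal.1, mul_one]

@[simp] theorem emb_apply (hm : IsTensorProduct m) (c : basisSet H₂) (x : H₁) :
    hm.emb c x = m x (basis H₂ c) := rfl

theorem hasSum_emb (hm : IsTensorProduct m) (x : H₁) (y : H₂) :
    HasSum (fun c => (basis H₂).repr y c • m x (basis H₂ c)) (m x y) := by
  simpa using ((basis H₂).hasSum_repr y).mapL (hm.rightL x)

theorem isHilbertSum (hm : IsTensorProduct m) :
    IsHilbertSum ℂ (fun _ : basisSet H₂ => H₁) hm.emb := by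
  refine IsHilbertSum.mk ?_ ?_
  · intro c c' hcc x y
    rw [emb_apply, emb_apply, hm.inner_map, (basis H₂).orthonormal.2 hcc, mul_zero]
  · rw [← hm.dense]
    refine Submodule.topologicalClosure_minimal _ ?_ (Submodule.isClosed_topologicalClosure _)
    rw [Submodule.span_le]
    rintro _ ⟨⟨x, y⟩, rfl⟩
    refine mem_closure_of_tendsto (hm.hasSum_emb x y) (Eventually.of_forall fun s => ?_)
    refine Submodule.sum_mem _ fun c _ => Submodule.smul_mem _ _ ?_
    exact Submodule.mem_iSup_of_mem c ⟨x, rfl⟩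

/-- The slices of a vector of `K`: the identification of `K` with the Hilbert sum of copies of
`H₁` indexed by a Hilbert basis of `H₂`. -/
def slices (hm : IsTensorProduct m) : K ≃ₗᵢ[ℂ] lp (fun _ : basisSet H₂ => H₁) 2 :=
  hm.isHilbertSum.linearIsometryEquiv

open Classical in
theorem slices_map_basis (hm : IsTensorProduct m) (x : H₁) (c : basisSet H₂) :
    hm.slices (m x (basis H₂ c)) = lp.single 2 c x := by
  rw [← hm.emb_apply, ← hm.isHilbertSum.linearIsometryEquiv_symm_apply_single]
  exact LinearIsometryEquiv.apply_symm_apply _ _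

end IsTensorProduct

theorem memℓp_clm_apply {ι : Type*} (B : H₁ →L[ℂ] H₁) (f : lp (fun _ : ι => H₁) 2) :
    Memℓp (fun c => B (f c)) 2 :=
  Memℓp.mono' (((lp.memℓp f).const_smul (‖B‖ : ℂ))) fun c => by
    simpa [norm_smul] using B.le_opNorm (f c)

/-- A bounded operator acting componentwise on a Hilbert sum of copies of `H₁`. -/
def diag (ι : Type*) (B : H₁ →L[ℂ] H₁) :
    lp (fun _ : ι => H₁) 2 →L[ℂ] lp (fun _ : ι => H₁) 2 :=
  LinearMap.mkContinuous
    { toFun := fun f => ⟨fun c => B (f c), memℓp_clm_apply B f⟩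
      map_add' := fun f g => by
        ext c
        exact map_add B (f c) (g c)
      map_smul' := fun a f => by
        ext c
        exact map_smul B a (f c) } ‖B‖ fun f => by
    have h : ‖(⟨fun c => B (f c), memℓp_clm_apply B f⟩ : lp (fun _ : ι => H₁) 2)‖ ≤
        ‖(‖B‖ : ℂ) • f‖ :=
      lp.norm_mono two_ne_zero fun c => by
        refine (B.le_opNorm (f c)).trans (le_of_eq ?_)
        rw [lp.coeFn_smul, Pi.smul_apply, norm_smul, Complex.norm_real, norm_norm]
    rwa [norm_smul, Complex.norm_real, norm_norm] at h

@[simp] theorem diag_apply {ι : Type*} (B : H₁ →L[ℂ] H₁) (f : lp (fun _ : ι => H₁) 2) (c : ι) :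
    diag ι B f c = B (f c) := rfl

theorem norm_diag_le {ι : Type*} (B : H₁ →L[ℂ] H₁) : ‖diag ι B‖ ≤ ‖B‖ :=
  LinearMap.mkContinuous_norm_le _ (norm_nonneg _) _

/-- Absolutely summable rank one operators define an operator. -/
theorem exists_of_summable_rankOne {ι : Type*} {a b : ι → H₁}
    (h : Summable fun i => ‖a i‖ * ‖b i‖) : ∃ A : H₁ →L[ℂ] H₁, IsNuclearRep A a b := by
  have hs : Summable fun i => InnerProductSpace.rankOne ℂ (a i) (b i) :=
    Summable.of_norm (by simpa using h)
  refine ⟨∑' i, InnerProductSpace.rankOne ℂ (a i) (b i), h, fun x y => ?_⟩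
  have h1 := (hs.hasSum.mapL (ContinuousLinearMap.apply ℂ H₁ y)).mapL (innerSL ℂ x)
  simpa [inner_smul_right, mul_comm] using h1

namespace IsTensorProduct

variable {m : H₁ →ₗ[ℂ] H₂ →ₗ[ℂ] K}

/-- The ampliation `B ⊗ 1` of an operator `B` on the first factor. -/
def amp (hm : IsTensorProduct m) (B : H₁ →L[ℂ] H₁) : K →L[ℂ] K :=
  hm.slices.symm.toContinuousLinearEquiv.toContinuousLinearMap ∘L diag _ B ∘L
    hm.slices.toContinuousLinearEquiv.toContinuousLinearMap

theorem amp_apply (hm : IsTensorProduct m) (B : H₁ →L[ℂ] H₁) (f : K) :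
    hm.amp B f = hm.slices.symm (diag _ B (hm.slices f)) := rfl

theorem norm_amp_le (hm : IsTensorProduct m) (B : H₁ →L[ℂ] H₁) : ‖hm.amp B‖ ≤ ‖B‖ := by
  refine ContinuousLinearMap.opNorm_le_bound _ (norm_nonneg _) fun f => ?_
  rw [amp_apply, LinearIsometryEquiv.norm_map]
  refine ((diag _ B).le_opNorm _).trans ?_
  rw [LinearIsometryEquiv.norm_map]
  exact mul_le_mul_of_nonneg_right (norm_diag_le B) (norm_nonneg _)

@[simp] theorem amp_map (hm : IsTensorProduct m) (B : H₁ →L[ℂ] H₁) (x : H₁) (y : H₂) :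
    hm.amp B (m x y) = m (B x) y := by
  classical
  have hb : ∀ c, hm.amp B (m x (basis H₂ c)) = m (B x) (basis H₂ c) := fun c => by
    rw [amp_apply, hm.slices_map_basis, LinearIsometryEquiv.symm_apply_eq, hm.slices_map_basis]
    ext c'
    rw [diag_apply]
    by_cases h : c' = c
    · subst h
      simp
    · simp [h]
  have h1 := (hm.hasSum_emb x y).mapL (hm.amp B)
  simp_rw [map_smul, hb] at h1
  exact h1.unique (hm.hasSum_emb (B x) y)

/-- Operators on `K` that agree on elementary tensors are equal. -/
theorem clm_ext (hm : IsTensorProduct m) {E : Type*} [NormedAddCommGroup E] [NormedSpace ℂ E]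
    {f g : K →L[ℂ] E} (h : ∀ x y, f (m x y) = g (m x y)) : f = g := by
  refine ContinuousLinearMap.ext_on (s := Set.range fun p : H₁ × H₂ => m p.1 p.2) ?_ ?_
  · exact Submodule.dense_iff_topologicalClosure_eq_top.2 hm.dense
  · rintro _ ⟨p, rfl⟩
    exact h p.1 p.2

/-- The partial trace: the functional `B ↦ trace (A (B ⊗ 1))` is given by an operator of trace
class on the first factor. -/
theorem exists_partialTrace (hm : IsTensorProduct m) (A : TraceClass K) :
    ∃ A' : TraceClass H₁, ∀ B : H₁ →L[ℂ] H₁,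
      TraceClass.tr (TraceClass.rmul B A') = TraceClass.tr (TraceClass.rmul (hm.amp B) A) := by
  obtain ⟨a, b, hab, -⟩ := A.exists_rep
  have hpq : (2 : ℝ≥0∞).toReal.HolderConjugate (2 : ℝ≥0∞).toReal := by
    simpa using Real.HolderConjugate.two_two
  have hH : ∀ i, (Summable fun c => ‖hm.slices (a i) c‖ * ‖hm.slices (b i) c‖) ∧
      ∑' c, ‖hm.slices (a i) c‖ * ‖hm.slices (b i) c‖ ≤ ‖a i‖ * ‖b i‖ := fun i => by
    have := lp.tsum_mul_le_mul_norm hpq (hm.slices (a i)) (hm.slices (b i))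
    rwa [LinearIsometryEquiv.norm_map, LinearIsometryEquiv.norm_map] at this
  have hs : Summable fun p : basisSet K × basisSet H₂ =>
      ‖hm.slices (a p.1) p.2‖ * ‖hm.slices (b p.1) p.2‖ := by
    refine (summable_prod_of_nonneg fun p => by positivity).2 ⟨fun i => (hH i).1, ?_⟩
    exact Summable.of_nonneg_of_le (fun i => tsum_nonneg fun k => by positivity)
      (fun i => (hH i).2) hab.summable
  obtain ⟨A', hA'⟩ := exists_of_summable_rankOne hs
  refine ⟨⟨A', hA'.traceNorm_lt_top⟩, fun B => ?_⟩
  have h1 : IsNuclearRep (B ∘L A') _ _ := hA'.comp_left B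
  have h2 := hab.comp_left (hm.amp B)
  rw [← TraceClass.tr_lmul, ← TraceClass.tr_lmul, TraceClass.tr_apply, TraceClass.tr_apply,
    TraceClass.op_lmul, TraceClass.op_lmul, TraceClass.op_mk, h1.trace_eq, h2.trace_eq]
  have h3 : Summable fun p : basisSet K × basisSet H₂ =>
      inner ℂ (hm.slices (b p.1) p.2) (B (hm.slices (a p.1) p.2)) :=
    Summable.of_norm_bounded h1.summable fun p => (norm_inner_le_norm _ _).trans (mul_comm _ _).le
  rw [h3.tsum_prod]
  refine tsum_congr fun i => ?_
  rw [← hm.slices.inner_map_map, amp_apply, LinearIsometryEquiv.apply_symm_apply, lp.inner_eq_tsum]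
  rfl

end IsTensorProduct
end Tensor

/-! ### A monotone class argument on products -/

section MonotoneClass

variable {X Y : Type*} [MeasurableSpace X] [MeasurableSpace Y]

/-- A property of bounded measurable functions on a product that is linear, stable under bounded
pointwise limits, and true for indicators of measurable rectangles, holds for all of them. -/
theorem bounded_measurable_prod_induction {P : (X × Y → ℂ) → Prop}
    (rect : ∀ s t, MeasurableSet s → MeasurableSet t → P ((s ×ˢ t).indicator 1))
    (add : ∀ f g : X × Y → ℂ, Measurable f → Measurable g → (∃ C, ∀ x, ‖f x‖ ≤ C) →
      (∃ C, ∀ x, ‖g x‖ ≤ C) → P f → P g → P (f + g))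
    (smul : ∀ (c : ℂ) (f : X × Y → ℂ), Measurable f → (∃ C, ∀ x, ‖f x‖ ≤ C) → P f → P (c • f))
    (lim : ∀ (f : ℕ → X × Y → ℂ) (g : X × Y → ℂ) (C : ℝ), (∀ n, Measurable (f n)) →
      (∀ n x, ‖f n x‖ ≤ C) → (∀ x, Tendsto (fun n => f n x) atTop (𝓝 (g x))) →
      (∀ n, P (f n)) → P g)
    {h : X × Y → ℂ} (hm : Measurable h) {C : ℝ} (hC : ∀ x, ‖h x‖ ≤ C) : P h := by
  have hbd : ∀ s : Set (X × Y), ∃ C : ℝ, ∀ x, ‖s.indicator (1 : X × Y → ℂ) x‖ ≤ C := fun s =>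
    ⟨1, fun x => (norm_indicator_le_norm_self _ _).trans (by simp)⟩
  have hmeas : ∀ s : Set (X × Y), MeasurableSet s → Measurable (s.indicator (1 : X × Y → ℂ)) :=
    fun s hs => measurable_one.indicator hs
  have hzero : P 0 := by
    simpa using smul 0 _ (hmeas _ (MeasurableSet.univ.prod MeasurableSet.univ)) (hbd _)
      (rect _ _ MeasurableSet.univ MeasurableSet.univ)
  have hone : P ((Set.univ : Set (X × Y)).indicator 1) := by
    simpa using rect Set.univ Set.univ MeasurableSet.univ MeasurableSet.univ
  have hset : ∀ s, MeasurableSet s → P (s.indicator 1) := by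
    intro s hs
    induction s, hs using MeasurableSpace.induction_on_inter generateFrom_prod.symm
      isPiSystem_prod with
    | empty =>
      rw [Set.indicator_empty']
      exact hzero
    | basic t ht =>
      obtain ⟨u, hu, v, hv, rfl⟩ := ht
      exact rect u v hu hv
    | compl t ht ih =>
      have h1 := add _ _ (hmeas _ MeasurableSet.univ) ((hmeas t ht).const_smul (-1 : ℂ)) (hbd _)
        ⟨1, fun x => by simpa using (norm_indicator_le_norm_self (1 : X × Y → ℂ) x).trans (by simp)⟩
        hone (smul (-1) _ (hmeas t ht) (hbd t) ih)
      rw [Set.indicator_compl]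
      simpa [sub_eq_add_neg] using h1
    | iUnion f hd hf ih =>
      have hfin : ∀ s : Finset ℕ, P ((⋃ i ∈ s, f i).indicator 1) := by
        intro s
        induction s using Finset.induction_on with
        | empty =>
          have h0 : (⋃ i ∈ (∅ : Finset ℕ), f i) = ∅ := by simp
          rw [h0, Set.indicator_empty']
          exact hzero
        | insert a s ha ihs =>
          have hdis : Disjoint (f a) (⋃ i ∈ s, f i) := by
            refine Set.disjoint_iUnion₂_right.2 fun i hi => hd ?_
            rintro rfl
            exact ha hi
          rw [Finset.set_biUnion_insert, Set.indicator_union_of_disjoint hdis]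
          exact add _ _ (hmeas _ (hf a))
            (hmeas _ (Finset.measurableSet_biUnion s fun i _ => hf i)) (hbd _) (hbd _) (ih a) ihs
      refine lim (fun n => (⋃ i ∈ Finset.range n, f i).indicator 1) _ 1
        (fun n => hmeas _ (Finset.measurableSet_biUnion _ fun i _ => hf i))
        (fun n x => (norm_indicator_le_norm_self _ _).trans (by simp)) (fun x => ?_)
        (fun n => hfin _)
      exact ((tendsto_indicator_biUnion_finset f (1 : X × Y → ℂ) x).comp
        tendsto_finset_range).mono_right (pure_le_nhds _)
  have hsimple : ∀ f : SimpleFunc (X × Y) ℂ, P f := by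
    intro f
    induction f using SimpleFunc.induction with
    | const c hs =>
      rename_i s
      have := smul c _ (hmeas s hs) (hbd s) (hset s hs)
      convert this using 1
      ext x
      by_cases hx : x ∈ s <;> simp [hx]
    | add hd hf hg =>
      rename_i f g
      exact add _ _ f.measurable g.measurable f.exists_forall_norm_le g.exists_forall_norm_le hf hg
  refine lim (fun n => SimpleFunc.approxOn h hm Set.univ 0 (Set.mem_univ _) n) h (C + C)
    (fun n => SimpleFunc.measurable _) (fun n x => ?_) (fun x => ?_) fun n => hsimple _
  · exact (SimpleFunc.norm_approxOn_zero_le hm _ x n).trans (add_le_add (hC x) (hC x))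
  · exact SimpleFunc.tendsto_approxOn hm (Set.mem_univ _) (by simp)

end MonotoneClass

/-! ### Multiplication operators -/

section MulOp

variable {X : Type*} [MeasureSpace X]

theorem mulOp_coeFn {f : X → ℂ} (hf : MemLp f ∞ (volume : Measure X)) (ψ : L2 X) :
    mulOp f ψ =ᵐ[volume] fun x => f x * ψ x := by
  rw [mulOp, dif_pos hf]
  filter_upwards [(ContinuousLinearMap.mul ℂ ℂ).coeFn_holder (r := 2) (hf.toLp f) ψ,
    hf.coeFn_toLp] with x hx hx'
  rw [ContinuousLinearMap.holderL_apply_apply, hx, hx']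
  rfl

theorem inner_mulOp {f : X → ℂ} (hf : MemLp f ∞ (volume : Measure X)) (φ ψ : L2 X) :
    inner ℂ φ (mulOp f ψ) = ∫ x, f x * (starRingEnd ℂ (φ x) * ψ x) := by
  rw [L2.inner_def]
  refine integral_congr_ae ?_
  filter_upwards [mulOp_coeFn hf ψ] with x hx
  rw [hx, RCLike.inner_apply]
  ring

theorem eq_mulOp_apply {f : X → ℂ} (hf : MemLp f ∞ (volume : Measure X)) {φ ψ : L2 X}
    (h : φ =ᵐ[volume] fun x => f x * ψ x) : φ = mulOp f ψ :=
  Lp.ext (h.trans (mulOp_coeFn hf ψ).symm)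

theorem mulOp_congr {f g : X → ℂ} (h : f =ᵐ[volume] g) : mulOp f = mulOp g := by
  by_cases hf : MemLp f ∞ (volume : Measure X)
  · ext1 ψ
    refine eq_mulOp_apply (hf.ae_eq h) ?_
    filter_upwards [mulOp_coeFn hf ψ, h] with x hx hx'
    rw [hx, hx']
  · have hg : ¬ MemLp g ∞ (volume : Measure X) := fun hg => hf (hg.ae_eq h.symm)
    rw [mulOp, mulOp, dif_neg hf, dif_neg hg]

theorem memLp_top_of_norm_le {f : X → ℂ} (hf : AEStronglyMeasurable f (volume : Measure X)) {C : ℝ}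
    (hC : ∀ x, ‖f x‖ ≤ C) : MemLp f ∞ (volume : Measure X) :=
  memLp_top_of_bound hf C (ae_of_all _ hC)

theorem norm_mulOp_le {f : X → ℂ} {C : ℝ} (hC0 : 0 ≤ C) (hC : ∀ᵐ x, ‖f x‖ ≤ C) :
    ‖mulOp f‖ ≤ C := by
  by_cases hf : MemLp f ∞ (volume : Measure X)
  · refine ContinuousLinearMap.opNorm_le_bound _ hC0 fun ψ => ?_
    refine Lp.norm_le_mul_norm_of_ae_le_mul ?_
    filter_upwards [mulOp_coeFn hf ψ, hC] with x hx hx'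
    rw [hx, norm_mul]
    exact mul_le_mul_of_nonneg_right hx' (norm_nonneg _)
  · rw [mulOp, dif_neg hf, norm_zero]
    exact hC0

theorem mulOp_add {f g : X → ℂ} (hf : MemLp f ∞ (volume : Measure X))
    (hg : MemLp g ∞ (volume : Measure X)) : mulOp (f + g) = mulOp f + mulOp g := by
  ext1 ψ
  refine (eq_mulOp_apply (hf.add hg) ?_).symm
  filter_upwards [mulOp_coeFn hf ψ, mulOp_coeFn hg ψ, Lp.coeFn_add (mulOp f ψ) (mulOp g ψ)]
    with x h1 h2 h3
  rw [add_apply, h3, Pi.add_apply, Pi.add_apply, h1, h2, add_mul]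

theorem mulOp_const_smul {f : X → ℂ} (hf : MemLp f ∞ (volume : Measure X)) (c : ℂ) :
    mulOp (c • f) = c • mulOp f := by
  ext1 ψ
  refine (eq_mulOp_apply (hf.const_smul c) ?_).symm
  filter_upwards [mulOp_coeFn hf ψ, Lp.coeFn_smul c (mulOp f ψ)] with x h1 h3
  rw [smul_apply, h3, Pi.smul_apply, Pi.smul_apply, h1, smul_eq_mul,
    smul_eq_mul, mul_assoc]

theorem mulOp_sub {f g : X → ℂ} (hf : MemLp f ∞ (volume : Measure X))
    (hg : MemLp g ∞ (volume : Measure X)) : mulOp (f - g) = mulOp f - mulOp g := by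
  have h := mulOp_add hf (hg.const_smul (-1 : ℂ))
  rw [mulOp_const_smul hg] at h
  simpa [sub_eq_add_neg] using h

theorem mulOp_sum {ι : Type*} (s : Finset ι) {f : ι → X → ℂ}
    (hf : ∀ i ∈ s, MemLp (f i) ∞ (volume : Measure X)) :
    mulOp (fun x => ∑ i ∈ s, f i x) = ∑ i ∈ s, mulOp (f i) := by
  classical
  induction s using Finset.induction_on with
  | empty =>
    have : mulOp (fun _ : X => (0 : ℂ)) = 0 := by
      ext1 ψ
      refine (eq_mulOp_apply MemLp.zero' ?_).symm
      filter_upwards [Lp.coeFn_zero ℂ 2 (volume : Measure X)] with x hx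
      simpa using hx
    simpa using this
  | insert a s ha ih =>
    simp_rw [Finset.sum_insert ha]
    rw [← ih fun i hi => hf i (Finset.mem_insert_of_mem hi)]
    exact mulOp_add (hf a (Finset.mem_insert_self a s))
      (memLp_finsetSum s fun i hi => hf i (Finset.mem_insert_of_mem hi))

theorem mulOp_mul {f g : X → ℂ} (hf : MemLp f ∞ (volume : Measure X))
    (hg : MemLp g ∞ (volume : Measure X)) : mulOp (f * g) = mulOp f ∘L mulOp g := by
  ext1 ψ
  refine (eq_mulOp_apply (hg.mul hf) ?_).symm
  filter_upwards [mulOp_coeFn hg ψ, mulOp_coeFn hf (mulOp g ψ)] with x h1 h2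
  rw [ContinuousLinearMap.comp_apply, h2, h1, Pi.mul_apply, mul_assoc]

theorem mulOp_one : mulOp (1 : X → ℂ) = ContinuousLinearMap.id ℂ (L2 X) := by
  ext1 ψ
  refine (eq_mulOp_apply (memLp_top_const 1) ?_).symm
  exact ae_of_all _ fun x => by simp

theorem mulOp_adjoint {f : X → ℂ} (hf : MemLp f ∞ (volume : Measure X)) :
    ContinuousLinearMap.adjoint (mulOp f) = mulOp (fun x => starRingEnd ℂ (f x)) := by
  symm
  rw [ContinuousLinearMap.eq_adjoint_iff]
  intro φ ψ
  rw [inner_mulOp hf, ← inner_conj_symm, inner_mulOp (f := fun x => starRingEnd ℂ (f x)) hf.star,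
    ← integral_conj]
  refine integral_congr_ae (ae_of_all _ fun x => ?_)
  simp only [map_mul, Complex.conj_conj]
  ring

/-- Bounded pointwise convergence of functions gives strong convergence of the multiplication
operators. -/
theorem tendsto_mulOp {α : Type*} {l : Filter α} [l.IsCountablyGenerated] {f : α → X → ℂ}
    {g : X → ℂ} {C : ℝ} (hf : ∀ i, AEStronglyMeasurable (f i) (volume : Measure X))
    (hg : AEStronglyMeasurable g (volume : Measure X)) (hfC : ∀ i x, ‖f i x‖ ≤ C)
    (hgC : ∀ x, ‖g x‖ ≤ C)
    (h : ∀ x, Tendsto (fun i => f i x) l (𝓝 (g x))) (ψ : L2 X) :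
    Tendsto (fun i => mulOp (f i) ψ) l (𝓝 (mulOp g ψ)) := by
  have hfm := fun i => memLp_top_of_norm_le (hf i) (hfC i)
  have hgm := memLp_top_of_norm_le hg hgC
  have hψ : Integrable (fun x => ‖ψ x‖ ^ 2) (volume : Measure X) :=
    (memLp_two_iff_integrable_sq_norm (Lp.aestronglyMeasurable ψ)).1 (Lp.memLp ψ)
  have hn : ∀ i, ‖mulOp (f i) ψ - mulOp g ψ‖ ^ 2 = ∫ x, ‖f i x - g x‖ ^ 2 * ‖ψ x‖ ^ 2 := by
    intro i
    rw [← inner_self_eq_norm_sq (𝕜 := ℂ), L2.inner_def, ← integral_re]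
    · refine integral_congr_ae ?_
      filter_upwards [mulOp_coeFn (hfm i) ψ, mulOp_coeFn hgm ψ,
        Lp.coeFn_sub (mulOp (f i) ψ) (mulOp g ψ)] with x h1 h2 h3
      rw [inner_self_eq_norm_sq, h3, Pi.sub_apply, h1, h2, ← sub_mul, norm_mul, mul_pow]
    · exact L2.integrable_inner _ _
  rw [tendsto_iff_norm_sub_tendsto_zero]
  have h0 : Tendsto (fun i => ‖mulOp (f i) ψ - mulOp g ψ‖ ^ 2) l (𝓝 0) := by
    simp_rw [hn]
    have hz : (∫ x : X, (0 : ℝ)) = 0 := integral_zero _ _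
    rw [← hz]
    refine tendsto_integral_filter_of_dominated_convergence (fun x => (C + C) ^ 2 * ‖ψ x‖ ^ 2)
      (Eventually.of_forall fun i => ?_) (Eventually.of_forall fun i => ae_of_all _ fun x => ?_)
      (hψ.const_mul _) (ae_of_all _ fun x => ?_)
    · exact (((hf i).sub hg).norm.pow 2).mul ((Lp.aestronglyMeasurable ψ).norm.pow 2)
    · rw [Real.norm_of_nonneg (by positivity)]
      gcongr
      exact (norm_sub_le _ _).trans (add_le_add (hfC i x) (hgC x))
    · have := ((tendsto_iff_norm_sub_tendsto_zero.1 (h x)).pow 2).mul_const (‖ψ x‖ ^ 2)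
      simpa using this
  have h1 := h0.sqrt
  simpa [Real.sqrt_sq] using h1

end MulOp

/-! ### `L²` of a product as a tensor product -/

section ProdL2

variable {X Y Z : Type*} [MeasureSpace X] [MeasureSpace Y] [MeasureSpace Z]
  [SigmaFinite (volume : Measure X)] [SigmaFinite (volume : Measure Y)]

theorem memLp_prodTensor {e : Z ≃ᵐ X × Y} (he : MeasurePreserving e) (φ : L2 X) (χ : L2 Y) :
    MemLp (fun z => φ (e z).1 * χ (e z).2) 2 := by
  have key : MemLp (fun w : X × Y => φ w.1 * χ w.2) 2 := by
    have hmeas : AEStronglyMeasurable (fun w : X × Y => φ w.1 * χ w.2) volume :=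
      ((Lp.aestronglyMeasurable φ).comp_quasiMeasurePreserving
        Measure.quasiMeasurePreserving_fst).mul
        ((Lp.aestronglyMeasurable χ).comp_quasiMeasurePreserving
        Measure.quasiMeasurePreserving_snd)
    rw [memLp_two_iff_integrable_sq_norm hmeas]
    simp_rw [norm_mul, mul_pow]
    exact ((memLp_two_iff_integrable_sq_norm (Lp.aestronglyMeasurable φ)).1 (Lp.memLp φ)).mul_prod
      ((memLp_two_iff_integrable_sq_norm (Lp.aestronglyMeasurable χ)).1 (Lp.memLp χ))
  exact key.comp_measurePreserving he

theorem quasiMeasurePreserving_fst_comp {e : Z ≃ᵐ X × Y} (he : MeasurePreserving e) :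
    Measure.QuasiMeasurePreserving (fun z => (e z).1) :=
  Measure.quasiMeasurePreserving_fst.comp he.quasiMeasurePreserving

theorem quasiMeasurePreserving_snd_comp {e : Z ≃ᵐ X × Y} (he : MeasurePreserving e) :
    Measure.QuasiMeasurePreserving (fun z => (e z).2) :=
  Measure.quasiMeasurePreserving_snd.comp he.quasiMeasurePreserving

/-- The function `z ↦ φ(x) χ(y)`, where `(x, y)` is the image of `z` in `X × Y`, as a bilinear map
into `L²(Z)`. -/
def prodTensor {e : Z ≃ᵐ X × Y} (he : MeasurePreserving e) : L2 X →ₗ[ℂ] L2 Y →ₗ[ℂ] L2 Z :=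
  LinearMap.mk₂ ℂ (fun φ χ => (memLp_prodTensor he φ χ).toLp _)
    (fun φ φ' χ => by
      rw [← MemLp.toLp_add]
      refine MemLp.toLp_congr _ _ ?_
      filter_upwards [(quasiMeasurePreserving_fst_comp he).ae_eq (Lp.coeFn_add φ φ')] with z hz
      simp only [Function.comp_apply, Pi.add_apply] at hz ⊢
      rw [hz, add_mul])
    (fun c φ χ => by
      rw [← MemLp.toLp_const_smul]
      refine MemLp.toLp_congr _ _ ?_
      filter_upwards [(quasiMeasurePreserving_fst_comp he).ae_eq (Lp.coeFn_smul c φ)] with z hz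
      simp only [Function.comp_apply, Pi.smul_apply, smul_eq_mul] at hz ⊢
      rw [hz, mul_assoc])
    (fun φ χ χ' => by
      rw [← MemLp.toLp_add]
      refine MemLp.toLp_congr _ _ ?_
      filter_upwards [(quasiMeasurePreserving_snd_comp he).ae_eq (Lp.coeFn_add χ χ')] with z hz
      simp only [Function.comp_apply, Pi.add_apply] at hz ⊢
      rw [hz, mul_add])
    (fun c φ χ => by
      rw [← MemLp.toLp_const_smul]
      refine MemLp.toLp_congr _ _ ?_
      filter_upwards [(quasiMeasurePreserving_snd_comp he).ae_eq (Lp.coeFn_smul c χ)] with z hz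
      simp only [Function.comp_apply, Pi.smul_apply, smul_eq_mul] at hz ⊢
      rw [hz]
      ring)

theorem prodTensor_coeFn {e : Z ≃ᵐ X × Y} (he : MeasurePreserving e) (φ : L2 X) (χ : L2 Y) :
    prodTensor he φ χ =ᵐ[volume] fun z => φ (e z).1 * χ (e z).2 :=
  (memLp_prodTensor he φ χ).coeFn_toLp

theorem inner_prodTensor {e : Z ≃ᵐ X × Y} (he : MeasurePreserving e) (φ φ' : L2 X) (χ χ' : L2 Y) :
    inner ℂ (prodTensor he φ χ) (prodTensor he φ' χ') = inner ℂ φ φ' * inner ℂ χ χ' := by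
  simp_rw [L2.inner_def]
  rw [← integral_prod_mul]
  refine Eq.trans ?_ (he.integral_comp' (f := e)
    (fun w : X × Y => inner ℂ (φ w.1) (φ' w.1) * inner ℂ (χ w.2) (χ' w.2)))
  refine integral_congr_ae ?_
  filter_upwards [prodTensor_coeFn he φ χ, prodTensor_coeFn he φ' χ'] with z h1 h2
  rw [h1, h2]
  simp only [RCLike.inner_apply, map_mul]
  ring

/-- A square integrable function orthogonal to all products vanishes: its integrals over the
measurable subsets of rectangles of finite measure are zero. -/
theorem eq_zero_of_inner_prodTensor {e : Z ≃ᵐ X × Y} (he : MeasurePreserving e) {f : L2 Z}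
    (hf : ∀ φ χ, inner ℂ (prodTensor he φ χ) f = 0) : f = 0 := by
  have key : ∀ (A : Set X) (B : Set Y), MeasurableSet A → MeasurableSet B → volume A ≠ ∞ →
      volume B ≠ ∞ → ∀ᵐ z, e z ∈ A ×ˢ B → f z = 0 := by
    intro A B hA hB hA' hB'
    let G : Z → ℂ := fun z => (A ×ˢ B).indicator 1 (e z) * f z
    have hrep : ∀ s t, ∀ hs : MeasurableSet s, ∀ ht : MeasurableSet t,
        (fun z => inner ℂ (prodTensor he
          (indicatorConstLp 2 (hA.inter hs) ((measure_mono Set.inter_subset_left).trans_lt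
            hA'.lt_top).ne (1 : ℂ))
          (indicatorConstLp 2 (hB.inter ht) ((measure_mono Set.inter_subset_left).trans_lt
            hB'.lt_top).ne (1 : ℂ)) z) (f z)) =ᵐ[volume]
          fun z => (s ×ˢ t).indicator 1 (e z) * G z := by
      intro s t hs ht
      filter_upwards [prodTensor_coeFn he
          (indicatorConstLp 2 (hA.inter hs) ((measure_mono Set.inter_subset_left).trans_lt
            hA'.lt_top).ne (1 : ℂ))
          (indicatorConstLp 2 (hB.inter ht) ((measure_mono Set.inter_subset_left).trans_lt
            hB'.lt_top).ne (1 : ℂ)),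
        (quasiMeasurePreserving_fst_comp he).ae_eq (indicatorConstLp_coeFn (p := 2)
          (hs := hA.inter hs) (hμs := ((measure_mono Set.inter_subset_left).trans_lt
            hA'.lt_top).ne) (c := (1 : ℂ))),
        (quasiMeasurePreserving_snd_comp he).ae_eq (indicatorConstLp_coeFn (p := 2)
          (hs := hB.inter ht) (hμs := ((measure_mono Set.inter_subset_left).trans_lt
            hB'.lt_top).ne) (c := (1 : ℂ)))] with z h1 h2 h3
      simp only [Function.comp_apply] at h2 h3
      rw [h1, h2, h3]
      simp only [G, RCLike.inner_apply]
      by_cases h4 : (e z).1 ∈ A <;> by_cases h5 : (e z).1 ∈ s <;>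
        by_cases h6 : (e z).2 ∈ B <;> by_cases h7 : (e z).2 ∈ t <;> simp [h4, h5, h6, h7]
    have hGint : Integrable G := by
      have h1 := (L2.integrable_inner (𝕜 := ℂ) _ f).congr
        (hrep Set.univ Set.univ MeasurableSet.univ MeasurableSet.univ)
      simpa using h1
    have hP : ∀ E : Set (X × Y), MeasurableSet E → ∫ z, E.indicator 1 (e z) * G z = 0 := by
      intro E hE
      refine bounded_measurable_prod_induction (P := fun h => ∫ z, h (e z) * G z = 0)
        ?_ ?_ ?_ ?_ (measurable_one.indicator hE) (C := 1)
        (fun x => (norm_indicator_le_norm_self _ _).trans (by simp))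
      · intro s t hs ht
        rw [← integral_congr_ae (hrep s t hs ht), ← L2.inner_def]
        exact hf _ _
      · rintro h h' hm hm' ⟨C, hC⟩ ⟨C', hC'⟩ h0 h0'
        simp only [Pi.add_apply, add_mul]
        rw [integral_add, h0, h0', add_zero]
        · exact hGint.bdd_mul (hm.comp e.measurable).aestronglyMeasurable
            (ae_of_all _ fun z => hC (e z))
        · exact hGint.bdd_mul (hm'.comp e.measurable).aestronglyMeasurable
            (ae_of_all _ fun z => hC' (e z))
      · intro c h hm _ h0
        simp only [Pi.smul_apply, smul_eq_mul, mul_assoc]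
        rw [integral_const_mul, h0, mul_zero]
      · intro h g C hm hC hlim h0
        have h1 : Tendsto (fun n => ∫ z, h n (e z) * G z) atTop (𝓝 (∫ z, g (e z) * G z)) := by
          refine tendsto_integral_of_dominated_convergence (fun z => C * ‖G z‖) (fun n => ?_)
            (hGint.norm.const_mul C) (fun n => ae_of_all _ fun z => ?_) (ae_of_all _ fun z => ?_)
          · exact ((hm n).comp e.measurable).aestronglyMeasurable.mul hGint.1
          · rw [norm_mul]
            exact mul_le_mul_of_nonneg_right (hC n _) (norm_nonneg _)
          · exact (hlim (e z)).mul_const _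
        simp_rw [h0] at h1
        exact tendsto_nhds_unique h1 tendsto_const_nhds
    have hG0 : G =ᵐ[volume] 0 := by
      refine hGint.ae_eq_zero_of_forall_setIntegral_eq_zero fun F hF _ => ?_
      have h1 := hP (e.symm ⁻¹' F) (e.symm.measurable hF)
      rw [← h1, ← integral_indicator hF]
      congr 1
      ext z
      by_cases hz : z ∈ F <;> simp [hz]
    filter_upwards [hG0] with z hz hzm
    simpa [G, hzm] using hz
  have hall : ∀ᵐ z : Z, ∀ n m : ℕ, e z ∈ spanningSets (volume : Measure X) n ×ˢ
      spanningSets (volume : Measure Y) m → f z = 0 := by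
    refine ae_all_iff.2 fun n => ae_all_iff.2 fun m => ?_
    exact key _ _ (measurableSet_spanningSets _ n) (measurableSet_spanningSets _ m)
      (measure_spanningSets_lt_top _ n).ne (measure_spanningSets_lt_top _ m).ne
  refine (Lp.eq_zero_iff_ae_eq_zero).2 ?_
  filter_upwards [hall] with z hz
  exact hz _ _ ⟨mem_spanningSetsIndex _ _, mem_spanningSetsIndex _ _⟩

theorem isTensorProduct_prodTensor {e : Z ≃ᵐ X × Y} (he : MeasurePreserving e) :
    IsTensorProduct (prodTensor he) where
  inner_map φ χ φ' χ' := inner_prodTensor he φ φ' χ χ'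
  dense := by
    rw [Submodule.topologicalClosure_eq_top_iff, Submodule.eq_bot_iff]
    intro f hf
    refine eq_zero_of_inner_prodTensor he fun φ χ => ?_
    exact (Submodule.mem_orthogonal _ _).1 hf _ (Submodule.subset_span ⟨(φ, χ), rfl⟩)

end ProdL2

/-! ### Splitting the configuration space -/

section Conf

variable {d : ℕ}

/-- The configuration space `(ℝ^d)^n` as a space of families of positions. -/
def confEquiv (d n : ℕ) : Conf d n ≃ᵐ (Fin n → Space d) where
  toFun x i := pos x i
  invFun y := WithLp.toLp 2 fun p => y p.1 p.2
  left_inv x := rfl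
  right_inv y := rfl
  measurable_toFun := (measurePreserving_pos d n).measurable
  measurable_invFun := by
    refine (WithLp.measurable_toLp 2 _).comp (measurable_pi_lambda _ fun p => ?_)
    exact (measurable_pi_apply p.2).comp
      ((WithLp.measurable_ofLp 2 _).comp (measurable_pi_apply p.1))

@[simp] theorem confEquiv_apply {n : ℕ} (x : Conf d n) (i : Fin n) : confEquiv d n x i = pos x i :=
  rfl

theorem measurePreserving_confEquiv (d n : ℕ) : MeasurePreserving (confEquiv d n) :=
  measurePreserving_pos d n

/-- Singling out the position of the particle `k`. -/
def siteEquiv (d : ℕ) {n : ℕ} (k : Fin (n + 1)) : Conf d (n + 1) ≃ᵐ Space d × Conf d n :=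
  (confEquiv d (n + 1)).trans ((MeasurableEquiv.piFinSuccAbove (fun _ => Space d) k).trans
    (MeasurableEquiv.prodCongr (MeasurableEquiv.refl _) (confEquiv d n).symm))

theorem measurePreserving_siteEquiv {n : ℕ} (k : Fin (n + 1)) :
    MeasurePreserving (siteEquiv d k) := by
  have h1 := volume_preserving_piFinSuccAbove (fun _ : Fin (n + 1) => Space d) k
  have h2 : MeasurePreserving (MeasurableEquiv.prodCongr (MeasurableEquiv.refl (Space d))
      (confEquiv d n).symm) :=
    (MeasurePreserving.id volume).prod ((measurePreserving_confEquiv d n).symm _)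
  exact h2.comp (h1.comp (measurePreserving_confEquiv d (n + 1)))

@[simp] theorem siteEquiv_fst {n : ℕ} (k : Fin (n + 1)) (x : Conf d (n + 1)) :
    (siteEquiv d k x).1 = pos x k := rfl

@[simp] theorem pos_siteEquiv_snd {n : ℕ} (k : Fin (n + 1)) (x : Conf d (n + 1)) (i : Fin n) :
    pos (siteEquiv d k x).2 i = pos x (k.succAbove i) := rfl

/-- Splitting the particles into the first `j` and the last `r`. -/
def splitEquiv (d j r : ℕ) : Conf d (j + r) ≃ᵐ Conf d j × Conf d r :=
  (confEquiv d (j + r)).trans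
    ((MeasurableEquiv.piCongrLeft (fun _ => Space d) finSumFinEquiv).symm.trans
      ((MeasurableEquiv.sumPiEquivProdPi fun _ => Space d).trans
        (MeasurableEquiv.prodCongr (confEquiv d j).symm (confEquiv d r).symm)))

theorem measurePreserving_splitEquiv (j r : ℕ) : MeasurePreserving (splitEquiv d j r) := by
  have h1 := (volume_measurePreserving_piCongrLeft (fun _ : Fin (j + r) => Space d)
    finSumFinEquiv).symm
  have h2 := volume_measurePreserving_sumPiEquivProdPi (fun _ : Fin j ⊕ Fin r => Space d)
  have h3 : MeasurePreserving (MeasurableEquiv.prodCongr (confEquiv d j).symm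
      (confEquiv d r).symm) :=
    ((measurePreserving_confEquiv d j).symm _).prod ((measurePreserving_confEquiv d r).symm _)
  exact h3.comp (h2.comp (h1.comp (measurePreserving_confEquiv d (j + r))))

@[simp] theorem pos_splitEquiv_fst {j r : ℕ} (x : Conf d (j + r)) (i : Fin j) :
    pos (splitEquiv d j r x).1 i = pos x (Fin.castAdd r i) := by
  rfl

@[simp] theorem pos_splitEquiv_snd {j r : ℕ} (x : Conf d (j + r)) (i : Fin r) :
    pos (splitEquiv d j r x).2 i = pos x (Fin.natAdd j i) := by
  rfl

/-! ### Elementary tensors -/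

theorem tensorVec_coeFn {n : ℕ} (ψ : Fin n → L2 (Space d)) :
    tensorVec ψ =ᵐ[volume] fun x => ∏ i, ψ i (pos x i) :=
  (memLp_tensor ψ).coeFn_toLp

theorem quasiMeasurePreserving_pos {n : ℕ} (k : Fin n) :
    Measure.QuasiMeasurePreserving (fun x : Conf d n => pos x k) :=
  (Measure.quasiMeasurePreserving_eval _ k).comp (measurePreserving_pos d n).quasiMeasurePreserving

/-- The tensor product structure that singles out the particle `k`. -/
theorem isTensorProduct_site (d : ℕ) {n : ℕ} (k : Fin (n + 1)) :
    IsTensorProduct (prodTensor (measurePreserving_siteEquiv (d := d) k)) :=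
  isTensorProduct_prodTensor _

theorem prodTensor_site_tensorVec {n : ℕ} (k : Fin (n + 1)) (ψ : Fin (n + 1) → L2 (Space d)) :
    prodTensor (measurePreserving_siteEquiv k) (ψ k) (tensorVec fun i => ψ (k.succAbove i)) =
      tensorVec ψ := by
  refine Lp.ext ?_
  filter_upwards [prodTensor_coeFn (measurePreserving_siteEquiv k) (ψ k)
    (tensorVec fun i => ψ (k.succAbove i)), tensorVec_coeFn ψ,
    (quasiMeasurePreserving_snd_comp (measurePreserving_siteEquiv k)).ae_eq
      (tensorVec_coeFn fun i => ψ (k.succAbove i))] with x h1 h2 h3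
  simp only [Function.comp_apply] at h3
  rw [h1, h2, h3, Fin.prod_univ_succAbove _ k]
  simp

/-- The tensor product structure that separates the first `j` particles from the last `r`. -/
theorem isTensorProduct_split (d j r : ℕ) :
    IsTensorProduct (prodTensor (measurePreserving_splitEquiv (d := d) j r)) :=
  isTensorProduct_prodTensor _

theorem prodTensor_split_tensorVec {j r : ℕ} (ψ : Fin (j + r) → L2 (Space d)) :
    prodTensor (measurePreserving_splitEquiv j r) (tensorVec fun i => ψ (Fin.castAdd r i))
      (tensorVec fun i => ψ (Fin.natAdd j i)) = tensorVec ψ := by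
  refine Lp.ext ?_
  filter_upwards [prodTensor_coeFn (measurePreserving_splitEquiv j r)
      (tensorVec fun i => ψ (Fin.castAdd r i)) (tensorVec fun i => ψ (Fin.natAdd j i)),
    tensorVec_coeFn ψ,
    (quasiMeasurePreserving_fst_comp (measurePreserving_splitEquiv j r)).ae_eq
      (tensorVec_coeFn fun i => ψ (Fin.castAdd r i)),
    (quasiMeasurePreserving_snd_comp (measurePreserving_splitEquiv j r)).ae_eq
      (tensorVec_coeFn fun i => ψ (Fin.natAdd j i))] with x h1 h2 h3 h4
  simp only [Function.comp_apply] at h3 h4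
  rw [h1, h2, h3, h4, Fin.prod_univ_add]
  simp

theorem inner_tensorVec {n : ℕ} (φ ψ : Fin n → L2 (Space d)) :
    inner ℂ (tensorVec φ) (tensorVec ψ) = ∏ i, inner ℂ (φ i) (ψ i) := by
  have h0 : ∀ i, inner ℂ (φ i) (ψ i) = ∫ x, inner ℂ (φ i x) (ψ i x) := fun i => L2.inner_def _ _
  simp_rw [h0]
  rw [L2.inner_def, ← integral_fintype_prod_volume_eq_prod
    (f := fun (i : Fin n) (x : Space d) => inner ℂ (φ i x) (ψ i x))]
  refine Eq.trans ?_ ((measurePreserving_confEquiv d n).integral_comp' (f := confEquiv d n)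
    (fun y => ∏ i, inner ℂ (φ i (y i)) (ψ i (y i))))
  refine integral_congr_ae ?_
  filter_upwards [tensorVec_coeFn φ, tensorVec_coeFn ψ] with x h1 h2
  rw [h1, h2]
  simp only [RCLike.inner_apply, map_prod, confEquiv_apply, Finset.prod_mul_distrib]

theorem norm_tensorVec {n : ℕ} (ψ : Fin n → L2 (Space d)) : ‖tensorVec ψ‖ = ∏ i, ‖ψ i‖ := by
  have h := inner_tensorVec ψ ψ
  simp only [inner_self_eq_norm_sq_to_K] at h
  have h2 : ‖tensorVec ψ‖ ^ 2 = (∏ i, ‖ψ i‖) ^ 2 := by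
    rw [← Finset.prod_pow]
    exact_mod_cast h
  exact (sq_eq_sq₀ (norm_nonneg _) (Finset.prod_nonneg fun i _ => norm_nonneg _)).1 h2

theorem dense_span_tensorVec (d n : ℕ) :
    Dense (Submodule.span ℂ (Set.range (tensorVec (d := d) (n := n))) : Set (L2 (Conf d n))) := by
  induction n with
  | zero =>
    have : (Submodule.span ℂ (Set.range (tensorVec (d := d) (n := 0)))) = ⊤ := by
      refine eq_top_iff.2 fun f _ => ?_
      have hf : f = f 0 • tensorVec (d := d) (n := 0) Fin.elim0 := by
        refine Lp.ext ?_
        filter_upwards [tensorVec_coeFn (d := d) (n := 0) Fin.elim0,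
          Lp.coeFn_smul (f 0) (tensorVec (d := d) (n := 0) Fin.elim0)] with x h1 h2
        rw [h2, Pi.smul_apply, h1, Subsingleton.elim x 0]
        simp
      rw [hf]
      exact Submodule.smul_mem _ _ (Submodule.subset_span ⟨_, rfl⟩)
    rw [this]
    exact dense_univ
  | succ n ih =>
    rw [Submodule.dense_iff_topologicalClosure_eq_top] at ih ⊢
    rw [eq_top_iff, ← (isTensorProduct_site d (0 : Fin (n + 1))).dense]
    refine Submodule.topologicalClosure_minimal _ ?_ (Submodule.isClosed_topologicalClosure _)
    rw [Submodule.span_le]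
    rintro _ ⟨⟨φ, χ⟩, rfl⟩
    let L := (isTensorProduct_site d (0 : Fin (n + 1))).rightL φ
    have h1 : (Submodule.span ℂ (Set.range (tensorVec (d := d) (n := n)))).topologicalClosure ≤
        ((Submodule.span ℂ (Set.range (tensorVec (d := d) (n := n + 1)))).topologicalClosure).comap
          L.toLinearMap := by
      refine Submodule.topologicalClosure_minimal _ ?_
        ((Submodule.isClosed_topologicalClosure _).preimage L.continuous)
      rw [Submodule.span_le]
      rintro _ ⟨ψ, rfl⟩
      refine Submodule.le_topologicalClosure _ (Submodule.subset_span ⟨Fin.cons φ ψ, ?_⟩)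
      rw [← prodTensor_site_tensorVec 0]
      simp [L]
    rw [ih] at h1
    exact h1 (Submodule.mem_top (x := χ))

/-- Bounded operators that agree on elementary tensors are equal. -/
theorem clm_ext_tensorVec {n : ℕ} {E : Type*} [NormedAddCommGroup E] [NormedSpace ℂ E]
    {S T : L2 (Conf d n) →L[ℂ] E} (h : ∀ ψ, S (tensorVec ψ) = T (tensorVec ψ)) : S = T := by
  refine ContinuousLinearMap.ext_on (dense_span_tensorVec d n) ?_
  rintro _ ⟨ψ, rfl⟩
  exact h ψ

/-- Bounded operators with the same matrix elements between elementary tensors are equal. -/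
theorem clm_ext_inner_tensorVec {n : ℕ} {S T : Op (Conf d n)}
    (h : ∀ φ ψ, inner ℂ (tensorVec φ) (S (tensorVec ψ)) = inner ℂ (tensorVec φ) (T (tensorVec ψ))) :
    S = T := by
  refine clm_ext_tensorVec fun ψ => ?_
  have h1 : innerSL ℂ (S (tensorVec ψ)) = innerSL ℂ (T (tensorVec ψ)) := by
    refine clm_ext_tensorVec fun φ => ?_
    rw [innerSL_apply_apply, innerSL_apply_apply, ← inner_conj_symm, h, inner_conj_symm]
  exact innerSL_inj.1 h1

/-! ### Tensor products of operators and operators at one site -/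

/-- The operator `A` acting on the particle `k`. -/
def siteOp : ∀ {n : ℕ}, Fin n → Op (Space d) → Op (Conf d n)
  | 0, k, _ => k.elim0
  | _ + 1, k, A => (isTensorProduct_site d k).amp A

theorem norm_siteOp_le {n : ℕ} (k : Fin n) (A : Op (Space d)) : ‖siteOp k A‖ ≤ ‖A‖ := by
  cases n with
  | zero => exact k.elim0
  | succ n => exact (isTensorProduct_site d k).norm_amp_le A

@[simp] theorem siteOp_tensorVec {n : ℕ} (k : Fin n) (A : Op (Space d))
    (ψ : Fin n → L2 (Space d)) :
    siteOp k A (tensorVec ψ) = tensorVec (Function.update ψ k (A (ψ k))) := by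
  cases n with
  | zero => exact k.elim0
  | succ n =>
    rw [← prodTensor_site_tensorVec k, ← prodTensor_site_tensorVec k, siteOp,
      (isTensorProduct_site d k).amp_map]
    simp

theorem exists_tensorOp {n : ℕ} (A : Fin n → Op (Space d)) : ∃ T : Op (Conf d n),
    ∀ ψ : Fin n → L2 (Space d), T (tensorVec ψ) = tensorVec fun i => A i (ψ i) := by
  have h : ∀ s : Finset (Fin n), ∃ T : Op (Conf d n), ∀ ψ : Fin n → L2 (Space d),
      T (tensorVec ψ) = tensorVec fun i => if i ∈ s then A i (ψ i) else ψ i := by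
    intro s
    induction s using Finset.induction_on with
    | empty => exact ⟨ContinuousLinearMap.id ℂ _, fun ψ => by simp⟩
    | insert a s ha ih =>
      obtain ⟨T, hT⟩ := ih
      refine ⟨siteOp a (A a) ∘L T, fun ψ => ?_⟩
      rw [ContinuousLinearMap.comp_apply, hT, siteOp_tensorVec]
      congr 1
      ext1 i
      by_cases hi : i = a
      · subst hi
        simp [ha]
      · simp [hi]
  obtain ⟨T, hT⟩ := h Finset.univ
  exact ⟨T, fun ψ => by simpa using hT ψ⟩

@[simp] theorem tensorOp_tensorVec {n : ℕ} (A : Fin n → Op (Space d)) (ψ : Fin n → L2 (Space d)) :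
    tensorOp A (tensorVec ψ) = tensorVec fun i => A i (ψ i) := by
  rw [tensorOp, dif_pos (exists_tensorOp A)]
  exact (exists_tensorOp A).choose_spec ψ

theorem tensorOp_comp {n : ℕ} (A B : Fin n → Op (Space d)) :
    tensorOp A ∘L tensorOp B = tensorOp fun i => A i ∘L B i :=
  clm_ext_tensorVec fun ψ => by simp

theorem siteOp_comm {n : ℕ} {k l : Fin n} (h : k ≠ l) (A B : Op (Space d)) :
    siteOp k A ∘L siteOp l B = siteOp l B ∘L siteOp k A :=
  clm_ext_tensorVec fun ψ => by
    simp only [ContinuousLinearMap.comp_apply, siteOp_tensorVec]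
    rw [Function.update_of_ne h, Function.update_of_ne h.symm, Function.update_comm h]

/-- Multiplication by a function of the position of the particle `k`. -/
theorem siteOp_mulOp {n : ℕ} (k : Fin n) {f : Space d → ℂ} (hf : MemLp f ∞ volume) :
    siteOp k (mulOp f) = mulOp fun x => f (pos x k) := by
  have hf' : MemLp (fun x : Conf d n => f (pos x k)) ∞ volume := by
    refine ⟨hf.1.comp_quasiMeasurePreserving (quasiMeasurePreserving_pos k), ?_⟩
    refine lt_of_le_of_lt ?_ hf.2
    rw [eLpNorm_exponent_top, eLpNorm_exponent_top]
    refine eLpNormEssSup_le_of_ae_enorm_bound ?_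
    exact (quasiMeasurePreserving_pos k).ae (ae_le_eLpNormEssSup)
  refine clm_ext_tensorVec fun ψ => ?_
  refine eq_mulOp_apply hf' ?_
  rw [siteOp_tensorVec]
  filter_upwards [tensorVec_coeFn ψ, tensorVec_coeFn (Function.update ψ k (mulOp f (ψ k))),
    (quasiMeasurePreserving_pos k).ae_eq (mulOp_coeFn hf (ψ k))] with x h1 h2 h3
  simp only [Function.comp_apply] at h3
  rw [h1, h2, ← Finset.mul_prod_erase _ _ (Finset.mem_univ k),
    ← Finset.mul_prod_erase _ (fun i => ψ i (pos x i)) (Finset.mem_univ k),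
    Function.update_self, h3, mul_assoc]
  congr 2
  refine Finset.prod_congr rfl fun i hi => ?_
  rw [Function.update_of_ne (Finset.ne_of_mem_erase hi)]

end Conf

/-! ### Local operators and pair potentials -/

section Local

variable {d n : ℕ}

/-- `B` commutes with every one-particle operator at the site `k`. -/
def CommutesAt (k : Fin n) (B : Op (Conf d n)) : Prop :=
  ∀ A : Op (Space d), B ∘L siteOp k A = siteOp k A ∘L B

/-- Operators acting on the particles in `S` only, encoded as the operators that commute with all
one-particle operators at the other sites. -/
def IsLocal (S : Finset (Fin n)) (B : Op (Conf d n)) : Prop :=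
  ∀ k ∉ S, CommutesAt k B

theorem commutesAt_id (k : Fin n) : CommutesAt k (ContinuousLinearMap.id ℂ (L2 (Conf d n))) :=
  fun A => by simp

theorem CommutesAt.comp {k : Fin n} {B C : Op (Conf d n)} (hB : CommutesAt k B)
    (hC : CommutesAt k C) : CommutesAt k (B ∘L C) := fun A => by
  rw [ContinuousLinearMap.comp_assoc, hC A, ← ContinuousLinearMap.comp_assoc, hB A,
    ContinuousLinearMap.comp_assoc]

theorem CommutesAt.sub {k : Fin n} {B C : Op (Conf d n)} (hB : CommutesAt k B)
    (hC : CommutesAt k C) : CommutesAt k (B - C) := fun A => by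
  rw [ContinuousLinearMap.sub_comp, ContinuousLinearMap.comp_sub, hB A, hC A]

theorem commutesAt_siteOp {k l : Fin n} (h : l ≠ k) (A : Op (Space d)) :
    CommutesAt k (siteOp l A) := fun B => siteOp_comm h A B

/-- Multiplication by the function `h(x_k, x_l)` of two particles. -/
def pairOp (k l : Fin n) (h : Space d × Space d → ℂ) : Op (Conf d n) :=
  mulOp fun x => h (pos x k, pos x l)

theorem measurable_pos (k : Fin n) : Measurable fun x : Conf d n => pos x k :=
  (measurable_pi_apply k).comp (measurePreserving_pos d n).measurable

theorem memLp_pair {k l : Fin n} {h : Space d × Space d → ℂ} (hm : Measurable h) {C : ℝ}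
    (hC : ∀ x, ‖h x‖ ≤ C) : MemLp (fun x : Conf d n => h (pos x k, pos x l)) ∞ volume :=
  memLp_top_of_norm_le
    (hm.comp ((measurable_pos k).prodMk (measurable_pos l))).aestronglyMeasurable fun _ => hC _

theorem pairOp_indicator (k l : Fin n) {s t : Set (Space d)} (hs : MeasurableSet s)
    (ht : MeasurableSet t) : pairOp k l ((s ×ˢ t).indicator 1) =
      siteOp k (mulOp (s.indicator 1)) ∘L siteOp l (mulOp (t.indicator 1)) := by
  have hb : ∀ u : Set (Space d), MeasurableSet u → MemLp (u.indicator (1 : Space d → ℂ)) ∞ volume :=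
    fun u hu => memLp_top_of_norm_le (measurable_one.indicator hu).aestronglyMeasurable (C := 1)
      fun x => (norm_indicator_le_norm_self _ _).trans (by simp)
  have hb' : ∀ (i : Fin n) (u : Set (Space d)), MeasurableSet u →
      MemLp (fun x : Conf d n => u.indicator (1 : Space d → ℂ) (pos x i)) ∞ volume :=
    fun i u hu => memLp_top_of_norm_le
      ((measurable_one.indicator hu).comp (measurable_pos i)).aestronglyMeasurable (C := 1)
      fun x => (norm_indicator_le_norm_self _ _).trans (by simp)
  rw [siteOp_mulOp k (hb s hs), siteOp_mulOp l (hb t ht), ← mulOp_mul (hb' k s hs) (hb' l t ht)]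
  refine congrArg mulOp (funext fun x => ?_)
  by_cases h1 : pos x k ∈ s <;> by_cases h2 : pos x l ∈ t <;> simp [h1, h2]

/-- An operator that commutes with all one-particle operators at two sites commutes with the pair
potentials of these sites. -/
theorem pairOp_comm {k l : Fin n} {B : Op (Conf d n)} (hk : CommutesAt k B) (hl : CommutesAt l B)
    {h : Space d × Space d → ℂ} (hm : Measurable h) {C : ℝ} (hC : ∀ x, ‖h x‖ ≤ C) :
    B ∘L pairOp k l h = pairOp k l h ∘L B := by
  refine bounded_measurable_prod_induction
    (P := fun h => B ∘L pairOp k l h = pairOp k l h ∘L B) ?_ ?_ ?_ ?_ hm hC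
  · intro s t hs ht
    rw [pairOp_indicator k l hs ht, ContinuousLinearMap.comp_assoc, ← hl,
      ← ContinuousLinearMap.comp_assoc, hk, ContinuousLinearMap.comp_assoc]
  · rintro f g hf hg ⟨C, hC⟩ ⟨C', hC'⟩ h1 h2
    have : pairOp k l (f + g) = pairOp k l f + pairOp (d := d) k l g :=
      mulOp_add (memLp_pair hf hC) (memLp_pair hg hC')
    rw [this, ContinuousLinearMap.comp_add, ContinuousLinearMap.add_comp, h1, h2]
  · rintro c f hf ⟨C, hC⟩ h1
    have : pairOp k l (c • f) = c • pairOp (d := d) k l f := mulOp_const_smul (memLp_pair hf hC) c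
    rw [this, ContinuousLinearMap.comp_smul, ContinuousLinearMap.smul_comp, h1]
  · intro f g C hf hfC hlim h1
    have hg : Measurable g := measurable_of_tendsto_metrizable hf (tendsto_pi_nhds.2 hlim)
    have hgC : ∀ x, ‖g x‖ ≤ C := fun x =>
      le_of_tendsto ((hlim x).norm) (Eventually.of_forall fun i => hfC i x)
    have hp := (measurable_pos (d := d) k).prodMk (measurable_pos l)
    have ht : ∀ ψ, Tendsto (fun i => pairOp k l (f i) ψ) atTop (𝓝 (pairOp k l g ψ)) := fun ψ =>
      tendsto_mulOp (fun i => ((hf i).comp hp).aestronglyMeasurable)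
        (hg.comp hp).aestronglyMeasurable (fun i x => hfC i _) (fun x => hgC _) (fun x => hlim _) ψ
    ext1 ψ
    refine tendsto_nhds_unique ((B.continuous.tendsto _).comp (ht ψ)) ?_
    refine (ht (B ψ)).congr fun i => ?_
    exact (congrArg (fun T : Op (Conf d n) => T ψ) (h1 i)).symm

theorem commutesAt_pairOp {i k l : Fin n} (hk : k ≠ i) (hl : l ≠ i)
    {h : Space d × Space d → ℂ} (hm : Measurable h) {C : ℝ} (hC : ∀ x, ‖h x‖ ≤ C) :
    CommutesAt i (pairOp k l h) := fun A =>
  (pairOp_comm (commutesAt_siteOp hk.symm A) (commutesAt_siteOp hl.symm A) hm hC).symm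

theorem norm_pairOp_le {k l : Fin n} {h : Space d × Space d → ℂ} {C : ℝ} (hC0 : 0 ≤ C)
    (hC : ∀ x, ‖h x‖ ≤ C) : ‖pairOp (n := n) k l h‖ ≤ C :=
  norm_mulOp_le hC0 (ae_of_all _ fun _ => hC _)

end Local

/-! ### Tensor powers of trace class operators -/

section TensorTC

/-- Product of finitely many absolutely convergent series. -/
theorem hasSum_fin_pi_prod {𝕜 ι : Type*} [NormedField 𝕜] [CompleteSpace 𝕜] :
    ∀ {n : ℕ} {f : Fin n → ι → 𝕜}, (∀ i, Summable fun j => ‖f i j‖) →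
      (Summable fun m : Fin n → ι => ‖∏ i, f i (m i)‖) ∧
        HasSum (fun m : Fin n → ι => ∏ i, f i (m i)) (∏ i, ∑' j, f i j) := by
  intro n
  induction n with
  | zero =>
    intro f _
    have h := hasSum_unique fun m : Fin 0 → ι => ∏ i, f i (m i)
    refine ⟨(hasSum_unique fun m : Fin 0 → ι => ‖∏ i, f i (m i)‖).summable, ?_⟩
    simp
  | succ n ih =>
    intro f hf
    obtain ⟨h1, h2⟩ := ih (f := fun i => f i.succ) fun i => hf i.succ
    generalize hg : (fun m : Fin n → ι => ∏ i : Fin n, f i.succ (m i)) = g at h2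
    have hg' : ∀ m, ∏ i : Fin n, f i.succ (m i) = g m := fun m => congrFun hg m
    simp only [hg'] at h1
    have h3 : Summable fun p : ι × (Fin n → ι) => ‖f 0 p.1 * g p.2‖ :=
      Summable.mul_norm (f := f 0) (g := g) (hf 0) h1
    let e : (ι × (Fin n → ι)) ≃ (Fin (n + 1) → ι) := Fin.consEquiv fun _ => ι
    have he : (fun m : Fin (n + 1) → ι => ∏ i, f i (m i)) =
        (fun p : ι × (Fin n → ι) => f 0 p.1 * g p.2) ∘ e.symm := by
      funext m
      rw [Fin.prod_univ_succ]
      exact congrArg _ (hg' fun i => m i.succ)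
    have h4 := tsum_mul_tsum_of_summable_norm (hf 0) h1
    rw [h2.tsum_eq] at h4
    have h5 := h3.of_norm.hasSum
    rw [← h4] at h5
    constructor
    · have he' : (fun m : Fin (n + 1) → ι => ‖∏ i, f i (m i)‖) =
          (fun p : ι × (Fin n → ι) => ‖f 0 p.1 * g p.2‖) ∘ e.symm :=
        funext fun m => congrArg norm (congrFun he m)
      rw [he']
      exact e.symm.summable_iff.2 h3
    · rw [he, Fin.prod_univ_succ]
      exact e.symm.hasSum_iff.2 h5

variable {d n : ℕ}

theorem IsNuclearRep.tensor {ι : Type*} {A : Fin n → Op (Space d)} {a b : Fin n → ι → L2 (Space d)}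
    (h : ∀ i, IsNuclearRep (A i) (a i) (b i)) :
    IsNuclearRep (tensorOp A) (fun m : Fin n → ι => tensorVec fun i => a i (m i))
      (fun m => tensorVec fun i => b i (m i)) := by
  have hs : Summable fun m : Fin n → ι =>
      ‖tensorVec fun i => a i (m i)‖ * ‖tensorVec fun i => b i (m i)‖ := by
    have h1 := (hasSum_fin_pi_prod (f := fun i j => ‖a i j‖ * ‖b i j‖) fun i => by
      simpa using (h i).summable).2.summable
    simpa only [norm_tensorVec, ← Finset.prod_mul_distrib] using h1
  obtain ⟨T, hT⟩ := exists_of_summable_rankOne hs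
  have hTA : T = tensorOp A := by
    refine clm_ext_inner_tensorVec fun φ ψ => ?_
    rw [tensorOp_tensorVec, inner_tensorVec, ← (hT.hasSum _ _).tsum_eq]
    have h2 := (hasSum_fin_pi_prod
      (f := fun i j => inner ℂ (φ i) (a i j) * inner ℂ (b i j) (ψ i)) fun i =>
        ((h i).hasSum (φ i) (ψ i)).summable.norm).2
    simp only [inner_tensorVec, ← Finset.prod_mul_distrib]
    rw [h2.tsum_eq]
    exact Finset.prod_congr rfl fun i _ => ((h i).hasSum _ _).tsum_eq
  exact hTA ▸ hT

open TraceClass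

/-- The tensor product of trace class operators. -/
def tensorTC (A : Fin n → TraceClass (L2 (Space d))) : TraceClass (L2 (Conf d n)) :=
  ⟨tensorOp fun i => (A i).op, by
    choose a b h _ using fun i => (A i).exists_rep
    exact (IsNuclearRep.tensor h).traceNorm_lt_top⟩

@[simp] theorem op_tensorTC (A : Fin n → TraceClass (L2 (Space d))) :
    (tensorTC A).op = tensorOp fun i => (A i).op := rfl

theorem norm_tensorTC_le (A : Fin n → TraceClass (L2 (Space d))) :
    ‖tensorTC A‖ ≤ ∏ i, ‖A i‖ := by
  choose a b h h' using fun i => (A i).exists_rep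
  have h1 : IsNuclearRep (tensorTC A).op _ _ := IsNuclearRep.tensor h
  refine h1.norm_traceClass_le.trans ?_
  have h2 := (hasSum_fin_pi_prod (f := fun i j => ‖a i j‖ * ‖b i j‖) fun i => by
      simpa using (h i).summable).2
  simp only [norm_tensorVec, ← Finset.prod_mul_distrib]
  rw [h2.tsum_eq]
  exact Finset.prod_le_prod (fun i _ => tsum_nonneg fun j => by positivity) fun i _ => h' i

theorem tr_tensorTC (A : Fin n → TraceClass (L2 (Space d))) :
    tr (tensorTC A) = ∏ i, tr (A i) := by
  choose a b h h' using fun i => (A i).exists_rep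
  rw [tr_apply, op_tensorTC, (IsNuclearRep.tensor h).trace_eq]
  have h2 := (hasSum_fin_pi_prod (f := fun i j => inner ℂ (b i j) (a i j)) fun i =>
    Summable.of_nonneg_of_le (fun j => norm_nonneg _)
      (fun j => (norm_inner_le_norm _ _).trans (mul_comm _ _).le) (h i).summable).2
  simp only [inner_tensorVec]
  rw [h2.tsum_eq]
  exact Finset.prod_congr rfl fun i _ => ((h i).trace_eq).symm

theorem tensorVec_update_add (ψ : Fin n → L2 (Space d)) (k : Fin n) (x y : L2 (Space d)) :
    tensorVec (Function.update ψ k (x + y)) =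
      tensorVec (Function.update ψ k x) + tensorVec (Function.update ψ k y) := by
  cases n with
  | zero => exact k.elim0
  | succ n =>
    rw [← prodTensor_site_tensorVec k, ← prodTensor_site_tensorVec k, ← prodTensor_site_tensorVec k]
    simp

theorem tensorVec_update_smul (ψ : Fin n → L2 (Space d)) (k : Fin n) (c : ℂ) (x : L2 (Space d)) :
    tensorVec (Function.update ψ k (c • x)) = c • tensorVec (Function.update ψ k x) := by
  cases n with
  | zero => exact k.elim0
  | succ n =>
    rw [← prodTensor_site_tensorVec k, ← prodTensor_site_tensorVec k]
    simp

theorem update_op_apply [DecidableEq (Fin n)] (A : Fin n → TraceClass (L2 (Space d))) (k : Fin n)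
    (B : TraceClass (L2 (Space d))) (ψ : Fin n → L2 (Space d)) :
    (fun i => (Function.update A k B i).op (ψ i)) =
      Function.update (fun i => (A i).op (ψ i)) k (B.op (ψ k)) := by
  ext1 i
  by_cases hi : i = k
  · subst hi
    simp
  · simp [hi]

theorem tensorTC_update_add [inst : DecidableEq (Fin n)] (A : Fin n → TraceClass (L2 (Space d)))
    (k : Fin n) (x y : TraceClass (L2 (Space d))) :
    tensorTC (Function.update A k (x + y)) =
      tensorTC (Function.update A k x) + tensorTC (Function.update A k y) := by
  obtain rfl : inst = instDecidableEqFin n := Subsingleton.elim _ _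
  refine op_injective (clm_ext_tensorVec fun ψ => ?_)
  rw [op_add, add_apply, op_tensorTC, op_tensorTC, op_tensorTC, tensorOp_tensorVec,
    tensorOp_tensorVec, tensorOp_tensorVec, update_op_apply, update_op_apply,
    update_op_apply, op_add, add_apply, tensorVec_update_add]

theorem tensorTC_update_smul [inst : DecidableEq (Fin n)] (A : Fin n → TraceClass (L2 (Space d)))
    (k : Fin n) (c : ℂ) (x : TraceClass (L2 (Space d))) :
    tensorTC (Function.update A k (c • x)) = c • tensorTC (Function.update A k x) := by
  obtain rfl : inst = instDecidableEqFin n := Subsingleton.elim _ _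
  refine op_injective (clm_ext_tensorVec fun ψ => ?_)
  rw [op_smul, smul_apply, op_tensorTC, op_tensorTC, tensorOp_tensorVec,
    tensorOp_tensorVec, update_op_apply, update_op_apply, op_smul, smul_apply,
    tensorVec_update_smul]

/-- The tensor product of trace class operators as a continuous multilinear map. -/
def tensorMulti (d n : ℕ) : ContinuousMultilinearMap ℂ
    (fun _ : Fin n => TraceClass (L2 (Space d))) (TraceClass (L2 (Conf d n))) :=
  MultilinearMap.mkContinuous
    { toFun := tensorTC
      map_update_add' := tensorTC_update_add
      map_update_smul' := tensorTC_update_smul } 1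
    fun A => by
      rw [one_mul]
      exact norm_tensorTC_le A

theorem lmul_siteOp_tensorTC (A : Fin n → TraceClass (L2 (Space d))) (k : Fin n)
    (B : Op (Space d)) :
    lmul (siteOp k B) (tensorTC A) = tensorTC (Function.update A k (lmul B (A k))) := by
  refine op_injective (clm_ext_tensorVec fun ψ => ?_)
  rw [op_lmul, ContinuousLinearMap.comp_apply, op_tensorTC, op_tensorTC, tensorOp_tensorVec,
    tensorOp_tensorVec, siteOp_tensorVec, update_op_apply, op_lmul, ContinuousLinearMap.comp_apply]

theorem rmul_siteOp_tensorTC (A : Fin n → TraceClass (L2 (Space d))) (k : Fin n)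
    (B : Op (Space d)) :
    rmul (siteOp k B) (tensorTC A) = tensorTC (Function.update A k (rmul B (A k))) := by
  refine op_injective (clm_ext_tensorVec fun ψ => ?_)
  rw [op_rmul, ContinuousLinearMap.comp_apply, op_tensorTC, op_tensorTC, siteOp_tensorVec,
    tensorOp_tensorVec, tensorOp_tensorVec, update_op_apply, op_rmul,
    ContinuousLinearMap.comp_apply]
  congr 1
  ext1 i
  by_cases hi : i = k
  · subst hi
    simp
  · simp [hi]

/-- A tracial functional on the trace class is a multiple of the trace. -/
theorem tracial_eq {H : Type*} [NormedAddCommGroup H] [InnerProductSpace ℂ H] [CompleteSpace H]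
    {R : TraceClass H →L[ℂ] ℂ} (hR : ∀ A G, R (lmul A G) = R (rmul A G)) {F : TraceClass H}
    (hF : tr F = 1) (G : TraceClass H) : R G = tr G * R F := by
  -- Cycle `|a⟩⟨v|` past `|u⟩⟨b|`.
  have h1 : ∀ a b u v : H, inner ℂ v u * R (rankOne a b) = inner ℂ b a * R (rankOne u v) := by
    intro a b u v
    have h := hR (InnerProductSpace.rankOne ℂ a v) (rankOne u b)
    have h2 : lmul (InnerProductSpace.rankOne ℂ a v) (rankOne u b) =
        inner ℂ v u • rankOne a b := op_injective (by
      rw [op_lmul, op_rankOne, op_smul, op_rankOne, InnerProductSpace.rankOne_comp_rankOne])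
    have h3 : rmul (InnerProductSpace.rankOne ℂ a v) (rankOne u b) =
        inner ℂ b a • rankOne u v := op_injective (by
      rw [op_rmul, op_rankOne, op_smul, op_rankOne, InnerProductSpace.rankOne_comp_rankOne])
    rwa [h2, h3, map_smul, map_smul, smul_eq_mul, smul_eq_mul] at h
  have h2 : ∀ a b : H, R (rankOne a b) = inner ℂ b a * R F := by
    intro a b
    have h : R (rankOne a b) • tr = inner ℂ b a • R := clm_ext fun u v => by
      simp only [smul_apply, smul_eq_mul, tr_rankOne]
      rw [mul_comm, h1]
    have h' := congrArg (fun f : TraceClass H →L[ℂ] ℂ => f F) h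
    simpa [hF] using h'
  have h3 : R = R F • tr := clm_ext fun u v => by
    rw [h2, smul_apply, tr_rankOne, smul_eq_mul, mul_comm]
  have h' := congrArg (fun f : TraceClass H →L[ℂ] ℂ => f G) h3
  simpa [mul_comm] using h'

/-- In a product state, an observable at the site `k` is independent of the observables that commute
with all one-particle operators at the site `k`. -/
theorem tr_tensorTC_comp_siteOp {F : TraceClass (L2 (Space d))} (hF : tr F = 1) {k : Fin n}
    {C : Op (Conf d n)} (hC : CommutesAt k C) (A : Op (Space d)) :
    tr (rmul (C ∘L siteOp k A) (tensorTC fun _ => F)) =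
      tr (lmul A F) * tr (rmul C (tensorTC fun _ => F)) := by
  -- The factor at the site `k` enters through a tracial functional, because `C` commutes with the
  -- operators at `k`.
  let R : TraceClass (L2 (Space d)) →L[ℂ] ℂ :=
    tr ∘L rmul C ∘L (tensorMulti d n).toContinuousLinearMap (fun _ => F) k
  have hRdef : ∀ G, R G = tr (rmul C (tensorTC (Function.update (fun _ => F) k G))) := fun G => rfl
  have hcyc : ∀ (A : Op (Space d)) (T : TraceClass (L2 (Conf d n))),
      tr (rmul C (lmul (siteOp k A) T)) = tr (rmul (C ∘L siteOp k A) T) := by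
    intro A T
    have h1 : rmul C (lmul (siteOp k A) T) = lmul (siteOp k A) (rmul C T) :=
      op_injective (by simp [ContinuousLinearMap.comp_assoc])
    rw [h1, tr_lmul]
    exact congrArg tr (op_injective (by simp [ContinuousLinearMap.comp_assoc]))
  have hR : ∀ A G, R (lmul A G) = R (rmul A G) := by
    intro A G
    have h1 := lmul_siteOp_tensorTC (Function.update (fun _ => F) k G) k A
    have h2 := rmul_siteOp_tensorTC (Function.update (fun _ => F) k G) k A
    rw [Function.update_self, Function.update_idem] at h1 h2
    rw [hRdef, hRdef, ← h1, ← h2, hcyc, hC A]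
    exact congrArg tr (op_injective (by simp [ContinuousLinearMap.comp_assoc]))
  have h1 := lmul_siteOp_tensorTC (fun _ => F) k A
  rw [← hcyc, h1, ← hRdef, tracial_eq hR hF, hRdef, Function.update_eq_self]

end TensorTC

/-! ### Averaging a pair potential over one particle of a product state -/

section Average

variable {d n : ℕ}

open TraceClass

/-- The average `x ↦ ∫ h(x, y) ρ(y) dy` of a pair potential. -/
def average (ρ : Space d → ℂ) (h : Space d × Space d → ℂ) (x : Space d) : ℂ :=
  ∫ y, h (x, y) * ρ y

theorem integrable_average {ρ : Space d → ℂ} (hρ : Integrable ρ) {h : Space d × Space d → ℂ}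
    (hm : Measurable h) {C : ℝ} (hC : ∀ x, ‖h x‖ ≤ C) (x : Space d) :
    Integrable fun y => h (x, y) * ρ y :=
  hρ.bdd_mul (hm.comp measurable_prodMk_left).aestronglyMeasurable
    (ae_of_all _ fun y => hC (x, y))

theorem aestronglyMeasurable_average {ρ : Space d → ℂ} (hρ : Integrable ρ)
    {h : Space d × Space d → ℂ} (hm : Measurable h) : AEStronglyMeasurable (average ρ h) volume := by
  have h1 : AEStronglyMeasurable (fun p : Space d × Space d => h p * ρ p.2)
      ((volume : Measure (Space d)).prod volume) :=
    hm.aestronglyMeasurable.mul (hρ.aestronglyMeasurable.comp_quasiMeasurePreserving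
      Measure.quasiMeasurePreserving_snd)
  exact h1.integral_prod_right'

theorem norm_average_le {ρ : Space d → ℂ} (hρ : Integrable ρ) {h : Space d × Space d → ℂ}
    {C : ℝ} (hC : ∀ x, ‖h x‖ ≤ C) (x : Space d) : ‖average ρ h x‖ ≤ C * ∫ y, ‖ρ y‖ := by
  rw [← integral_const_mul]
  refine norm_integral_le_of_norm_le (hρ.norm.const_mul C) (ae_of_all _ fun y => ?_)
  rw [norm_mul]
  exact mul_le_mul_of_nonneg_right (hC _) (norm_nonneg _)

theorem memLp_average {ρ : Space d → ℂ} (hρ : Integrable ρ) {h : Space d × Space d → ℂ}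
    (hm : Measurable h) {C : ℝ} (hC : ∀ x, ‖h x‖ ≤ C) : MemLp (average ρ h) ∞ volume :=
  memLp_top_of_norm_le (aestronglyMeasurable_average hρ hm) (norm_average_le hρ hC)

theorem memLp_average_pos {ρ : Space d → ℂ} (hρ : Integrable ρ) {h : Space d × Space d → ℂ}
    (hm : Measurable h) {C : ℝ} (hC : ∀ x, ‖h x‖ ≤ C) (k : Fin n) :
    MemLp (fun x : Conf d n => average ρ h (pos x k)) ∞ volume :=
  memLp_top_of_norm_le ((aestronglyMeasurable_average hρ hm).comp_quasiMeasurePreserving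
    (quasiMeasurePreserving_pos k)) fun _ => norm_average_le hρ hC _

theorem siteOp_mulOp_average {ρ : Space d → ℂ} (hρ : Integrable ρ) {h : Space d × Space d → ℂ}
    (hm : Measurable h) {C : ℝ} (hC : ∀ x, ‖h x‖ ≤ C) (k : Fin n) :
    siteOp k (mulOp (average ρ h)) = mulOp fun x => average ρ h (pos x k) :=
  siteOp_mulOp k (memLp_average hρ hm hC)

theorem lmul_add {H : Type*} [NormedAddCommGroup H] [InnerProductSpace ℂ H] [CompleteSpace H]
    (P Q : H →L[ℂ] H) (G : TraceClass H) : lmul (P + Q) G = lmul P G + lmul Q G :=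
  op_injective (by simp)

theorem lmul_smul {H : Type*} [NormedAddCommGroup H] [InnerProductSpace ℂ H] [CompleteSpace H]
    (c : ℂ) (P : H →L[ℂ] H) (G : TraceClass H) : lmul (c • P) G = c • lmul P G :=
  op_injective (by simp)

theorem tr_rmul_comp_comp {H : Type*} [NormedAddCommGroup H] [InnerProductSpace ℂ H]
    [CompleteSpace H] (B P B' : H →L[ℂ] H) (T : TraceClass H) :
    tr (rmul (B ∘L P ∘L B') T) = tr (lmul P (lmul B' (rmul B T))) := by
  have h1 : rmul (B ∘L P ∘L B') T = rmul (P ∘L B') (rmul B T) :=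
    op_injective (by simp [ContinuousLinearMap.comp_assoc])
  have h2 : lmul P (lmul B' (rmul B T)) = lmul (P ∘L B') (rmul B T) :=
    op_injective (by simp [ContinuousLinearMap.comp_assoc])
  rw [h1, h2, tr_lmul]

theorem memLp_indicator_one {u : Set (Space d)} (hu : MeasurableSet u) :
    MemLp (u.indicator (1 : Space d → ℂ)) ∞ volume :=
  memLp_top_of_norm_le (measurable_one.indicator hu).aestronglyMeasurable (C := 1)
    fun _ => (norm_indicator_le_norm_self _ _).trans (by simp)

theorem average_indicator (ρ : Space d → ℂ) (s t : Set (Space d)) (x : Space d) :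
    average ρ ((s ×ˢ t).indicator 1) x =
      (∫ y, t.indicator 1 y * ρ y) * s.indicator (1 : Space d → ℂ) x := by
  rw [mul_comm, ← integral_const_mul]
  refine integral_congr_ae (ae_of_all _ fun y => ?_)
  by_cases h1 : x ∈ s <;> by_cases h2 : y ∈ t <;> simp [h1, h2]

theorem tr_tensorTC_pairOp_indicator {F : TraceClass (L2 (Space d))} (hF : tr F = 1)
    {ρ : Space d → ℂ}
    (hFρ : ∀ f : Space d → ℂ, MemLp f ∞ → ∫ x, f x * ρ x = tr (lmul (mulOp f) F))
    {k l : Fin n} (hkl : k ≠ l) {B B' : Op (Conf d n)} (hB : CommutesAt l B)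
    (hB' : CommutesAt l B') {s t : Set (Space d)} (hs : MeasurableSet s) (ht : MeasurableSet t) :
    tr (rmul (B ∘L pairOp k l ((s ×ˢ t).indicator 1) ∘L B') (tensorTC fun _ => F)) =
      tr (rmul (B ∘L (mulOp fun x => average ρ ((s ×ˢ t).indicator 1) (pos x k)) ∘L B')
        (tensorTC fun _ => F)) := by
  have h2 : MemLp (fun x : Conf d n => s.indicator (1 : Space d → ℂ) (pos x k)) ∞ volume :=
    memLp_top_of_norm_le
      ((measurable_one.indicator hs).comp (measurable_pos k)).aestronglyMeasurable (C := 1)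
      fun x => (norm_indicator_le_norm_self _ _).trans (by simp)
  have h4 := tr_tensorTC_comp_siteOp hF ((hB.comp (commutesAt_siteOp hkl
    (mulOp (s.indicator 1)))).comp hB') (mulOp (t.indicator 1))
  have h5 : B ∘L pairOp k l ((s ×ˢ t).indicator 1) ∘L B' =
      ((B ∘L siteOp k (mulOp (s.indicator 1))) ∘L B') ∘L siteOp l (mulOp (t.indicator 1)) := by
    rw [pairOp_indicator k l hs ht, ContinuousLinearMap.comp_assoc, ← hB',
      ContinuousLinearMap.comp_assoc, ContinuousLinearMap.comp_assoc]
  rw [← hFρ _ (memLp_indicator_one ht)] at h4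
  have h1 := fun x => average_indicator ρ s t x
  generalize ∫ y, t.indicator 1 y * ρ y = c at h1 h4
  have h1' : (fun x : Conf d n => average ρ ((s ×ˢ t).indicator 1) (pos x k)) =
      c • fun x : Conf d n => s.indicator (1 : Space d → ℂ) (pos x k) :=
    funext fun x => h1 (pos x k)
  have h6 : (mulOp fun x : Conf d n => average ρ ((s ×ˢ t).indicator 1) (pos x k)) =
      c • siteOp k (mulOp (s.indicator 1)) := by
    rw [h1', mulOp_const_smul h2, siteOp_mulOp k (memLp_indicator_one hs)]
  rw [h5, h4, h6]
  generalize siteOp k (mulOp (s.indicator 1)) = P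
  rw [tr_rmul_comp_comp, lmul_smul, map_smul, ← tr_rmul_comp_comp, smul_eq_mul,
    ContinuousLinearMap.comp_assoc]

/-- In a product state `F ⊗ ⋯ ⊗ F`, a pair potential of the particles `k`, `l` may be replaced by its
average over the position of the particle `l`, when it is only multiplied by operators that do not
act on `l`. -/
theorem tr_tensorTC_pairOp {F : TraceClass (L2 (Space d))} (hF : tr F = 1) {ρ : Space d → ℂ}
    (hρ : Integrable ρ)
    (hFρ : ∀ f : Space d → ℂ, MemLp f ∞ → ∫ x, f x * ρ x = tr (lmul (mulOp f) F))
    {k l : Fin n} (hkl : k ≠ l) {B B' : Op (Conf d n)} (hB : CommutesAt l B)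
    (hB' : CommutesAt l B') {h : Space d × Space d → ℂ} (hm : Measurable h) {C : ℝ}
    (hC : ∀ x, ‖h x‖ ≤ C) :
    tr (rmul (B ∘L pairOp k l h ∘L B') (tensorTC fun _ => F)) =
      tr (rmul (B ∘L siteOp k (mulOp (average ρ h)) ∘L B') (tensorTC fun _ => F)) := by
  rw [siteOp_mulOp_average hρ hm hC]
  have hrect := fun (s t : Set (Space d)) (hs : MeasurableSet s) (ht : MeasurableSet t) =>
    tr_tensorTC_pairOp_indicator hF hFρ hkl hB hB' hs ht
  simp only [tr_rmul_comp_comp] at hrect ⊢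
  generalize lmul B' (rmul B (tensorTC fun _ => F)) = G at hrect ⊢
  refine bounded_measurable_prod_induction
    (P := fun h => tr (lmul (pairOp k l h) G) =
      tr (lmul (mulOp fun x => average ρ h (pos x k)) G)) hrect ?_ ?_ ?_ hm hC
  · rintro f g hf hg ⟨C, hC⟩ ⟨C', hC'⟩ h1 h2
    have e1 : pairOp k l (f + g) = pairOp k l f + pairOp (d := d) k l g :=
      mulOp_add (memLp_pair hf hC) (memLp_pair hg hC')
    have e2 : (mulOp fun x : Conf d n => average ρ (f + g) (pos x k)) =
        (mulOp fun x => average ρ f (pos x k)) + mulOp fun x => average ρ g (pos x k) := by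
      rw [← mulOp_add (memLp_average_pos hρ hf hC k) (memLp_average_pos hρ hg hC' k)]
      refine congrArg mulOp (funext fun x => ?_)
      simp only [average, Pi.add_apply, add_mul]
      exact integral_add (integrable_average hρ hf hC _) (integrable_average hρ hg hC' _)
    rw [e1, e2, lmul_add, lmul_add, map_add, map_add, h1, h2]
  · rintro c f hf ⟨C, hC⟩ h1
    have e1 : pairOp k l (c • f) = c • pairOp (d := d) k l f := mulOp_const_smul (memLp_pair hf hC) c
    have e2 : (mulOp fun x : Conf d n => average ρ (c • f) (pos x k)) =
        c • mulOp fun x => average ρ f (pos x k) := by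
      rw [← mulOp_const_smul (memLp_average_pos hρ hf hC k)]
      refine congrArg mulOp (funext fun x => ?_)
      simp only [average, Pi.smul_apply, smul_eq_mul, mul_assoc]
      exact integral_const_mul _ _
    rw [e1, e2, lmul_smul, lmul_smul, map_smul, map_smul, h1]
  · intro f g C hf hfC hlim h1
    have hg : Measurable g := measurable_of_tendsto_metrizable hf (tendsto_pi_nhds.2 hlim)
    have hgC : ∀ x, ‖g x‖ ≤ C := fun x =>
      le_of_tendsto ((hlim x).norm) (Eventually.of_forall fun i => hfC i x)
    have hp := (measurable_pos (d := d) k).prodMk (measurable_pos l)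
    have ht : Tendsto (fun i => lmul (pairOp k l (f i)) G) atTop (𝓝 (lmul (pairOp k l g) G)) := by
      refine tendsto_lmul (C := max C 0) (Eventually.of_forall fun i => norm_pairOp_le (le_max_right _ _)
        fun x => (hfC i x).trans (le_max_left _ _)) (fun ψ => ?_) G
      exact tendsto_mulOp (fun i => ((hf i).comp hp).aestronglyMeasurable)
        (hg.comp hp).aestronglyMeasurable (fun i x => hfC i _) (fun x => hgC _) (fun x => hlim _) ψ
    have hav : ∀ x, Tendsto (fun i => average ρ (f i) x) atTop (𝓝 (average ρ g x)) := by
      intro x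
      refine tendsto_integral_of_dominated_convergence (fun y => C * ‖ρ y‖)
        (fun i => (integrable_average hρ (hf i) (hfC i) x).aestronglyMeasurable)
        (hρ.norm.const_mul C) (fun i => ae_of_all _ fun y => ?_)
        (ae_of_all _ fun y => (hlim (x, y)).mul_const _)
      rw [norm_mul]
      exact mul_le_mul_of_nonneg_right (hfC i _) (norm_nonneg _)
    have ht' : Tendsto (fun i => lmul (mulOp fun x : Conf d n => average ρ (f i) (pos x k)) G) atTop
        (𝓝 (lmul (mulOp fun x : Conf d n => average ρ g (pos x k)) G)) := by
      refine tendsto_lmul (C := max (C * ∫ y, ‖ρ y‖) 0) (Eventually.of_forall fun i =>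
        norm_mulOp_le (le_max_right _ _) (ae_of_all _ fun x =>
          (norm_average_le hρ (hfC i) _).trans (le_max_left _ _))) (fun ψ => ?_) G
      exact tendsto_mulOp (fun i => (memLp_average_pos hρ (hf i) (hfC i) k).aestronglyMeasurable)
        (memLp_average_pos hρ hg hgC k).aestronglyMeasurable
        (fun i x => norm_average_le hρ (hfC i) _) (fun x => norm_average_le hρ hgC _)
        (fun x => hav _) ψ
    refine tendsto_nhds_unique ((tr.continuous.tendsto _).comp ht) ?_
    refine ((tr.continuous.tendsto _).comp ht').congr fun i => (h1 i).symm

end Average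

/-! ### The free Schrödinger group -/

section FreeGroup

variable {X : Type*} [NormedAddCommGroup X] [InnerProductSpace ℝ X] [FiniteDimensional ℝ X]
  [MeasurableSpace X] [BorelSpace X]

/-- The Fourier multiplier of the free Schrödinger group. -/
def phase (ħ t : ℝ) (ξ : X) : ℂ :=
  Complex.exp (-(2 * (Real.pi : ℂ) ^ 2 * Complex.I * (ħ : ℂ) * (t : ℂ) * ((‖ξ‖ ^ 2 : ℝ) : ℂ)))

theorem phase_eq (ħ t : ℝ) (ξ : X) :
    phase ħ t ξ = Complex.exp (((-(2 * Real.pi ^ 2 * ħ * t * ‖ξ‖ ^ 2) : ℝ) : ℂ) * Complex.I) := by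
  rw [phase]
  congr 1
  push_cast
  ring

theorem norm_phase (ħ t : ℝ) (ξ : X) : ‖phase ħ t ξ‖ = 1 := by
  rw [phase_eq, Complex.norm_exp_ofReal_mul_I]

theorem continuous_phase (ħ t : ℝ) : Continuous (phase ħ t : X → ℂ) := by
  unfold phase
  fun_prop

theorem memLp_phase (ħ t : ℝ) : MemLp (phase ħ t : X → ℂ) ∞ volume :=
  memLp_top_of_norm_le (continuous_phase ħ t).aestronglyMeasurable fun ξ => (norm_phase ħ t ξ).le

theorem phase_add (ħ s t : ℝ) : (phase ħ (s + t) : X → ℂ) = phase ħ s * phase ħ t := by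
  funext ξ
  simp only [Pi.mul_apply, phase, ← Complex.exp_add]
  congr 1
  push_cast
  ring

theorem phase_zero (ħ : ℝ) : (phase ħ 0 : X → ℂ) = 1 := by
  funext ξ
  simp [phase]

theorem conj_phase (ħ t : ℝ) (ξ : X) : starRingEnd ℂ (phase ħ t ξ) = phase ħ (-t) ξ := by
  rw [phase_eq, phase_eq, ← Complex.exp_conj, map_mul, Complex.conj_I, Complex.conj_ofReal]
  congr 1
  push_cast
  ring

theorem freeGroup_apply (ħ t : ℝ) (ψ : L2 X) : freeGroup ħ t ψ =
    (Lp.fourierTransformₗᵢ X ℂ).symm (mulOp (phase ħ t) (Lp.fourierTransformₗᵢ X ℂ ψ)) := rfl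

theorem freeGroup_comp (ħ s t : ℝ) :
    (freeGroup ħ s ∘L freeGroup ħ t : Op X) = freeGroup ħ (s + t) := by
  ext1 ψ
  rw [ContinuousLinearMap.comp_apply, freeGroup_apply, freeGroup_apply, freeGroup_apply,
    LinearIsometryEquiv.apply_symm_apply, phase_add, mulOp_mul (memLp_phase ħ s) (memLp_phase ħ t),
    ContinuousLinearMap.comp_apply]

theorem freeGroup_zero (ħ : ℝ) : (freeGroup ħ 0 : Op X) = ContinuousLinearMap.id ℂ _ := by
  ext1 ψ
  rw [freeGroup_apply, phase_zero, mulOp_one, ContinuousLinearMap.id_apply,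
    LinearIsometryEquiv.symm_apply_apply, ContinuousLinearMap.id_apply]

theorem freeGroup_comp_neg (ħ t : ℝ) :
    (freeGroup ħ t ∘L freeGroup ħ (-t) : Op X) = ContinuousLinearMap.id ℂ _ := by
  rw [freeGroup_comp, add_neg_cancel, freeGroup_zero]

theorem freeGroup_neg_comp (ħ t : ℝ) :
    (freeGroup ħ (-t) ∘L freeGroup ħ t : Op X) = ContinuousLinearMap.id ℂ _ := by
  rw [freeGroup_comp, neg_add_cancel, freeGroup_zero]

theorem adjoint_freeGroup (ħ t : ℝ) :
    ContinuousLinearMap.adjoint (freeGroup ħ t : Op X) = freeGroup ħ (-t) := by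
  symm
  rw [ContinuousLinearMap.eq_adjoint_iff]
  intro φ ψ
  have h : (fun ξ : X => starRingEnd ℂ (phase ħ t ξ)) = phase ħ (-t) :=
    funext fun ξ => conj_phase ħ t ξ
  rw [freeGroup_apply, freeGroup_apply, ← h, ← mulOp_adjoint (memLp_phase ħ t),
    ← LinearIsometryEquiv.inner_map_map (Lp.fourierTransformₗᵢ X ℂ),
    LinearIsometryEquiv.apply_symm_apply, ContinuousLinearMap.adjoint_inner_left,
    ← LinearIsometryEquiv.inner_map_map (Lp.fourierTransformₗᵢ X ℂ) φ,
    LinearIsometryEquiv.apply_symm_apply]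

theorem norm_freeGroup_le (ħ t : ℝ) : ‖(freeGroup ħ t : Op X)‖ ≤ 1 := by
  refine ContinuousLinearMap.opNorm_le_bound _ zero_le_one fun ψ => ?_
  rw [freeGroup_apply, LinearIsometryEquiv.norm_map]
  refine (ContinuousLinearMap.le_of_opNorm_le _ (norm_mulOp_le zero_le_one
    (ae_of_all _ fun ξ => (norm_phase ħ t ξ).le)) _).trans ?_
  rw [LinearIsometryEquiv.norm_map]

/-- The free Schrödinger group is strongly continuous. -/
theorem tendsto_freeGroup (ħ : ℝ) {α : Type*} {l : Filter α} [l.IsCountablyGenerated] {s : α → ℝ}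
    {t : ℝ} (hs : Tendsto s l (𝓝 t)) (ψ : L2 X) :
    Tendsto (fun a => freeGroup ħ (s a) ψ) l (𝓝 (freeGroup ħ t ψ)) := by
  refine ((Lp.fourierTransformₗᵢ X ℂ).symm.continuous.tendsto _).comp
    (tendsto_mulOp (C := 1) (fun a => (memLp_phase ħ (s a)).aestronglyMeasurable)
      (memLp_phase ħ t).aestronglyMeasurable (fun a ξ => (norm_phase ħ (s a) ξ).le)
      (fun ξ => (norm_phase ħ t ξ).le) (fun ξ => ?_) _)
  have hc : Continuous fun t => phase ħ t ξ := by
    unfold phase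
    fun_prop
  exact (hc.tendsto t).comp hs

end FreeGroup

/-! ### The free Schrödinger group of several particles -/

section FourierTensor

variable {X : Type*} [NormedAddCommGroup X] [InnerProductSpace ℝ X] [FiniteDimensional ℝ X]
  [MeasurableSpace X] [BorelSpace X]

/-- On `L¹ ∩ L²`, the Fourier transform of `L²` is given by the Fourier integral. -/
theorem fourierTransform_eq_of_integrable {G G' : L2 X} {g : X → ℂ} (hG : G =ᵐ[volume] g)
    (hg : Integrable g) (hG' : G' =ᵐ[volume] 𝓕 g) : Lp.fourierTransformₗᵢ X ℂ G = G' := by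
  have hinj : Function.Injective (Lp.toTemperedDistributionCLM (E := X) ℂ volume 2) :=
    LinearMap.ker_eq_bot.1 Lp.ker_toTemperedDistributionCLM_eq_bot
  refine hinj ?_
  have h1 := Lp.fourier_toTemperedDistribution_eq G
  rw [Lp.toTemperedDistributionCLM_apply, Lp.toTemperedDistributionCLM_apply]
  refine h1.symm.trans ?_
  ext h
  rw [TemperedDistribution.fourier_apply, Lp.toTemperedDistribution_apply,
    Lp.toTemperedDistribution_apply]
  have h2 := VectorFourier.integral_fourierIntegral_smul_eq_flip (L := innerₗ X) (μ := volume)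
    (ν := volume) (f := h) (g := g) Real.continuous_fourierChar continuous_inner h.integrable hg
  rw [flip_innerₗ] at h2
  refine (integral_congr_ae ?_).trans (h2.trans (integral_congr_ae ?_))
  · filter_upwards [hG] with ξ hξ
    rw [hξ, SchwartzMap.fourier_coe]
    rfl
  · filter_upwards [hG'] with ξ hξ
    rw [hξ]
    rfl

variable {d n : ℕ}

theorem inner_conf (x y : Conf d n) : inner ℝ x y = ∑ i, inner ℝ (pos x i) (pos y i) := by
  simp only [PiLp.inner_apply, pos]
  exact Fintype.sum_prod_type _

theorem norm_sq_conf (x : Conf d n) : ‖x‖ ^ 2 = ∑ i, ‖pos x i‖ ^ 2 := by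
  simp only [← real_inner_self_eq_norm_sq, inner_conf]

theorem fourier_prod (f : Fin n → Space d → ℂ) (ξ : Conf d n) :
    𝓕 (fun x : Conf d n => ∏ i, f i (pos x i)) ξ = ∏ i, 𝓕 (f i) (pos ξ i) := by
  simp only [Real.fourier_eq']
  rw [← integral_fintype_prod_volume_eq_prod, ← (measurePreserving_confEquiv d n).integral_comp']
  refine integral_congr_ae (ae_of_all _ fun x => ?_)
  simp only [confEquiv_apply, smul_eq_mul, Finset.prod_mul_distrib, ← Complex.exp_sum, inner_conf,
    Finset.mul_sum, Complex.ofReal_sum, Finset.sum_mul]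

theorem integrable_prod_pos {f : Fin n → Space d → ℂ} (hf : ∀ i, Integrable (f i)) :
    Integrable fun x : Conf d n => ∏ i, f i (pos x i) :=
  (measurePreserving_pos d n).integrable_comp_of_integrable (Integrable.fintype_prod hf)

theorem ae_pos {ι : Type*} [Countable ι] {p : Fin n → Space d → Prop}
    (h : ∀ i, ∀ᵐ x, p i x) : ∀ᵐ x : Conf d n, ∀ i, p i (pos x i) :=
  ae_all_iff.2 fun i => (quasiMeasurePreserving_pos i).ae (h i)

/-- Elementary tensors depend continuously on their factors. -/
theorem continuous_tensorVec : Continuous (tensorVec : (Fin n → L2 (Space d)) → L2 (Conf d n)) := by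
  have hadd : ∀ [inst : DecidableEq (Fin n)] (ψ : Fin n → L2 (Space d)) (k : Fin n)
      (x y : L2 (Space d)), tensorVec (Function.update ψ k (x + y)) =
        tensorVec (Function.update ψ k x) + tensorVec (Function.update ψ k y) := by
    intro inst ψ k x y
    obtain rfl : inst = instDecidableEqFin n := Subsingleton.elim _ _
    exact tensorVec_update_add ψ k x y
  have hsmul : ∀ [inst : DecidableEq (Fin n)] (ψ : Fin n → L2 (Space d)) (k : Fin n) (c : ℂ)
      (x : L2 (Space d)), tensorVec (Function.update ψ k (c • x)) =
        c • tensorVec (Function.update ψ k x) := by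
    intro inst ψ k c x
    obtain rfl : inst = instDecidableEqFin n := Subsingleton.elim _ _
    exact tensorVec_update_smul ψ k c x
  exact (MultilinearMap.mkContinuous
    ({ toFun := tensorVec, map_update_add' := hadd, map_update_smul' := hsmul } :
      MultilinearMap ℂ (fun _ : Fin n => L2 (Space d)) (L2 (Conf d n))) 1 fun ψ => by
        rw [one_mul]
        exact (norm_tensorVec ψ).le).cont

theorem fourierTransform_tensorVec (ψ : Fin n → L2 (Space d)) :
    Lp.fourierTransformₗᵢ (Conf d n) ℂ (tensorVec ψ) =
      tensorVec fun i => Lp.fourierTransformₗᵢ (Space d) ℂ (ψ i) := by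
  have hd : DenseRange (Pi.map fun _ : Fin n =>
      (SchwartzMap.toLpCLM ℝ (E := Space d) ℂ 2 volume : SchwartzMap (Space d) ℂ → L2 (Space d))) :=
    DenseRange.piMap fun _ => SchwartzMap.denseRange_toLpCLM ENNReal.ofNat_ne_top
  refine hd.induction_on (p := fun ψ => Lp.fourierTransformₗᵢ (Conf d n) ℂ (tensorVec ψ) =
      tensorVec fun i => Lp.fourierTransformₗᵢ (Space d) ℂ (ψ i)) ψ ?_ fun f => ?_
  · refine isClosed_eq ((LinearIsometryEquiv.continuous _).comp continuous_tensorVec)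
      (continuous_tensorVec.comp (continuous_pi fun i => (LinearIsometryEquiv.continuous _).comp
        (continuous_apply i)))
  · refine fourierTransform_eq_of_integrable (g := fun x : Conf d n => ∏ i, f i (pos x i)) ?_
      (integrable_prod_pos fun i => (f i).integrable) ?_
    · filter_upwards [tensorVec_coeFn _, ae_pos (ι := Fin n) fun i => (f i).coeFn_toLp 2 volume]
        with x hx h
      rw [hx]
      exact Finset.prod_congr rfl fun i _ => h i
    · filter_upwards [tensorVec_coeFn _,
        ae_pos (ι := Fin n) fun i => (𝓕 (f i)).coeFn_toLp 2 volume] with x hx h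
      rw [hx, fourier_prod]
      refine Finset.prod_congr rfl fun i _ => ?_
      rw [← SchwartzMap.fourier_coe, ← h i, ← SchwartzMap.toLp_fourier_eq]
      rfl

theorem freeGroup_tensorVec (ħ t : ℝ) (ψ : Fin n → L2 (Space d)) :
    freeGroup ħ t (tensorVec ψ) = tensorVec fun i => freeGroup ħ t (ψ i) := by
  apply (Lp.fourierTransformₗᵢ (Conf d n) ℂ).injective
  rw [freeGroup_apply, LinearIsometryEquiv.apply_symm_apply, fourierTransform_tensorVec,
    fourierTransform_tensorVec]
  symm
  refine eq_mulOp_apply (memLp_phase ħ t) ?_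
  filter_upwards [tensorVec_coeFn fun i => Lp.fourierTransformₗᵢ (Space d) ℂ (ψ i),
    tensorVec_coeFn fun i => Lp.fourierTransformₗᵢ (Space d) ℂ (freeGroup ħ t (ψ i)),
    ae_pos (ι := Fin n) fun i =>
      mulOp_coeFn (memLp_phase ħ t) (Lp.fourierTransformₗᵢ (Space d) ℂ (ψ i))] with ξ h1 h2 h3
  have h4 : phase ħ t ξ = ∏ i, phase ħ t (pos ξ i) := by
    simp only [phase_eq, norm_sq_conf, ← Complex.exp_sum]
    congr 1
    push_cast
    rw [Finset.mul_sum, ← Finset.sum_neg_distrib, Finset.sum_mul]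
  rw [h1, h2, h4, ← Finset.prod_mul_distrib]
  refine Finset.prod_congr rfl fun i _ => ?_
  rw [← h3 i, freeGroup_apply, LinearIsometryEquiv.apply_symm_apply]

/-- The free group of `n` particles is the tensor power of the one-particle free group. -/
theorem freeGroup_eq_tensorOp (ħ t : ℝ) :
    (freeGroup ħ t : Op (Conf d n)) = tensorOp fun _ => freeGroup ħ t :=
  clm_ext_tensorVec fun ψ => by rw [freeGroup_tensorVec, tensorOp_tensorVec]

/-- Conjugation of a one-particle operator with the free group of `n` particles. -/
theorem freeGroup_comp_siteOp (ħ t : ℝ) (k : Fin n) (A : Op (Space d)) :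
    freeGroup ħ t ∘L siteOp k A =
      siteOp k (freeGroup ħ t ∘L A ∘L freeGroup ħ (-t)) ∘L freeGroup ħ t :=
  clm_ext_tensorVec fun ψ => by
    have h : freeGroup ħ (-t) (freeGroup ħ t (ψ k)) = ψ k :=
      congrArg (fun T : Op (Space d) => T (ψ k)) (freeGroup_neg_comp ħ t)
    simp only [ContinuousLinearMap.comp_apply, siteOp_tensorVec, freeGroup_tensorVec, h]
    congr 1
    ext1 i
    by_cases hi : i = k
    · subst hi
      simp
    · simp [hi]

end FourierTensor

/-! ### Completeness of the trace class -/

namespace TraceClass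

variable {H : Type*} [NormedAddCommGroup H] [InnerProductSpace ℂ H] [CompleteSpace H]

instance : CompleteSpace (TraceClass H) := by
  refine NormedAddCommGroup.completeSpace_of_summable_imp_tendsto fun u hu => ?_
  choose a b hab hle using fun n => (u n).exists_rep
  have hs : Summable fun p : ℕ × basisSet H => ‖a p.1 p.2‖ * ‖b p.1 p.2‖ := by
    refine (summable_prod_of_nonneg fun p => by positivity).2 ⟨fun n => (hab n).summable, ?_⟩
    exact Summable.of_nonneg_of_le (fun n => tsum_nonneg fun i => by positivity) hle hu
  obtain ⟨A, hA⟩ := exists_of_summable_rankOne hs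
  have h1 := hasSum_rankOne (A := mk A hA.traceNorm_lt_top) hA
  exact ⟨_, (h1.prod_fiberwise fun n => hasSum_rankOne (hab n)).tendsto_sum_nat⟩

/-- The inclusion of the trace class into the bounded operators. -/
def opL : TraceClass H →L[ℂ] H →L[ℂ] H :=
  LinearMap.mkContinuous { toFun := op, map_add' := op_add, map_smul' := op_smul } 1
    fun A => by
      rw [one_mul]
      exact norm_op_le A

/-- Left multiplication as a bounded bilinear map. -/
def lmulL : (H →L[ℂ] H) →L[ℂ] TraceClass H →L[ℂ] TraceClass H :=
  LinearMap.mkContinuous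
    { toFun := lmul
      map_add' := fun P Q => ContinuousLinearMap.ext fun A => lmul_add P Q A
      map_smul' := fun c P => ContinuousLinearMap.ext fun A => lmul_smul c P A } 1
    fun P => by
      rw [one_mul]
      exact ContinuousLinearMap.opNorm_le_bound _ (norm_nonneg _) (norm_lmul_le P)

/-- Right multiplication as a bounded bilinear map. -/
def rmulL : (H →L[ℂ] H) →L[ℂ] TraceClass H →L[ℂ] TraceClass H :=
  LinearMap.mkContinuous
    { toFun := rmul
      map_add' := fun P Q => ContinuousLinearMap.ext fun A => op_injective (by simp)
      map_smul' := fun c P => ContinuousLinearMap.ext fun A => op_injective (by simp) } 1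
    fun P => by
      rw [one_mul]
      exact ContinuousLinearMap.opNorm_le_bound _ (norm_nonneg _) (norm_rmul_le P)

/-- The commutator `[P, A]` of a bounded and a trace class operator. -/
def comm (P : H →L[ℂ] H) : TraceClass H →L[ℂ] TraceClass H := lmul P - rmul P

theorem comm_apply (P : H →L[ℂ] H) (A : TraceClass H) : comm P A = lmul P A - rmul P A := rfl

@[simp] theorem op_comm (P : H →L[ℂ] H) (A : TraceClass H) :
    (comm P A).op = P ∘L A.op - A.op ∘L P := rfl

theorem norm_comm_le (P : H →L[ℂ] H) (A : TraceClass H) : ‖comm P A‖ ≤ 2 * ‖P‖ * ‖A‖ := by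
  rw [comm_apply]
  linarith [norm_sub_le (lmul P A) (rmul P A), norm_lmul_le P A, norm_rmul_le P A]

theorem tr_comm (P : H →L[ℂ] H) (A : TraceClass H) : tr (comm P A) = 0 := by
  rw [comm_apply, map_sub, tr_lmul, sub_self]

/-- The invariance of the trace under cyclic permutations, for commutators. -/
theorem tr_rmul_comm (B P : H →L[ℂ] H) (A : TraceClass H) :
    tr (rmul B (comm P A)) = tr (rmul (B ∘L P - P ∘L B) A) := by
  have h1 : rmul B (comm P A) = lmul P (rmul B A) - rmul (P ∘L B) A :=
    op_injective (by simp [ContinuousLinearMap.comp_assoc])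
  have h2 : rmul (B ∘L P - P ∘L B) A = rmul P (rmul B A) - rmul (P ∘L B) A :=
    op_injective (by simp [ContinuousLinearMap.comp_assoc])
  rw [h1, h2, map_sub, map_sub, tr_lmul]

/-- Conjugation with a skew-adjoint generator preserves the trace norm to first order. -/
theorem norm_add_smul_comm_le {P : H →L[ℂ] H} (hP : ContinuousLinearMap.adjoint P = P) {c : ℂ}
    (hc : starRingEnd ℂ c = -c) (A : TraceClass H) (h : ℝ) :
    ‖A + h • c • comm P A‖ ≤ ‖A‖ + 2 * (‖c‖ * ‖P‖) ^ 2 * ‖A‖ * h ^ 2 := by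
  -- Multiplication by `1 + s c P`, for a skew-adjoint `c P`, changes norms to second order only.
  have hn : ∀ s : ℝ, ‖ContinuousLinearMap.id ℂ H + ((s : ℂ) * c) • P‖ ≤
      Real.sqrt (1 + (s * (‖c‖ * ‖P‖)) ^ 2) := by
    intro s
    refine ContinuousLinearMap.opNorm_le_bound _ (Real.sqrt_nonneg _) fun x => ?_
    have hre : (inner ℂ x (((s : ℂ) * c) • P x)).re = 0 := by
      have hself : starRingEnd ℂ (inner ℂ x (P x)) = inner ℂ x (P x) := by
        rw [inner_conj_symm, ← ContinuousLinearMap.adjoint_inner_right, hP]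
      have h1 : starRingEnd ℂ (inner ℂ x (((s : ℂ) * c) • P x)) =
          -inner ℂ x (((s : ℂ) * c) • P x) := by
        rw [inner_smul_right, map_mul, hself, map_mul, hc, Complex.conj_ofReal]
        ring
      have h2 := congrArg Complex.re h1
      rw [Complex.conj_re, Complex.neg_re] at h2
      linarith
    have h1 : ‖x + ((s : ℂ) * c) • P x‖ ^ 2 = ‖x‖ ^ 2 + ‖((s : ℂ) * c) • P x‖ ^ 2 := by
      rw [@norm_add_sq ℂ]
      have : RCLike.re (inner ℂ x (((s : ℂ) * c) • P x)) = 0 := hre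
      rw [this]
      ring
    have h2 : ‖((s : ℂ) * c) • P x‖ ≤ |s| * (‖c‖ * ‖P‖) * ‖x‖ := by
      rw [norm_smul, norm_mul, Complex.norm_real, Real.norm_eq_abs]
      have := P.le_opNorm x
      calc |s| * ‖c‖ * ‖P x‖ ≤ |s| * ‖c‖ * (‖P‖ * ‖x‖) := by gcongr
        _ = _ := by ring
    have h3 : ‖((s : ℂ) * c) • P x‖ ^ 2 ≤ (s * (‖c‖ * ‖P‖)) ^ 2 * ‖x‖ ^ 2 := by
      calc ‖((s : ℂ) * c) • P x‖ ^ 2 ≤ (|s| * (‖c‖ * ‖P‖) * ‖x‖) ^ 2 := by gcongr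
        _ = (s * (‖c‖ * ‖P‖)) ^ 2 * ‖x‖ ^ 2 := by rw [mul_pow, mul_pow, sq_abs, ← mul_pow]
    have h4 : ‖(ContinuousLinearMap.id ℂ H + ((s : ℂ) * c) • P) x‖ ^ 2 ≤
        (Real.sqrt (1 + (s * (‖c‖ * ‖P‖)) ^ 2) * ‖x‖) ^ 2 := by
      rw [mul_pow, Real.sq_sqrt (by positivity)]
      have : (ContinuousLinearMap.id ℂ H + ((s : ℂ) * c) • P) x = x + ((s : ℂ) * c) • P x := rfl
      rw [this, h1]
      linarith
    exact le_of_sq_le_sq h4 (by positivity)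
  set q := ‖c‖ * ‖P‖ with hq
  -- To first order in `h`, adding the commutator is conjugation with `1 + h c P`.
  have h1 : A + h • c • comm P A =
      lmul (ContinuousLinearMap.id ℂ H + ((h : ℂ) * c) • P)
        (rmul (ContinuousLinearMap.id ℂ H + (((-h : ℝ) : ℂ) * c) • P) A) +
      ((h : ℂ) * c) • ((h : ℂ) * c) • lmul P (rmul P A) := by
    refine op_injective ?_
    have h2 : h • c • comm P A = ((h : ℂ) * c) • comm P A := by
      rw [mul_smul]
      rfl
    rw [h2]
    ext x
    simp
    module
  have h2 := norm_lmul_le (ContinuousLinearMap.id ℂ H + ((h : ℂ) * c) • P)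
    (rmul (ContinuousLinearMap.id ℂ H + (((-h : ℝ) : ℂ) * c) • P) A)
  have h3 := norm_rmul_le (ContinuousLinearMap.id ℂ H + (((-h : ℝ) : ℂ) * c) • P) A
  have h4 := hn h
  have h5 := hn (-h)
  rw [neg_mul, neg_sq] at h5
  have h6 : ‖lmul P (rmul P A)‖ ≤ ‖P‖ * (‖P‖ * ‖A‖) :=
    (norm_lmul_le _ _).trans (by gcongr; exact norm_rmul_le _ _)
  have h7 : Real.sqrt (1 + (h * q) ^ 2) * Real.sqrt (1 + (h * q) ^ 2) = 1 + (h * q) ^ 2 :=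
    Real.mul_self_sqrt (by positivity)
  rw [h1]
  refine (norm_add_le _ _).trans ?_
  have h8 : ‖((h : ℂ) * c) • ((h : ℂ) * c) • lmul P (rmul P A)‖ ≤ (h * q) ^ 2 * ‖A‖ := by
    rw [norm_smul, norm_smul, norm_mul, Complex.norm_real, Real.norm_eq_abs]
    calc |h| * ‖c‖ * (|h| * ‖c‖ * ‖lmul P (rmul P A)‖)
        ≤ |h| * ‖c‖ * (|h| * ‖c‖ * (‖P‖ * (‖P‖ * ‖A‖))) := by gcongr
      _ = (|h| * |h|) * q ^ 2 * ‖A‖ := by rw [hq]; ring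
      _ = (h * q) ^ 2 * ‖A‖ := by rw [abs_mul_abs_self]; ring
  have h9 : ‖lmul (ContinuousLinearMap.id ℂ H + ((h : ℂ) * c) • P)
      (rmul (ContinuousLinearMap.id ℂ H + (((-h : ℝ) : ℂ) * c) • P) A)‖ ≤
      (1 + (h * q) ^ 2) * ‖A‖ := by
    refine h2.trans ?_
    rw [← h7, mul_assoc]
    exact mul_le_mul h4 (h3.trans (by gcongr)) (norm_nonneg _) (Real.sqrt_nonneg _)
  calc _ ≤ (1 + (h * q) ^ 2) * ‖A‖ + (h * q) ^ 2 * ‖A‖ := add_le_add h9 h8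
    _ = _ := by ring

end TraceClass

/-! ### The interaction picture -/

section Interaction

open TraceClass

/-- Strong convergence of linear contractions is joint convergence. -/
theorem tendsto_clm_apply {E : Type*} [NormedAddCommGroup E] [NormedSpace ℂ E] {α : Type*}
    {l : Filter α} {L : α → E →L[ℂ] E} {L₀ : E →L[ℂ] E} (hL : ∀ a x, ‖L a x‖ ≤ ‖x‖)
    (hlim : ∀ x, Tendsto (fun a => L a x) l (𝓝 (L₀ x))) {x : α → E} {x₀ : E}
    (hx : Tendsto x l (𝓝 x₀)) : Tendsto (fun a => L a (x a)) l (𝓝 (L₀ x₀)) := by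
  have h1 : Tendsto (fun a => L a (x a - x₀)) l (𝓝 0) := by
    refine squeeze_zero_norm (fun a => hL a _) ?_
    simpa using (tendsto_iff_norm_sub_tendsto_zero.1 hx)
  simpa using h1.add (hlim x₀)

variable {X : Type*} [NormedAddCommGroup X] [InnerProductSpace ℝ X] [FiniteDimensional ℝ X]
  [MeasurableSpace X] [BorelSpace X]

/-- The free evolution as a map of the trace class. -/
def evo (ħ t : ℝ) : TraceClass (L2 X) →L[ℂ] TraceClass (L2 X) :=
  lmul (freeGroup ħ t) ∘L rmul (freeGroup ħ (-t))

@[simp] theorem op_evo (ħ t : ℝ) (A : TraceClass (L2 X)) :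
    (evo ħ t A).op = freeEvolution ħ t A.op := rfl

theorem norm_lmul_freeGroup_le (ħ t : ℝ) (A : TraceClass (L2 X)) :
    ‖lmul (freeGroup ħ t) A‖ ≤ ‖A‖ :=
  (norm_lmul_le _ _).trans (mul_le_of_le_one_left (norm_nonneg _) (norm_freeGroup_le ħ t))

theorem norm_rmul_freeGroup_le (ħ t : ℝ) (A : TraceClass (L2 X)) :
    ‖rmul (freeGroup ħ t) A‖ ≤ ‖A‖ :=
  (norm_rmul_le _ _).trans (mul_le_of_le_one_left (norm_nonneg _) (norm_freeGroup_le ħ t))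

theorem norm_evo_le (ħ t : ℝ) (A : TraceClass (L2 X)) : ‖evo ħ t A‖ ≤ ‖A‖ :=
  (norm_lmul_freeGroup_le ħ t _).trans (norm_rmul_freeGroup_le ħ (-t) A)

theorem freeEvolution_zero (ħ : ℝ) (A : Op X) : freeEvolution ħ 0 A = A := by
  rw [freeEvolution, neg_zero, freeGroup_zero]
  simp

theorem freeEvolution_freeEvolution_neg (ħ t : ℝ) (A : Op X) :
    freeEvolution ħ t (freeEvolution ħ (-t) A) = A := by
  rw [freeEvolution, freeEvolution, neg_neg]
  ext1 ψ
  have h : ∀ χ : L2 X, freeGroup ħ t (freeGroup ħ (-t) χ) = χ := fun χ =>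
    congrArg (fun T : Op X => T χ) (freeGroup_comp_neg ħ t)
  simp only [ContinuousLinearMap.comp_apply, h]

theorem freeEvolution_mul (ħ t : ℝ) (A B : Op X) :
    freeEvolution ħ t (A ∘L B) = freeEvolution ħ t A ∘L freeEvolution ħ t B := by
  have h : ∀ C : Op X, freeGroup ħ (-t) ∘L freeGroup ħ t ∘L C = C := fun C => by
    rw [← ContinuousLinearMap.comp_assoc, freeGroup_neg_comp, ContinuousLinearMap.id_comp]
  simp only [freeEvolution, ContinuousLinearMap.comp_assoc, h]

theorem freeEvolution_sub (ħ t : ℝ) (A B : Op X) :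
    freeEvolution ħ t (A - B) = freeEvolution ħ t A - freeEvolution ħ t B := by
  simp [freeEvolution]

theorem adjoint_freeEvolution (ħ t : ℝ) (A : Op X) :
    ContinuousLinearMap.adjoint (freeEvolution ħ t A) =
      freeEvolution ħ t (ContinuousLinearMap.adjoint A) := by
  simp only [freeEvolution, ContinuousLinearMap.adjoint_comp, adjoint_freeGroup, neg_neg,
    ContinuousLinearMap.comp_assoc]

theorem norm_freeEvolution_le (ħ t : ℝ) (A : Op X) : ‖freeEvolution ħ t A‖ ≤ ‖A‖ := by
  refine (ContinuousLinearMap.opNorm_comp_le _ _).trans ?_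
  refine (mul_le_of_le_one_left (norm_nonneg _) (norm_freeGroup_le ħ t)).trans ?_
  refine (ContinuousLinearMap.opNorm_comp_le _ _).trans ?_
  exact mul_le_of_le_one_right (norm_nonneg _) (norm_freeGroup_le ħ (-t))

theorem inner_freeEvolution (ħ t : ℝ) (A : Op X) (φ ψ : L2 X) :
    inner ℂ φ (freeEvolution ħ t A ψ) =
      inner ℂ (freeGroup ħ (-t) φ) (A (freeGroup ħ (-t) ψ)) := by
  rw [← adjoint_freeGroup ħ t, ContinuousLinearMap.adjoint_inner_left, adjoint_freeGroup]
  rfl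

theorem continuous_evo (ħ : ℝ) {s : ℝ → ℝ} (hs : Continuous s) {R : ℝ → TraceClass (L2 X)}
    (hR : Continuous R) : Continuous fun t => evo ħ (s t) (R t) := by
  refine continuous_iff_continuousAt.2 fun t => ?_
  have h1 : Tendsto (fun a => rmul (freeGroup ħ (-s a)) (R a)) (𝓝 t)
      (𝓝 (rmul (freeGroup ħ (-s t)) (R t))) := by
    refine tendsto_clm_apply (L := fun a => rmul (freeGroup ħ (-s a)))
      (fun a => norm_rmul_freeGroup_le ħ _) (fun A => ?_) (hR.tendsto t)
    refine tendsto_rmul (C := 1) (Eventually.of_forall fun a => norm_freeGroup_le ħ _)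
      (fun ψ => ?_) A
    simp only [adjoint_freeGroup, neg_neg]
    exact tendsto_freeGroup ħ (hs.tendsto t) ψ
  exact tendsto_clm_apply (L := fun a => lmul (freeGroup ħ (s a)))
    (fun a => norm_lmul_freeGroup_le ħ _) (fun A => tendsto_lmul (C := 1)
      (Eventually.of_forall fun a => norm_freeGroup_le ħ _)
      (fun ψ => tendsto_freeGroup ħ (hs.tendsto t) ψ) A) h1

/-- In the interaction picture, a mild solution of the von Neumann equation whose potential is
continuous in operator norm is a strong solution, for the trace norm. -/
theorem IsVonNeumannSolution.exists_interaction {ħ : ℝ} {W : ℝ → Op X} {D₀ : Op X} {D : ℝ → Op X}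
    (h : IsVonNeumannSolution ħ W D₀ D) (hW : ContinuousOn W (Set.Ici 0)) :
    ∃ J : ℝ → TraceClass (L2 X), (J 0).op = D₀ ∧
      (∀ t, 0 ≤ t → (J t).op = freeEvolution ħ (-t) (D t)) ∧
      ∀ t, 0 ≤ t → HasDerivAt J
        ((Complex.I * (ħ : ℂ))⁻¹ • comm (freeEvolution ħ (-t) (W t)) (J t)) t := by
  -- All data are extended to negative times by their values at time zero.
  let m : ℝ → ℝ := fun t => max t 0
  have hm0 : ∀ t, 0 ≤ m t := fun t => le_max_right _ _
  have hm : ∀ t, 0 ≤ t → m t = t := fun t ht => max_eq_left ht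
  have hmc : Continuous m := continuous_id.max continuous_const
  let G : ℝ → TraceClass (L2 X) := fun t => ⟨D (m t), h.traceNorm_lt_top _ (hm0 t)⟩
  have hG : Continuous G := by
    have h1 : ContinuousOn G (Set.Ici 0) := by
      intro t ht
      refine tendsto_iff_norm_sub_tendsto_zero.2 ?_
      have h2 := (ENNReal.tendsto_toReal ENNReal.zero_ne_top).comp (h.continuous t ht)
      refine h2.congr' ?_
      filter_upwards [self_mem_nhdsWithin] with s hs
      have h3 : ‖G s - G t‖ = (traceNorm (D (m s) - D (m t))).toReal := rfl
      rw [h3, hm s hs, hm t ht]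
      rfl
    have h2 : G = G ∘ m := funext fun t => by
      simp only [G, Function.comp_def, hm _ (hm0 t)]
    rw [h2]
    exact h1.comp_continuous hmc hm0
  have hWm : Continuous fun t => W (m t) := hW.comp_continuous hmc hm0
  have hRc : Continuous fun t => comm (W (m t)) (G t) :=
    ((lmulL.continuous.comp hWm).clm_apply hG).sub ((rmulL.continuous.comp hWm).clm_apply hG)
  let K : ℝ → TraceClass (L2 X) := fun t => evo ħ (-m t) (comm (W (m t)) (G t))
  have hK : Continuous K := continuous_evo ħ hmc.neg hRc
  set c := (Complex.I * (ħ : ℂ))⁻¹ with hc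
  have hD0 : D 0 = D₀ := by
    ext1 ψ
    refine ext_inner_left ℂ fun φ => ?_
    have h1 := h.duhamel 0 le_rfl φ ψ
    rwa [intervalIntegral.integral_same, mul_zero, add_zero, freeEvolution_zero] at h1
  let J : ℝ → TraceClass (L2 X) := fun t => G 0 + c • ∫ τ in (0 : ℝ)..t, K τ
  have hJ0 : (J 0).op = D₀ := by
    simp only [J, G, intervalIntegral.integral_same, smul_zero, add_zero, op_mk, hm 0 le_rfl, hD0]
  have hJ : ∀ t, 0 ≤ t → (J t).op = freeEvolution ħ (-t) (D t) := by
    intro t ht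
    ext1 ψ
    refine ext_inner_left ℂ fun φ => ?_
    let ℓ : TraceClass (L2 X) →L[ℂ] ℂ :=
      innerSL ℂ φ ∘L ContinuousLinearMap.apply ℂ (L2 X) ψ ∘L opL
    have hℓ : ∀ A : TraceClass (L2 X), ℓ A = inner ℂ φ (A.op ψ) := fun A => rfl
    rw [← hℓ, map_add, map_smul, ← ContinuousLinearMap.intervalIntegral_comp_comm _
      (hK.intervalIntegrable 0 t), inner_freeEvolution, neg_neg, h.duhamel t ht, hℓ, smul_eq_mul]
    congr 1
    · rw [inner_freeEvolution]
      have h1 : ∀ χ : L2 X, freeGroup ħ (-t) (freeGroup ħ t χ) = χ := fun χ =>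
        congrArg (fun T : Op X => T χ) (freeGroup_neg_comp ħ t)
      rw [h1, h1, op_mk, hm 0 le_rfl, hD0]
    · congr 1
      refine intervalIntegral.integral_congr fun τ hτ => ?_
      rw [Set.uIcc_of_le ht] at hτ
      have h1 : ∀ χ : L2 X, freeGroup ħ (-(t - τ)) (freeGroup ħ t χ) = freeGroup ħ τ χ := fun χ => by
        rw [← ContinuousLinearMap.comp_apply, freeGroup_comp]
        congr 2
        ring
      show ℓ (K τ) = _
      rw [hℓ, inner_freeEvolution, h1, h1, op_evo, inner_freeEvolution, hm τ hτ.1, neg_neg, op_comm,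
        op_mk, hm τ hτ.1]
  refine ⟨J, hJ0, hJ, fun t ht => ?_⟩
  have h1 : HasDerivAt J (c • K t) t :=
    ((intervalIntegral.integral_hasDerivAt_right (hK.intervalIntegrable 0 t)
      (hK.stronglyMeasurableAtFilter _ _) hK.continuousAt).const_smul c).const_add _
  -- The free evolution is multiplicative, so the integrand is the commutator in the interaction
  -- picture.
  have h2 : K t = comm (freeEvolution ħ (-t) (W t)) (J t) := by
    refine op_injective ?_
    rw [op_evo, op_comm, op_comm, hJ t ht, hm t ht, op_mk, hm t ht, freeEvolution_sub,
      freeEvolution_mul, freeEvolution_mul]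
  rwa [h2] at h1

/-- A curve whose tangents do not increase the norm to first order has nonincreasing norm. -/
theorem norm_le_of_tangent {E : Type*} [NormedAddCommGroup E] [NormedSpace ℝ E] {J J' : ℝ → E}
    (hJ : ∀ t, 0 ≤ t → HasDerivAt J (J' t) t)
    (hJ' : ∀ t, 0 ≤ t → ∃ C, ∀ h : ℝ, ‖J t + h • J' t‖ ≤ ‖J t‖ + C * h ^ 2) {t : ℝ} (ht : 0 ≤ t) :
    ‖J t‖ ≤ ‖J 0‖ := by
  refine le_of_forall_pos_le_add fun ε hε => ?_
  have key : ∀ x ∈ Set.Icc 0 t, ‖J x‖ ≤ ‖J 0‖ + ε / (t + 1) * x := by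
    refine image_norm_le_of_liminf_right_slope_norm_lt_deriv_boundary (f' := fun _ => 0)
      (B' := fun _ => ε / (t + 1)) (fun x hx => (hJ x hx.1).continuousAt.continuousWithinAt)
      ?_ (by simp) (by fun_prop) (fun x _ => HasDerivAt.hasDerivWithinAt (by
        simpa using ((hasDerivAt_id x).const_mul (ε / (t + 1))).const_add ‖J 0‖))
      (fun x _ _ => by positivity)
    intro x hx r hr
    obtain ⟨C, hC⟩ := hJ' x hx.1
    have h1 := (hJ x hx.1).isLittleO
    have h2 : ∀ᶠ z in 𝓝[>] x, ‖J z - J x - (z - x) • J' x‖ ≤ r / 3 * ‖z - x‖ :=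
      (h1.def (by positivity)).filter_mono nhdsWithin_le_nhds
    have h3 : ∀ᶠ z in 𝓝[>] x, C * (z - x) < r / 3 := by
      have h4 : Tendsto (fun z => C * (z - x)) (𝓝 x) (𝓝 (C * (x - x))) :=
        (continuous_const.mul (continuous_id.sub continuous_const)).tendsto x
      rw [sub_self, mul_zero] at h4
      exact (h4.eventually_lt_const (by positivity)).filter_mono nhdsWithin_le_nhds
    refine Eventually.frequently ?_
    filter_upwards [h2, h3, self_mem_nhdsWithin] with z hz2 hz3 hz
    have hzx : 0 < z - x := sub_pos.2 hz
    rw [Real.norm_of_nonneg hzx.le] at hz2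
    rw [slope_def_field, div_lt_iff₀ hzx]
    have h5 : ‖J z‖ ≤ ‖J x + (z - x) • J' x‖ + ‖J z - J x - (z - x) • J' x‖ := by
      refine le_trans (le_of_eq ?_) (norm_add_le _ _)
      congr 1
      abel
    have h6 := hC (z - x)
    simp only [Function.comp_apply]
    nlinarith
  refine (key t (Set.right_mem_Icc.2 ht)).trans ?_
  have : ε / (t + 1) * t ≤ ε := by
    rw [div_mul_eq_mul_div, div_le_iff₀ (by positivity)]
    nlinarith
  linarith

theorem conj_inv_I_mul (ħ : ℝ) :
    starRingEnd ℂ (Complex.I * (ħ : ℂ))⁻¹ = -(Complex.I * (ħ : ℂ))⁻¹ := by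
  rw [map_inv₀, map_mul, Complex.conj_I, Complex.conj_ofReal, neg_mul, inv_neg]

/-- The trace norm does not increase along the flow of a self-adjoint potential. -/
theorem norm_le_of_hasDerivAt_comm {H : Type*} [NormedAddCommGroup H] [InnerProductSpace ℂ H]
    [CompleteSpace H] {ħ : ℝ} {J : ℝ → TraceClass H} {W : ℝ → H →L[ℂ] H}
    (hJ : ∀ t, 0 ≤ t → HasDerivAt J ((Complex.I * (ħ : ℂ))⁻¹ • comm (W t) (J t)) t)
    (hW : ∀ t, 0 ≤ t → ContinuousLinearMap.adjoint (W t) = W t) {t : ℝ} (ht : 0 ≤ t) :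
    ‖J t‖ ≤ ‖J 0‖ :=
  norm_le_of_tangent hJ (fun t ht =>
    ⟨_, fun h => norm_add_smul_comm_le (hW t ht) (conj_inv_I_mul ħ) (J t) h⟩) ht

/-- The trace is conserved. -/
theorem tr_eq_of_hasDerivAt_comm {H : Type*} [NormedAddCommGroup H] [InnerProductSpace ℂ H]
    [CompleteSpace H] {c : ℂ} {J : ℝ → TraceClass H} {W : ℝ → H →L[ℂ] H}
    (hJ : ∀ t, 0 ≤ t → HasDerivAt J (c • comm (W t) (J t)) t) {t : ℝ} (ht : 0 ≤ t) :
    tr (J t) = tr (J 0) := by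
  have h1 : ∀ s, 0 ≤ s → HasDerivAt (fun s => tr (J s)) 0 s := fun s hs => by
    have h2 := (tr.restrictScalars ℝ).hasFDerivAt.comp_hasDerivAt s (hJ s hs)
    have h3 : (tr.restrictScalars ℝ) (c • comm (W s) (J s)) = 0 := by
      show tr (c • comm (W s) (J s)) = 0
      rw [map_smul, tr_comm, smul_zero]
    rwa [h3] at h2
  exact constant_of_has_deriv_right_zero
    (fun s hs => (h1 s hs.1).continuousAt.continuousWithinAt)
    (fun s hs => (h1 s hs.1).hasDerivWithinAt) t (Set.right_mem_Icc.2 ht)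

end Interaction

/-! ### Density operators and position densities -/

section Density

open TraceClass

variable {H : Type*} [NormedAddCommGroup H] [InnerProductSpace ℂ H] [CompleteSpace H]

theorem tr_adj (A : TraceClass H) : tr (adj A) = starRingEnd ℂ (tr A) := by
  rw [tr_apply, tr_apply, trace, trace]
  refine Eq.trans (tsum_congr fun i => ?_) (Complex.conjCLE.map_tsum).symm
  rw [op_adj, ContinuousLinearMap.adjoint_inner_right, ← inner_conj_symm]
  rfl

theorem norm_adj_le (A : TraceClass H) : ‖adj A‖ ≤ ‖A‖ := by
  obtain ⟨a, b, h, h1⟩ := A.exists_rep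
  refine le_trans ?_ h1
  simp_rw [mul_comm ‖a _‖]
  exact IsNuclearRep.norm_traceClass_le (A := adj A) h.adjoint

theorem IsDensityOperator.norm_le_one {A : TraceClass H} (hA : IsDensityOperator A.op) :
    ‖A‖ ≤ 1 := by
  have h0 : (0 : H →L[ℂ] H) ≤ A.op := (ContinuousLinearMap.nonneg_iff_isPositive _).2 hA.isPositive
  have hnn : ∀ i, 0 ≤ (inner ℂ (basis H i) (A.op (basis H i))).re := fun i =>
    hA.isPositive.re_inner_nonneg_right _
  have h1 : traceNorm A.op = ∑' i, ENNReal.ofReal (inner ℂ (basis H i) (A.op (basis H i))).re := by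
    rw [traceNorm, CFC.abs_of_nonneg _ h0]
  have hs : Summable fun i => (inner ℂ (basis H i) (A.op (basis H i))).re := by
    have h2 := ENNReal.summable_toReal (h1 ▸ A.traceNorm_op_lt_top.ne)
    refine h2.congr fun i => ENNReal.toReal_ofReal (hnn i)
  have h3 : ∑' i, (inner ℂ (basis H i) (A.op (basis H i))).re = 1 := by
    have hc : ∀ i, inner ℂ (basis H i) (A.op (basis H i)) =
        (((inner ℂ (basis H i) (A.op (basis H i))).re : ℝ) : ℂ) := fun i => by
      have h4 := hA.isPositive.inner_nonneg_right (basis H i)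
      exact Complex.ext rfl (Complex.nonneg_iff.1 h4).2.symm
    have h5 : trace A.op = ((∑' i, (inner ℂ (basis H i) (A.op (basis H i))).re : ℝ) : ℂ) := by
      rw [trace, Complex.ofReal_tsum]
      exact tsum_congr hc
    rw [hA.trace_eq_one] at h5
    exact_mod_cast h5.symm
  rw [norm_def, h1, ← ENNReal.ofReal_tsum_of_nonneg hnn hs, h3]
  simp

variable {d : ℕ}

theorem IsPositionDensity.sub {G G' : TraceClass (L2 (Space d))} {ρ ρ' : Space d → ℂ}
    (h : IsPositionDensity G.op ρ) (h' : IsPositionDensity G'.op ρ') :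
    IsPositionDensity (G - G').op (ρ - ρ') := by
  refine ⟨h.1.sub h'.1, fun f hf => ?_⟩
  have hi : ∀ {σ : Space d → ℂ}, Integrable σ → Integrable fun x => f x * σ x := fun hσ =>
    hσ.mul_of_top_right hf
  have h1 : tr (lmul (mulOp f) (G - G')) = tr (lmul (mulOp f) G) - tr (lmul (mulOp f) G') := by
    rw [map_sub, map_sub]
  refine Eq.trans ?_ h1.symm
  refine Eq.trans ?_ (congrArg₂ (· - ·) (h.2 f hf) (h'.2 f hf))
  rw [← integral_sub (hi h.1) (hi h'.1)]
  simp only [Pi.sub_apply, mul_sub]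

theorem memLp_conj {f : Space d → ℂ} (hf : MemLp f ∞ volume) :
    MemLp (fun x => starRingEnd ℂ (f x)) ∞ volume :=
  hf.star

theorem IsPositionDensity.conj {G : TraceClass (L2 (Space d))} {ρ : Space d → ℂ}
    (h : IsPositionDensity G.op ρ) :
    IsPositionDensity (adj G).op (fun x => starRingEnd ℂ (ρ x)) := by
  refine ⟨Complex.conjCLE.integrable_comp_iff.2 h.1, fun f hf => ?_⟩
  have h1 := congrArg (starRingEnd ℂ) (h.2 _ (memLp_conj hf))
  have h2 : trace (mulOp (fun x => starRingEnd ℂ (f x)) ∘L G.op) =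
      tr (lmul (mulOp fun x => starRingEnd ℂ (f x)) G) := rfl
  rw [h2, ← tr_adj, ← integral_conj] at h1
  have h3 : adj (lmul (mulOp fun x => starRingEnd ℂ (f x)) G) = rmul (mulOp f) (adj G) := by
    refine op_injective ?_
    rw [op_adj, op_lmul, op_rmul, op_adj, ContinuousLinearMap.adjoint_comp,
      mulOp_adjoint (memLp_conj hf)]
    simp only [Complex.conj_conj]
  rw [h3, ← tr_lmul] at h1
  refine Eq.trans (integral_congr_ae (ae_of_all _ fun x => ?_)) h1
  simp

/-- The position density is bounded in `L¹` by the trace norm. -/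
theorem IsPositionDensity.integral_norm_le {G : TraceClass (L2 (Space d))} {ρ : Space d → ℂ}
    (h : IsPositionDensity G.op ρ) : ∫ x, ‖ρ x‖ ≤ ‖G‖ := by
  -- The test function is the phase of the density.
  let f : Space d → ℂ := fun x => starRingEnd ℂ (ρ x) / (‖ρ x‖ : ℂ)
  have hf1 : ∀ x, ‖f x‖ ≤ 1 := fun x => by
    rw [norm_div, RCLike.norm_conj, Complex.norm_real, norm_norm]
    exact div_self_le_one _
  have hf : MemLp f ∞ volume := by
    refine memLp_top_of_norm_le ?_ hf1
    exact ((Complex.continuous_conj.comp_aestronglyMeasurable h.1.1).mul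
      ((Complex.continuous_ofReal.comp_aestronglyMeasurable h.1.1.norm).inv₀)).congr
        (ae_of_all _ fun x => (div_eq_mul_inv _ _).symm)
  have h1 : ∀ x, f x * ρ x = ((‖ρ x‖ : ℝ) : ℂ) := fun x => by
    simp only [f]
    by_cases hx : ρ x = 0
    · simp [hx]
    · have hx' : ((‖ρ x‖ : ℝ) : ℂ) ≠ 0 := by simpa using hx
      rw [div_mul_eq_mul_div, div_eq_iff hx', mul_comm, Complex.mul_conj, Complex.normSq_eq_norm_sq]
      push_cast
      ring
  have h2 := h.2 f hf
  simp only [h1] at h2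
  rw [integral_complex_ofReal] at h2
  have h3 : ‖((∫ x, ‖ρ x‖ : ℝ) : ℂ)‖ ≤ ‖G‖ := by
    rw [h2]
    refine (TraceClass.norm_trace_le (lmul (mulOp f) G)).trans ((norm_lmul_le _ _).trans ?_)
    exact mul_le_of_le_one_left (norm_nonneg _)
      (norm_mulOp_le zero_le_one (ae_of_all _ hf1))
  rwa [Complex.norm_real, Real.norm_of_nonneg (integral_nonneg fun x => norm_nonneg _)] at h3

theorem average_sub {ρ ρ' : Space d → ℂ} (hρ : Integrable ρ) (hρ' : Integrable ρ')
    {h : Space d × Space d → ℂ} (hm : Measurable h) {C : ℝ} (hC : ∀ x, ‖h x‖ ≤ C) :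
    average (ρ - ρ') h = average ρ h - average ρ' h := by
  funext x
  simp only [average, Pi.sub_apply, mul_sub]
  exact integral_sub (integrable_average hρ hm hC x) (integrable_average hρ' hm hC x)

/-- The averaged potential depends on the state in a Lipschitz manner. -/
theorem norm_mulOp_average_sub_le {G G' : TraceClass (L2 (Space d))} {ρ ρ' : Space d → ℂ}
    (hρ : IsPositionDensity G.op ρ) (hρ' : IsPositionDensity G'.op ρ')
    {h : Space d × Space d → ℂ} (hm : Measurable h) {L : ℝ} (hL : 0 ≤ L) (hh : ∀ x, ‖h x‖ ≤ L) :
    ‖mulOp (average ρ h) - mulOp (average ρ' h)‖ ≤ L * ‖G - G'‖ := by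
  rw [← mulOp_sub (memLp_average hρ.1 hm hh) (memLp_average hρ'.1 hm hh),
    ← average_sub hρ.1 hρ'.1 hm hh]
  refine norm_mulOp_le (by positivity) (ae_of_all _ fun x => ?_)
  exact (norm_average_le (hρ.1.sub hρ'.1) hh x).trans
    (mul_le_mul_of_nonneg_left (hρ.sub hρ').integral_norm_le hL)

theorem norm_mulOp_average_le {G : TraceClass (L2 (Space d))} {ρ : Space d → ℂ}
    (hρ : IsPositionDensity G.op ρ) {h : Space d × Space d → ℂ} {L : ℝ} (hL : 0 ≤ L)
    (hh : ∀ x, ‖h x‖ ≤ L) : ‖mulOp (average ρ h)‖ ≤ L * ‖G‖ :=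
  norm_mulOp_le (by positivity) (ae_of_all _ fun x => (norm_average_le hρ.1 hh x).trans
    (mul_le_mul_of_nonneg_left hρ.integral_norm_le hL))

theorem adjoint_mulOp_average {ρ : Space d → ℂ} (hρ : Integrable ρ)
    {h : Space d × Space d → ℂ} (hm : Measurable h) {C : ℝ} (hC : ∀ x, ‖h x‖ ≤ C)
    (hreal : ∀ x, starRingEnd ℂ (h x) = h x) :
    ContinuousLinearMap.adjoint (mulOp (average ρ h)) =
      mulOp (average (fun x => starRingEnd ℂ (ρ x)) h) := by
  rw [mulOp_adjoint (memLp_average hρ hm hC)]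
  refine congrArg mulOp (funext fun x => ?_)
  simp only [average, ← integral_conj, map_mul, hreal]

end Density

/-! ### The Hartree flow -/

section Hartree

open TraceClass

variable {d : ℕ}

/-- An essentially bounded even function has a representative that is measurable, bounded by the
essential supremum, and even everywhere. -/
theorem exists_even_representative {Φ : Space d → ℝ} (hΦ : MemLp Φ ∞ volume)
    (hev : ∀ᵐ x, Φ (-x) = Φ x) : ∃ Ψ : Space d → ℝ, Measurable Ψ ∧ (∀ x, |Ψ x| ≤ supNorm Φ) ∧
      (∀ x, Ψ (-x) = Ψ x) ∧ Ψ =ᵐ[volume] Φ := by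
  have hL : 0 ≤ supNorm Φ := ENNReal.toReal_nonneg
  set L := supNorm Φ with hLdef
  have hb : ∀ᵐ x, |Φ x| ≤ L := by
    filter_upwards [ae_le_eLpNormEssSup (f := Φ) (μ := volume)] with x hx
    rw [← eLpNorm_exponent_top] at hx
    have h1 := ENNReal.toReal_mono hΦ.2.ne hx
    rwa [toReal_enorm, Real.norm_eq_abs] at h1
  let g : Space d → ℝ := fun x => max (-L) (min L (hΦ.1.mk Φ x))
  have hgm : Measurable g :=
    measurable_const.max (measurable_const.min hΦ.1.stronglyMeasurable_mk.measurable)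
  have hgb : ∀ x, |g x| ≤ L := fun x =>
    abs_le.2 ⟨le_max_left _ _, max_le (by linarith) (min_le_left _ _)⟩
  have hgΦ : ∀ᵐ x, g x = Φ x := by
    filter_upwards [hΦ.1.ae_eq_mk, hb] with x hx hx'
    simp only [g]
    rw [← hx, min_eq_right (abs_le.1 hx').2, max_eq_right (abs_le.1 hx').1]
  have hgΦ' : ∀ᵐ x, g (-x) = Φ (-x) :=
    (Measure.measurePreserving_neg (volume : Measure (Space d))).quasiMeasurePreserving.ae hgΦ
  refine ⟨fun x => (g x + g (-x)) / 2, (hgm.add (hgm.comp measurable_neg)).div_const 2, fun x => ?_,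
    fun x => ?_, ?_⟩
  · have h1 := abs_le.1 (hgb x)
    have h2 := abs_le.1 (hgb (-x))
    exact abs_le.2 ⟨by linarith, by linarith⟩
  · simp only [neg_neg]
    ring
  · filter_upwards [hgΦ, hgΦ', hev] with x h1 h2 h3
    rw [h1, h2, h3]
    ring

/-- The interaction of two particles at the positions `x`, `y`. -/
def pairPotential (Ψ : Space d → ℝ) (p : Space d × Space d) : ℂ := ((Ψ (p.1 - p.2) : ℝ) : ℂ)

theorem measurable_pairPotential {Ψ : Space d → ℝ} (hΨ : Measurable Ψ) :
    Measurable (pairPotential Ψ) :=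
  Complex.measurable_ofReal.comp (hΨ.comp (measurable_fst.sub measurable_snd))

theorem norm_pairPotential_le {Ψ : Space d → ℝ} {L : ℝ} (hL : ∀ x, |Ψ x| ≤ L)
    (p : Space d × Space d) : ‖pairPotential Ψ p‖ ≤ L := by
  rw [pairPotential, Complex.norm_real, Real.norm_eq_abs]
  exact hL _

theorem conj_pairPotential (Ψ : Space d → ℝ) (p : Space d × Space d) :
    starRingEnd ℂ (pairPotential Ψ p) = pairPotential Ψ p :=
  Complex.conj_ofReal _

theorem hartreePotential_eq_average {Φ Ψ : Space d → ℝ} (h : Ψ =ᵐ[volume] Φ) (ρ : Space d → ℂ) :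
    hartreePotential Φ ρ = average ρ (pairPotential Ψ) := by
  funext x
  rw [hartreePotential, convolution_eq_swap, average]
  have h1 : ∀ᵐ y : Space d, Ψ (x - y) = Φ (x - y) :=
    (Measure.measurePreserving_sub_left (volume : Measure (Space d)) x).quasiMeasurePreserving.ae h
  refine integral_congr_ae ?_
  filter_upwards [h1] with y hy
  simp [pairPotential, hy]

/-- A solution of the Hartree equation in the interaction picture: a curve of trace class operators
in the unit ball, of trace one, that is driven by its averaged potential. -/
structure IsHartreeFlow (ħ : ℝ) (h : Space d × Space d → ℂ) (J : ℝ → TraceClass (L2 (Space d)))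
    (ρ : ℝ → Space d → ℂ) : Prop where
  density : ∀ t, 0 ≤ t → IsPositionDensity (evo ħ t (J t)).op (ρ t)
  hasDerivAt : ∀ t, 0 ≤ t → HasDerivAt J ((Complex.I * (ħ : ℂ))⁻¹ •
    comm (freeEvolution ħ (-t) (mulOp (average (ρ t) h))) (J t)) t
  norm_le_one : ∀ t, 0 ≤ t → ‖J t‖ ≤ 1
  tr_eq_one : ∀ t, 0 ≤ t → tr (J t) = 1

theorem evo_adj (ħ t : ℝ) (A : TraceClass (L2 (Space d))) : evo ħ t (adj A) = adj (evo ħ t A) :=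
  op_injective (by rw [op_evo, op_adj, op_adj, op_evo, adjoint_freeEvolution])

/-- Solutions of the Hartree equation stay self-adjoint: the difference of the solution and its
adjoint satisfies a linear Gronwall inequality. -/
theorem adj_eq_of_hartree {ħ : ℝ} (hħ : 0 < ħ) {h : Space d × Space d → ℂ} (hm : Measurable h)
    {L : ℝ} (hL : 0 ≤ L) (hh : ∀ x, ‖h x‖ ≤ L) (hreal : ∀ x, starRingEnd ℂ (h x) = h x)
    {J : ℝ → TraceClass (L2 (Space d))} {ρ : ℝ → Space d → ℂ}
    (hρ : ∀ t, 0 ≤ t → IsPositionDensity (evo ħ t (J t)).op (ρ t))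
    (hJ : ∀ t, 0 ≤ t → HasDerivAt J ((Complex.I * (ħ : ℂ))⁻¹ •
      comm (freeEvolution ħ (-t) (mulOp (average (ρ t) h))) (J t)) t)
    (h0 : adj (J 0) = J 0) {t : ℝ} (ht : 0 ≤ t) : adj (J t) = J t := by
  set c := (Complex.I * (ħ : ℂ))⁻¹ with hc
  have hcn : ‖c‖ = 1 / ħ := by
    rw [hc, norm_inv, norm_mul, Complex.norm_I, one_mul, Complex.norm_real,
      Real.norm_of_nonneg hħ.le, one_div]
  have hJc : ContinuousOn J (Set.Icc 0 t) := fun s hs =>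
    (hJ s hs.1).continuousAt.continuousWithinAt
  obtain ⟨M, hM⟩ := isCompact_Icc.exists_bound_of_continuousOn hJc
  let W : ℝ → Op (Space d) := fun s => freeEvolution ħ (-s) (mulOp (average (ρ s) h))
  have hY : ∀ s, 0 ≤ s → HasDerivAt (fun s => J s - adj (J s))
      (c • comm (W s) (J s) - adj (c • comm (W s) (J s))) s := fun s hs =>
    (hJ s hs).sub (adj.hasFDerivAt.comp_hasDerivAt s (hJ s hs))
  have hadj : ∀ s, c • comm (W s) (J s) - adj (c • comm (W s) (J s)) =
      c • (comm (W s) (J s - adj (J s)) +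
        comm (W s - ContinuousLinearMap.adjoint (W s)) (adj (J s))) := by
    intro s
    refine op_injective ?_
    simp only [op_sub, op_smul, op_adj, op_comm, op_add, map_smulₛₗ, map_sub,
      ContinuousLinearMap.adjoint_comp, hc, conj_inv_I_mul, ContinuousLinearMap.comp_sub,
      ContinuousLinearMap.sub_comp]
    module
  have hbound : ∀ s ∈ Set.Ico 0 t, ‖c • comm (W s) (J s) - adj (c • comm (W s) (J s))‖ ≤
      (1 / ħ * (4 * L * M)) * ‖J s - adj (J s)‖ := by
    intro s hs
    have hMs := hM s ⟨hs.1, hs.2.le⟩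
    have h1 : ‖W s‖ ≤ L * M := (norm_freeEvolution_le _ _ _).trans
      ((norm_mulOp_average_le (hρ s hs.1) hL hh).trans
        (mul_le_mul_of_nonneg_left ((norm_evo_le _ _ _).trans hMs) hL))
    have h2 : ‖W s - ContinuousLinearMap.adjoint (W s)‖ ≤ L * ‖J s - adj (J s)‖ := by
      have h3 := norm_mulOp_average_sub_le (hρ s hs.1) (hρ s hs.1).conj hm hL hh
      rw [← adjoint_mulOp_average (hρ s hs.1).1 hm hh hreal, ← evo_adj, ← map_sub] at h3
      have h4 : W s - ContinuousLinearMap.adjoint (W s) = freeEvolution ħ (-s)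
          (mulOp (average (ρ s) h) - ContinuousLinearMap.adjoint (mulOp (average (ρ s) h))) := by
        rw [freeEvolution_sub, adjoint_freeEvolution]
      rw [h4]
      exact (norm_freeEvolution_le _ _ _).trans (h3.trans
        (mul_le_mul_of_nonneg_left (norm_evo_le _ _ _) hL))
    have h5 := norm_comm_le (W s) (J s - adj (J s))
    have h6 := norm_comm_le (W s - ContinuousLinearMap.adjoint (W s)) (adj (J s))
    have h7 : ‖adj (J s)‖ ≤ M := (norm_adj_le _).trans hMs
    have h8 : 2 * ‖W s‖ * ‖J s - adj (J s)‖ ≤ 2 * (L * M) * ‖J s - adj (J s)‖ := by gcongr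
    have h9 : 2 * ‖W s - ContinuousLinearMap.adjoint (W s)‖ * ‖adj (J s)‖ ≤
        2 * (L * ‖J s - adj (J s)‖) * M := by gcongr
    rw [hadj, norm_smul, hcn, mul_assoc]
    refine mul_le_mul_of_nonneg_left ((norm_add_le _ _).trans ?_) (by positivity)
    nlinarith
  have h1 := eq_zero_of_abs_deriv_le_mul_abs_self_of_eq_zero_right
    (fun s hs => (hY s hs.1).continuousAt.continuousWithinAt)
    (fun s hs => (hY s hs.1).hasDerivWithinAt) (by rw [h0, sub_self]) hbound t
    (Set.right_mem_Icc.2 ht)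
  exact (sub_eq_zero.1 h1).symm

/-- The interaction picture of a solution of the Hartree equation. The averaged potential is Lipschitz
in the state, hence continuous in time, so that mild solutions are strong. -/
theorem IsHartreeSolution.exists_flow {ħ : ℝ} (hħ : 0 < ħ) {Φ Ψ : Space d → ℝ}
    (hΨΦ : Ψ =ᵐ[volume] Φ) (hΨ : Measurable Ψ) {L : ℝ} (hL : ∀ x, |Ψ x| ≤ L)
    {F₀ : Op (Space d)} (hF₀ : IsDensityOperator F₀) {F : ℝ → Op (Space d)}
    (hF : IsHartreeSolution ħ Φ F₀ F) :
    ∃ (J : ℝ → TraceClass (L2 (Space d))) (ρ : ℝ → Space d → ℂ), (J 0).op = F₀ ∧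
      (∀ t, 0 ≤ t → (evo ħ t (J t)).op = F t) ∧ IsHartreeFlow ħ (pairPotential Ψ) J ρ := by
  obtain ⟨ρ, hρ, hsol⟩ := hF
  have hL0 : 0 ≤ L := (abs_nonneg _).trans (hL 0)
  have hm := measurable_pairPotential hΨ
  have hh := norm_pairPotential_le hL
  simp only [hartreePotential_eq_average hΨΦ] at hsol
  have hW : ContinuousOn (fun t => mulOp (average (ρ t) (pairPotential Ψ))) (Set.Ici 0) := by
    intro t ht
    refine tendsto_iff_norm_sub_tendsto_zero.2 ?_
    have h2 := ((ENNReal.tendsto_toReal ENNReal.zero_ne_top).comp (hsol.continuous t ht)).const_mul L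
    rw [ENNReal.toReal_zero, mul_zero] at h2
    refine squeeze_zero' (Eventually.of_forall fun s => norm_nonneg _) ?_ h2
    filter_upwards [self_mem_nhdsWithin] with s hs
    exact norm_mulOp_average_sub_le (G := ⟨F s, hsol.traceNorm_lt_top s hs⟩)
      (G' := ⟨F t, hsol.traceNorm_lt_top t ht⟩) (hρ s hs) (hρ t ht) hm hL0 hh
  obtain ⟨J, hJ0, hJ, hder⟩ := hsol.exists_interaction hW
  have hevo : ∀ t, 0 ≤ t → (evo ħ t (J t)).op = F t := fun t ht => by
    rw [op_evo, hJ t ht, freeEvolution_freeEvolution_neg]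
  have hden : ∀ t, 0 ≤ t → IsPositionDensity (evo ħ t (J t)).op (ρ t) := fun t ht => by
    rw [hevo t ht]
    exact hρ t ht
  have hden0 : IsDensityOperator (J 0).op := hJ0.symm ▸ hF₀
  have h0 : adj (J 0) = J 0 := op_injective (by
    rw [op_adj]
    exact hden0.isPositive.isSelfAdjoint.adjoint_eq)
  have hsa : ∀ t, 0 ≤ t → ContinuousLinearMap.adjoint (freeEvolution ħ (-t)
      (mulOp (average (ρ t) (pairPotential Ψ)))) =
        freeEvolution ħ (-t) (mulOp (average (ρ t) (pairPotential Ψ))) := by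
    intro t ht
    have h1 := adj_eq_of_hartree hħ hm hL0 hh (conj_pairPotential Ψ) hden hder h0 ht
    have h3 := norm_mulOp_average_sub_le (hden t ht) (hden t ht).conj hm hL0 hh
    rw [← adjoint_mulOp_average (hden t ht).1 hm hh (conj_pairPotential Ψ), ← evo_adj, h1, sub_self,
      norm_zero, mul_zero] at h3
    rw [adjoint_freeEvolution, ← sub_eq_zero.1 (norm_le_zero_iff.1 h3)]
  -- Self-adjointness of the potential gives the bound for the trace norm.
  refine ⟨J, ρ, hJ0, hevo, hden, hder, fun t ht => ?_, fun t ht => ?_⟩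
  · exact (norm_le_of_hasDerivAt_comm hder hsa ht).trans hden0.norm_le_one
  · rw [tr_eq_of_hasDerivAt_comm hder ht]
    exact hden0.trace_eq_one

end Hartree

/-! ### The mean-field potential and the free evolution of local operators -/

section MeanFieldPotential

open TraceClass

variable {d n : ℕ}

/-- The two-body interaction, without the constant contribution of the diagonal `k = l`. -/
def interaction (Ψ : Space d → ℝ) (k l : Fin n) : Space d × Space d → ℂ :=
  if k = l then 0 else pairPotential Ψ

theorem measurable_interaction {Ψ : Space d → ℝ} (hΨ : Measurable Ψ) (k l : Fin n) :
    Measurable (interaction Ψ k l) := by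
  unfold interaction
  split_ifs
  exacts [measurable_zero, measurable_pairPotential hΨ]

theorem norm_interaction_le {Ψ : Space d → ℝ} {L : ℝ} (hL : ∀ x, |Ψ x| ≤ L) (k l : Fin n)
    (p : Space d × Space d) : ‖interaction Ψ k l p‖ ≤ L := by
  unfold interaction
  split_ifs
  · simpa using (abs_nonneg _).trans (hL 0)
  · exact norm_pairPotential_le hL p

theorem conj_interaction (Ψ : Space d → ℝ) (k l : Fin n) (p : Space d × Space d) :
    starRingEnd ℂ (interaction Ψ k l p) = interaction Ψ k l p := by
  unfold interaction
  split_ifs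
  exacts [by simp, conj_pairPotential Ψ p]

theorem pairOp_interaction_symm {Ψ : Space d → ℝ} (hev : ∀ x, Ψ (-x) = Ψ x) (k l : Fin n) :
    pairOp k l (interaction Ψ k l) = pairOp l k (interaction Ψ l k) := by
  refine congrArg mulOp (funext fun x => ?_)
  by_cases h : k = l
  · subst h
    rfl
  · rw [interaction, interaction, if_neg h, if_neg (Ne.symm h), pairPotential, pairPotential, ← hev]
    simp

theorem quasiMeasurePreserving_pos_sub {k l : Fin n} (h : k ≠ l) :
    Measure.QuasiMeasurePreserving (fun x : Conf d n => pos x k - pos x l) := by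
  cases n with
  | zero => exact k.elim0
  | succ n =>
    obtain ⟨l, rfl⟩ := Fin.exists_succAbove_eq h.symm
    have h1 : Measure.QuasiMeasurePreserving (fun p : Space d × Conf d n => p.1 - pos p.2 l)
        ((volume : Measure (Space d)).prod volume) volume := by
      refine QuasiMeasurePreserving.prod_of_left
        (measurable_fst.sub ((measurable_pos l).comp measurable_snd)) (ae_of_all _ fun r => ?_)
      exact (measurePreserving_sub_right (volume : Measure (Space d)) (pos r l)).quasiMeasurePreserving
    exact h1.comp (measurePreserving_siteEquiv k).quasiMeasurePreserving

/-- The `N`-body potential is a sum of two-body interactions, up to an additive constant. -/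
theorem mulOp_meanFieldPotential {Φ Ψ : Space d → ℝ} (hΨΦ : Ψ =ᵐ[volume] Φ) (hΨ : Measurable Ψ)
    {L : ℝ} (hL : ∀ x, |Ψ x| ≤ L) : ∃ a : ℝ,
      (mulOp fun x : Conf d n => (meanFieldPotential Φ n x : ℂ)) =
        ((1 / (2 * (n : ℝ)) : ℝ) : ℂ) • ∑ k, ∑ l, pairOp k l (interaction Ψ k l) +
          (a : ℂ) • ContinuousLinearMap.id ℂ _ := by
  have hpair : ∀ k l : Fin n, MemLp (fun x : Conf d n => interaction Ψ k l (pos x k, pos x l)) ∞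
      volume := fun k l => memLp_pair (measurable_interaction hΨ k l) (norm_interaction_le hL k l)
  let a : ℝ := 1 / (2 * (n : ℝ)) * ∑ k : Fin n, ∑ l : Fin n, if k = l then Φ 0 else 0
  have hsum : MemLp (fun x : Conf d n => ∑ k, ∑ l, interaction Ψ k l (pos x k, pos x l)) ∞ volume :=
    memLp_finsetSum _ fun k _ => memLp_finsetSum _ fun l _ => hpair k l
  have hone : MemLp (1 : Conf d n → ℂ) ∞ volume :=
    memLp_top_of_norm_le aestronglyMeasurable_one (C := 1) fun x => by simp
  have hae : (fun x : Conf d n => (meanFieldPotential Φ n x : ℂ)) =ᵐ[volume]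
      ((1 / (2 * (n : ℝ)) : ℝ) : ℂ) •
        (fun x : Conf d n => ∑ k, ∑ l, interaction Ψ k l (pos x k, pos x l)) +
          (a : ℂ) • (1 : Conf d n → ℂ) := by
    have h1 : ∀ᵐ x : Conf d n, ∀ k l : Fin n, k ≠ l →
        Ψ (pos x k - pos x l) = Φ (pos x k - pos x l) :=
      ae_all_iff.2 fun k => ae_all_iff.2 fun l => by
        by_cases h : k = l
        · exact ae_of_all _ fun x h' => absurd h h'
        · filter_upwards [(quasiMeasurePreserving_pos_sub h).ae hΨΦ] with x hx _ using hx
    filter_upwards [h1] with x hx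
    have h2 : ∀ k l : Fin n, (Φ (pos x k - pos x l) : ℂ) =
        interaction Ψ k l (pos x k, pos x l) + ((if k = l then Φ 0 else 0 : ℝ) : ℂ) := by
      intro k l
      by_cases h : k = l
      · subst h
        simp [interaction]
      · simp [interaction, h, pairPotential, hx k l h]
    simp only [meanFieldPotential, Pi.add_apply, Pi.smul_apply, smul_eq_mul, Pi.one_apply, mul_one, a]
    push_cast
    simp only [h2, Finset.sum_add_distrib, mul_add]
  refine ⟨a, ?_⟩
  rw [mulOp_congr hae, mulOp_add (hsum.const_smul _) (hone.const_smul _), mulOp_const_smul hsum,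
    mulOp_const_smul hone, mulOp_one,
    mulOp_sum _ fun k _ => memLp_finsetSum _ fun l _ => hpair k l]
  simp only [mulOp_sum _ fun l _ => hpair _ l]
  rfl

theorem adjoint_mulOp_meanFieldPotential {Φ Ψ : Space d → ℝ} (hΨΦ : Ψ =ᵐ[volume] Φ)
    (hΨ : Measurable Ψ) {L : ℝ} (hL : ∀ x, |Ψ x| ≤ L) :
    ContinuousLinearMap.adjoint (mulOp fun x : Conf d n => (meanFieldPotential Φ n x : ℂ)) =
      mulOp fun x : Conf d n => (meanFieldPotential Φ n x : ℂ) := by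
  obtain ⟨a, ha⟩ := mulOp_meanFieldPotential (n := n) hΨΦ hΨ hL
  have h1 : ∀ k l : Fin n, ContinuousLinearMap.adjoint (pairOp k l (interaction Ψ k l)) =
      pairOp k l (interaction Ψ k l) := fun k l => by
    rw [pairOp, mulOp_adjoint (memLp_pair (measurable_interaction hΨ k l)
      (norm_interaction_le hL k l))]
    simp only [conj_interaction]
  rw [ha]
  simp only [map_add, map_smulₛₗ, map_sum, h1, Complex.conj_ofReal, ContinuousLinearMap.adjoint_id]

theorem freeEvolution_siteOp (ħ t : ℝ) (k : Fin n) (A : Op (Space d)) :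
    freeEvolution ħ t (siteOp k A) = siteOp k (freeEvolution ħ t A) := by
  have h := freeGroup_comp_siteOp ħ t k A
  rw [freeEvolution, ← ContinuousLinearMap.comp_assoc, h, ContinuousLinearMap.comp_assoc,
    freeGroup_comp_neg, ContinuousLinearMap.comp_id]
  rfl

/-- The free evolution does not spread the support of an observable over further particles. -/
theorem CommutesAt.freeEvolution {k : Fin n} {B : Op (Conf d n)} (hB : CommutesAt k B) (ħ t : ℝ) :
    CommutesAt k (freeEvolution ħ t B) := fun A => by
  have h := congrArg (MeanField.freeEvolution ħ t) (hB (MeanField.freeEvolution ħ (-t) A))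
  rwa [freeEvolution_mul, freeEvolution_mul, freeEvolution_siteOp,
    freeEvolution_freeEvolution_neg] at h

theorem freeEvolution_neg_freeEvolution {X : Type*} [NormedAddCommGroup X] [InnerProductSpace ℝ X]
    [FiniteDimensional ℝ X] [MeasurableSpace X] [BorelSpace X] (ħ t : ℝ) (A : Op X) :
    freeEvolution ħ (-t) (freeEvolution ħ t A) = A := by
  have h := freeEvolution_freeEvolution_neg ħ (-t) A
  rwa [neg_neg] at h

theorem tr_evo {X : Type*} [NormedAddCommGroup X] [InnerProductSpace ℝ X]
    [FiniteDimensional ℝ X] [MeasurableSpace X] [BorelSpace X] (ħ t : ℝ) (A : TraceClass (L2 X)) :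
    tr (evo ħ t A) = tr A := by
  rw [evo, ContinuousLinearMap.comp_apply, tr_lmul]
  refine congrArg tr (op_injective ?_)
  rw [op_rmul, op_rmul, ContinuousLinearMap.comp_assoc, freeGroup_neg_comp,
    ContinuousLinearMap.comp_id]

/-- Passing from the interaction picture to the Schrödinger picture in expectations. -/
theorem tr_rmul_evo {X : Type*} [NormedAddCommGroup X] [InnerProductSpace ℝ X]
    [FiniteDimensional ℝ X] [MeasurableSpace X] [BorelSpace X] (ħ t : ℝ) (B : Op X)
    (A : TraceClass (L2 X)) : tr (rmul (freeEvolution ħ t B) (evo ħ t A)) = tr (rmul B A) := by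
  rw [← tr_evo ħ t (rmul B A)]
  exact congrArg tr (op_injective (by rw [op_rmul, op_evo, op_evo, op_rmul, freeEvolution_mul]))

theorem evo_tensorTC (ħ t : ℝ) (A : Fin n → TraceClass (L2 (Space d))) :
    evo ħ t (tensorTC A) = tensorTC fun i => evo ħ t (A i) := by
  refine op_injective ?_
  rw [op_evo, op_tensorTC, op_tensorTC, freeEvolution, freeGroup_eq_tensorOp, freeGroup_eq_tensorOp,
    tensorOp_comp, tensorOp_comp]
  rfl

theorem hasDerivAt_tensorTC {J : ℝ → TraceClass (L2 (Space d))} {J' : TraceClass (L2 (Space d))}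
    {t : ℝ} (h : HasDerivAt J J' t) :
    HasDerivAt (fun s => tensorTC fun _ : Fin n => J s)
      (∑ k, tensorTC (Function.update (fun _ => J t) k J')) t := by
  have h1 := ((tensorMulti d n).hasFDerivAt (fun _ => J t)).restrictScalars ℝ
  have h2 : HasDerivAt (fun s => fun _ : Fin n => J s) (fun _ => J') t := hasDerivAt_pi.2 fun _ => h
  have h3 := h1.comp_hasDerivAt t h2
  rw [ContinuousLinearMap.coe_restrictScalars', ContinuousMultilinearMap.linearDeriv_apply] at h3
  exact h3

theorem tensorTC_update_comm (c : ℂ) (P : Op (Space d)) (A : TraceClass (L2 (Space d)))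
    (k : Fin n) : tensorTC (Function.update (fun _ => A) k (c • comm P A)) =
      c • comm (siteOp k P) (tensorTC fun _ => A) := by
  have hsub : ∀ x y : TraceClass (L2 (Space d)),
      tensorTC (Function.update (fun _ : Fin n => A) k (x - y)) =
        tensorTC (Function.update (fun _ => A) k x) - tensorTC (Function.update (fun _ => A) k y) :=
    fun x y => (tensorMulti d n).map_update_sub _ _ _ _
  rw [tensorTC_update_smul, comm_apply, comm_apply, hsub, lmul_siteOp_tensorTC,
    rmul_siteOp_tensorTC]

end MeanFieldPotential

/-! ### The hierarchy inequality -/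

section Hierarchy

open TraceClass

/-- The combinatorics of the mean-field limit: `g k l` stands for the contribution of the
interaction of the particles `k`, `l` and `w k` for that of the averaged potential. The `N - |S|`
pairs with one particle in `S` are compared with `N` times the averaged potential; the pairs inside `S`
and the `|S|` missing pairs are the error of order `1 / N`. -/
theorem norm_meanField_sum_le {N : ℕ} (hN : 0 < N) (S : Finset (Fin N)) {g : Fin N → Fin N → ℂ}
    {w : Fin N → ℂ} {b u : ℝ} (hsymm : ∀ k l, g k l = g l k)
    (hg0 : ∀ k ∉ S, ∀ l ∉ S, g k l = 0) (hw0 : ∀ k ∉ S, w k = 0) (hg : ∀ k l, ‖g k l‖ ≤ b)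
    (hw : ∀ k, ‖w k‖ ≤ b) (hgw : ∀ k ∈ S, ∀ l ∉ S, ‖g k l - w k‖ ≤ b * u) (hu : 0 ≤ u) :
    ‖((1 / (2 * (N : ℝ)) : ℝ) : ℂ) * ∑ k, ∑ l, g k l - ∑ k, w k‖ ≤
      b * (S.card * u + 3 / 2 * S.card ^ 2 / N) := by
  have hN' : (0 : ℝ) < N := Nat.cast_pos.2 hN
  have hNC : (N : ℂ) ≠ 0 := by exact_mod_cast hN.ne'
  have hb : 0 ≤ b := (norm_nonneg _).trans (hw ⟨0, hN⟩)
  have hsplit : ∀ f : Fin N → ℂ, ∑ k, f k = ∑ k ∈ S, f k + ∑ k ∈ Sᶜ, f k := fun f =>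
    (Finset.sum_add_sum_compl S f).symm
  have h1 : ∑ k, ∑ l, g k l = ∑ k ∈ S, ∑ l ∈ S, g k l + 2 * ∑ k ∈ S, ∑ l ∈ Sᶜ, g k l := by
    rw [hsplit]
    have h2 : ∑ k ∈ S, ∑ l, g k l = ∑ k ∈ S, ∑ l ∈ S, g k l + ∑ k ∈ S, ∑ l ∈ Sᶜ, g k l := by
      rw [← Finset.sum_add_distrib]
      exact Finset.sum_congr rfl fun k _ => hsplit _
    have h3 : ∑ k ∈ Sᶜ, ∑ l, g k l = ∑ k ∈ S, ∑ l ∈ Sᶜ, g k l := by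
      rw [Finset.sum_comm (s := S)]
      refine Finset.sum_congr rfl fun k hk => ?_
      rw [hsplit, Finset.sum_eq_zero (s := Sᶜ) fun l hl =>
        hg0 k (Finset.mem_compl.1 hk) l (Finset.mem_compl.1 hl), add_zero]
      exact Finset.sum_congr rfl fun l _ => hsymm _ _
    rw [h2, h3]
    ring
  have h4 : ∑ k, w k = ∑ k ∈ S, w k := by
    rw [hsplit, Finset.sum_eq_zero (s := Sᶜ) fun k hk => hw0 k (Finset.mem_compl.1 hk), add_zero]
  have hcard : (Sᶜ.card : ℝ) = N - S.card := by
    rw [Finset.card_compl, Fintype.card_fin, Nat.cast_sub (by simpa using S.card_le_univ)]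
  have h5 : ∑ k ∈ S, ∑ l ∈ Sᶜ, (g k l - w k) = ∑ k ∈ S, ∑ l ∈ Sᶜ, g k l -
      ((N : ℂ) - S.card) * ∑ k ∈ S, w k := by
    have h6 : (Sᶜ.card : ℂ) = (N : ℂ) - S.card := by
      have := congrArg (fun x : ℝ => (x : ℂ)) hcard
      simpa using this
    simp only [Finset.sum_sub_distrib, Finset.sum_const, nsmul_eq_mul, ← Finset.mul_sum, h6]
  have h6 : ((1 / (2 * (N : ℝ)) : ℝ) : ℂ) * ∑ k, ∑ l, g k l - ∑ k, w k =
      ((1 / (2 * (N : ℝ)) : ℝ) : ℂ) * ∑ k ∈ S, ∑ l ∈ S, g k l +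
        ((1 / (N : ℝ) : ℝ) : ℂ) * ∑ k ∈ S, ∑ l ∈ Sᶜ, (g k l - w k) -
          ((S.card / (N : ℝ) : ℝ) : ℂ) * ∑ k ∈ S, w k := by
    rw [h1, h4, h5]
    push_cast
    field_simp
    ring
  have h7 : ‖∑ k ∈ S, ∑ l ∈ S, g k l‖ ≤ S.card * (S.card * b) := by
    refine norm_sum_le_of_le _ (fun k _ => norm_sum_le_of_le _ fun l _ => hg k l) |>.trans ?_
    simp
  have h8 : ‖∑ k ∈ S, ∑ l ∈ Sᶜ, (g k l - w k)‖ ≤ S.card * ((N - S.card) * (b * u)) := by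
    refine norm_sum_le_of_le _ (fun k hk => norm_sum_le_of_le _ fun l hl =>
      hgw k hk l (Finset.mem_compl.1 hl)) |>.trans ?_
    simp only [Finset.sum_const, nsmul_eq_mul, hcard]
    exact le_rfl
  have h9 : ‖∑ k ∈ S, w k‖ ≤ S.card * b := by
    refine norm_sum_le_of_le _ (fun k _ => hw k) |>.trans ?_
    simp
  have hr : ∀ x : ℝ, 0 ≤ x → ∀ z : ℂ, ‖(x : ℂ) * z‖ = x * ‖z‖ := fun x hx z => by
    rw [norm_mul, Complex.norm_real, Real.norm_of_nonneg hx]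
  rw [h6]
  refine (norm_sub_le _ _).trans ((add_le_add_left (norm_add_le _ _) _).trans ?_)
  rw [hr _ (by positivity), hr _ (by positivity), hr _ (by positivity)]
  have hs0 : (0 : ℝ) ≤ S.card := Nat.cast_nonneg _
  calc _ ≤ 1 / (2 * (N : ℝ)) * (S.card * (S.card * b)) +
        1 / (N : ℝ) * (S.card * ((N - S.card) * (b * u))) + S.card / (N : ℝ) * (S.card * b) := by
        gcongr
    _ ≤ 1 / (2 * (N : ℝ)) * (S.card * (S.card * b)) +
        1 / (N : ℝ) * (S.card * (N * (b * u))) + S.card / (N : ℝ) * (S.card * b) := by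
        gcongr
        linarith
    _ = _ := by
        field_simp
        ring

end Hierarchy

section HierarchyInequality

open TraceClass

variable {d N : ℕ}

/-- The averaging identity in the interaction picture. -/
theorem IsHartreeFlow.tr_tensorTC {ħ : ℝ} {h : Space d × Space d → ℂ} (hm : Measurable h) {L : ℝ}
    (hh : ∀ x, ‖h x‖ ≤ L) {J : ℝ → TraceClass (L2 (Space d))} {ρ : ℝ → Space d → ℂ}
    (hJ : IsHartreeFlow ħ h J ρ) {t : ℝ} (ht : 0 ≤ t) {k l : Fin N} (hkl : k ≠ l)
    {B B' : Op (Conf d N)} (hB : CommutesAt l B) (hB' : CommutesAt l B') :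
    tr (rmul (B ∘L freeEvolution ħ (-t) (pairOp k l h) ∘L B') (tensorTC fun _ => J t)) =
      tr (rmul (B ∘L siteOp k (freeEvolution ħ (-t) (mulOp (average (ρ t) h))) ∘L B')
        (tensorTC fun _ => J t)) := by
  rw [← tr_rmul_evo ħ t, ← tr_rmul_evo ħ t (B ∘L siteOp k _ ∘L B'), freeEvolution_mul,
    freeEvolution_mul, freeEvolution_freeEvolution_neg, freeEvolution_mul, freeEvolution_mul,
    freeEvolution_siteOp, freeEvolution_freeEvolution_neg, evo_tensorTC]
  exact tr_tensorTC_pairOp ((tr_evo ħ t _).trans (hJ.tr_eq_one t ht)) (hJ.density t ht).1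
    (hJ.density t ht).2 hkl (hB.freeEvolution ħ t) (hB'.freeEvolution ħ t) hm hh

/-- The expectation of the commutator of `B` with an evolved potential, as a linear functional of
the potential. -/
def commutatorExpectation (ħ t : ℝ) (B : Op (Conf d N)) (K : TraceClass (L2 (Conf d N))) :
    Op (Conf d N) →ₗ[ℂ] ℂ where
  toFun P := tr (rmul (B ∘L freeEvolution ħ t P - freeEvolution ħ t P ∘L B) K)
  map_add' P Q := by
    rw [← map_add]
    refine congrArg tr (op_injective ?_)
    simp only [freeEvolution, op_rmul, op_add, ContinuousLinearMap.add_comp,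
      ContinuousLinearMap.comp_add, ContinuousLinearMap.comp_sub]
    abel
  map_smul' c P := by
    rw [RingHom.id_apply, ← map_smul]
    refine congrArg tr (op_injective ?_)
    simp only [freeEvolution, op_rmul, op_smul, ContinuousLinearMap.smul_comp,
      ContinuousLinearMap.comp_smul, ContinuousLinearMap.comp_sub, smul_sub]

theorem commutatorExpectation_apply (ħ t : ℝ) (B : Op (Conf d N))
    (K : TraceClass (L2 (Conf d N))) (P : Op (Conf d N)) : commutatorExpectation ħ t B K P =
      tr (rmul (B ∘L freeEvolution ħ t P - freeEvolution ħ t P ∘L B) K) := rfl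

theorem commutatorExpectation_id (ħ t : ℝ) (B : Op (Conf d N))
    (K : TraceClass (L2 (Conf d N))) :
    commutatorExpectation ħ t B K (ContinuousLinearMap.id ℂ _) = 0 := by
  have h : freeEvolution ħ t (ContinuousLinearMap.id ℂ (L2 (Conf d N))) =
      ContinuousLinearMap.id ℂ _ := by
    rw [freeEvolution, ContinuousLinearMap.id_comp, freeGroup_comp_neg]
  rw [commutatorExpectation_apply, h, ContinuousLinearMap.comp_id, ContinuousLinearMap.id_comp,
    sub_self]
  exact (congrArg tr (op_injective (by simp))).trans (map_zero tr)

theorem norm_commutator_le {H : Type*} [NormedAddCommGroup H] [InnerProductSpace ℂ H]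
    (B P : H →L[ℂ] H) {L : ℝ} (hP : ‖P‖ ≤ L) : ‖B ∘L P - P ∘L B‖ ≤ 2 * L * ‖B‖ := by
  refine (norm_sub_le _ _).trans ?_
  have h1 := ContinuousLinearMap.opNorm_comp_le B P
  have h2 := ContinuousLinearMap.opNorm_comp_le P B
  have h3 : ‖B‖ * ‖P‖ ≤ ‖B‖ * L := mul_le_mul_of_nonneg_left hP (norm_nonneg _)
  linarith [mul_comm ‖P‖ ‖B‖]

/-- A solution of the `N`-body equation in the interaction picture, in the unit ball of the trace
class. -/
structure IsNBodyFlow (ħ : ℝ) (V : Op (Conf d N)) (K : ℝ → TraceClass (L2 (Conf d N))) : Prop where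
  hasDerivAt : ∀ t, 0 ≤ t →
    HasDerivAt K ((Complex.I * (ħ : ℂ))⁻¹ • comm (freeEvolution ħ (-t) V) (K t)) t
  norm_le_one : ∀ t, 0 ≤ t → ‖K t‖ ≤ 1

theorem norm_tensorTC_le_one {A : TraceClass (L2 (Space d))} (hA : ‖A‖ ≤ 1) :
    ‖(tensorTC fun _ : Fin N => A)‖ ≤ 1 :=
  (norm_tensorTC_le _).trans (Finset.prod_le_one (fun _ _ => norm_nonneg _) fun _ _ => hA)

/-- The hierarchy inequality: the deviation of the expectations of an observable of the particles
in `S` changes at a rate that is controlled by the deviation for the observables of one further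
particle, up to a term of order `1 / N`. -/
theorem exists_hasDerivAt_deviation (hN : 0 < N) {ħ : ℝ} (hħ : 0 < ħ) {Ψ : Space d → ℝ}
    (hΨ : Measurable Ψ) {L : ℝ} (hL : ∀ x, |Ψ x| ≤ L) (hev : ∀ x, Ψ (-x) = Ψ x)
    {J : ℝ → TraceClass (L2 (Space d))} {ρ : ℝ → Space d → ℂ}
    (hJ : IsHartreeFlow ħ (pairPotential Ψ) J ρ) {V : Op (Conf d N)} {a : ℝ}
    (hV : V = ((1 / (2 * (N : ℝ)) : ℝ) : ℂ) • ∑ k, ∑ l, pairOp k l (interaction Ψ k l) +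
      (a : ℂ) • ContinuousLinearMap.id ℂ _)
    {K : ℝ → TraceClass (L2 (Conf d N))} (hK : IsNBodyFlow ħ V K) {S : Finset (Fin N)}
    {B : Op (Conf d N)} (hB : IsLocal S B) :
    ∃ δ : ℝ → ℂ, ∀ t, 0 ≤ t →
      HasDerivAt (fun s => tr (rmul B (K s)) - tr (rmul B (tensorTC fun _ => J s))) (δ t) t ∧
      ∀ u, 0 ≤ u → (∀ k ∉ S, ∀ B' : Op (Conf d N), IsLocal (insert k S) B' →
          ‖tr (rmul B' (K t)) - tr (rmul B' (tensorTC fun _ => J t))‖ ≤ u * ‖B'‖) →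
        ‖δ t‖ ≤ 1 / ħ * (2 * L * ‖B‖ * (S.card * u + 3 / 2 * S.card ^ 2 / N)) := by
  set c := (Complex.I * (ħ : ℂ))⁻¹ with hc
  have hcn : ‖c‖ = 1 / ħ := by
    rw [hc, norm_inv, norm_mul, Complex.norm_I, one_mul, Complex.norm_real,
      Real.norm_of_nonneg hħ.le, one_div]
  have hL0 : 0 ≤ L := (abs_nonneg _).trans (hL 0)
  let W : ℝ → Op (Space d) := fun t => freeEvolution ħ (-t) (mulOp (average (ρ t) (pairPotential Ψ)))
  let T : ℝ → TraceClass (L2 (Conf d N)) := fun t => tensorTC fun _ => J t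
  let g : ℝ → Fin N → Fin N → ℂ := fun t k l =>
    commutatorExpectation ħ (-t) B (K t) (pairOp k l (interaction Ψ k l))
  let w : ℝ → Fin N → ℂ := fun t k =>
    tr (rmul (B ∘L siteOp k (W t) - siteOp k (W t) ∘L B) (T t))
  refine ⟨fun t => c * (((1 / (2 * (N : ℝ)) : ℝ) : ℂ) * ∑ k, ∑ l, g t k l - ∑ k, w t k),
    fun t ht => ⟨?_, fun u hu0 hu => ?_⟩⟩
  · have hℓ : ∀ {G : ℝ → TraceClass (L2 (Conf d N))} {G' : TraceClass (L2 (Conf d N))},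
        HasDerivAt G G' t → HasDerivAt (fun s => tr (rmul B (G s))) (tr (rmul B G')) t := fun hG =>
      ((tr ∘L rmul B).restrictScalars ℝ).hasFDerivAt.comp_hasDerivAt t hG
    have h1 := hℓ (hK.hasDerivAt t ht)
    have h2 := hℓ (hasDerivAt_tensorTC (n := N) (hJ.hasDerivAt t ht))
    have e1 : tr (rmul B (c • comm (freeEvolution ħ (-t) V) (K t))) =
        c * (((1 / (2 * (N : ℝ)) : ℝ) : ℂ) * ∑ k, ∑ l, g t k l) := by
      rw [map_smul, map_smul, smul_eq_mul, tr_rmul_comm, ← commutatorExpectation_apply, hV, map_add,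
        map_smul, map_smul, commutatorExpectation_id, smul_zero, add_zero, smul_eq_mul, map_sum]
      simp only [map_sum, g]
    have e2 : tr (rmul B (∑ k, tensorTC (Function.update (fun _ : Fin N => J t) k
        (c • comm (freeEvolution ħ (-t) (mulOp (average (ρ t) (pairPotential Ψ)))) (J t))))) =
          c * ∑ k, w t k := by
      rw [map_sum, map_sum, Finset.mul_sum]
      refine Finset.sum_congr rfl fun k _ => ?_
      rw [tensorTC_update_comm, map_smul, map_smul, smul_eq_mul, tr_rmul_comm]
    have h3 := h1.sub h2
    rw [e1, e2, ← mul_sub] at h3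
    exact h3
  · have hevo : ∀ P : Op (Conf d N), ‖P‖ ≤ L → ‖freeEvolution ħ (-t) P‖ ≤ L := fun P hP =>
      (norm_freeEvolution_le _ _ _).trans hP
    have hP : ∀ k l, ‖pairOp (n := N) k l (interaction Ψ k l)‖ ≤ L := fun k l =>
      norm_pairOp_le hL0 (norm_interaction_le hL k l)
    have hW : ‖W t‖ ≤ L := by
      refine (norm_freeEvolution_le _ _ _).trans ((norm_mulOp_average_le (hJ.density t ht) hL0
        (norm_pairPotential_le hL)).trans (mul_le_of_le_one_right hL0 ?_))
      exact (norm_evo_le _ _ _).trans (hJ.norm_le_one t ht)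
    have htr : ∀ (X : Op (Conf d N)) (G : TraceClass (L2 (Conf d N))), ‖G‖ ≤ 1 →
        ‖X‖ ≤ 2 * L * ‖B‖ → ‖tr (rmul X G)‖ ≤ 2 * L * ‖B‖ := fun X G hG hX =>
      (norm_tr_rmul_le _ _).trans ((mul_le_of_le_one_right (norm_nonneg _) hG).trans hX)
    rw [norm_mul, hcn]
    refine mul_le_mul_of_nonneg_left ?_ (by positivity)
    refine norm_meanField_sum_le hN S (fun k l => ?_) (fun k hk l hl => ?_) (fun k hk => ?_)
      (fun k l => ?_) (fun k => ?_) (fun k hk l hl => ?_) hu0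
    · simp only [g]
      rw [pairOp_interaction_symm hev]
    -- A pair of particles outside `S` does not contribute, and neither does the average at a particle
    -- outside `S`, because the evolved potentials commute with `B`.
    · have h1 := pairOp_comm ((hB k hk).freeEvolution ħ t) ((hB l hl).freeEvolution ħ t)
        (measurable_interaction hΨ k l) (norm_interaction_le hL k l)
      have h2 := congrArg (freeEvolution ħ (-t)) h1
      rw [freeEvolution_mul, freeEvolution_mul, freeEvolution_neg_freeEvolution] at h2
      simp only [g]
      rw [commutatorExpectation_apply, h2, sub_self]
      exact (congrArg tr (op_injective (by simp))).trans (map_zero tr)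
    · simp only [w]
      rw [hB k hk, sub_self]
      exact (congrArg tr (op_injective (by simp))).trans (map_zero tr)
    · exact htr _ _ (hK.norm_le_one t ht) (norm_commutator_le _ _ (hevo _ (hP k l)))
    · exact htr _ _ (norm_tensorTC_le_one (hJ.norm_le_one t ht))
        (norm_commutator_le _ _ ((norm_siteOp_le _ _).trans hW))
    -- For `k` in `S` and `l` outside `S`, the averaging identity turns the contribution of the averaged
    -- potential into that of the pair potential in the product state.
    · have hkl : k ≠ l := fun h => hl (h ▸ hk)
      have hint : interaction Ψ k l = pairPotential Ψ := if_neg hkl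
      set P := freeEvolution ħ (-t) (pairOp k l (interaction Ψ k l)) with hPdef
      have havg : tr (rmul (B ∘L P - P ∘L B) (T t)) = w t k := by
        have h1 := hJ.tr_tensorTC (measurable_pairPotential hΨ) (norm_pairPotential_le hL) ht hkl
          (hB l hl) (commutesAt_id l)
        have h2 := hJ.tr_tensorTC (measurable_pairPotential hΨ) (norm_pairPotential_le hL) ht hkl
          (commutesAt_id l) (hB l hl)
        simp only [ContinuousLinearMap.comp_id, ContinuousLinearMap.id_comp] at h1 h2
        rw [← hint, ← hPdef] at h1 h2
        have hsub : ∀ X Y : Op (Conf d N), tr (rmul (X - Y) (T t)) =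
            tr (rmul X (T t)) - tr (rmul Y (T t)) := fun X Y => by
          rw [← map_sub]
          exact congrArg tr (op_injective (by simp))
        simp only [w]
        rw [hsub, hsub, h1, h2, hint]
      have hloc : IsLocal (insert l S) (B ∘L P - P ∘L B) := by
        intro m hm
        have hml : l ≠ m := fun h => hm (h ▸ Finset.mem_insert_self _ _)
        have hmS : m ∉ S := fun h => hm (Finset.mem_insert_of_mem h)
        have hmk : k ≠ m := fun h => hmS (h ▸ hk)
        have h1 : CommutesAt m P := (commutesAt_pairOp hmk hml (measurable_interaction hΨ k l)
          (norm_interaction_le hL k l)).freeEvolution ħ (-t)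
        exact ((hB m hmS).comp h1).sub (h1.comp (hB m hmS))
      have h1 := hu l hl _ hloc
      rw [← havg]
      refine h1.trans ?_
      rw [mul_comm]
      exact mul_le_mul_of_nonneg_right (norm_commutator_le _ _ (hevo _ (hP k l))) hu0

end HierarchyInequality

/-! ### Solving the hierarchy inequality -/

section Iteration

theorem sq_le_two_pow_succ (j : ℕ) : j ^ 2 ≤ 2 ^ (j + 1) := by
  induction j with
  | zero => norm_num
  | succ j ih =>
    rcases Nat.lt_or_ge j 3 with h | h
    · interval_cases j <;> norm_num
    · rw [pow_succ 2 (j + 1)]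
      nlinarith

variable {N : ℕ} {E : Type*} [NormedAddCommGroup E] {P : Finset (Fin N) → E → Prop}
  {D : E → ℝ → ℂ} {κ : ℝ}

/-- A family of quantities `D B t`, indexed by observables `B` of finitely many particles, that
satisfies a hierarchy of differential inequalities: the rate of change for the observables of
`S.card` particles is controlled by the size for those of one further particle. -/
def SatisfiesHierarchy (P : Finset (Fin N) → E → Prop) (D : E → ℝ → ℂ) (κ : ℝ) : Prop :=
  ∀ S B, P S B → ∃ δ : ℝ → ℂ, ∀ t, 0 ≤ t → HasDerivAt (D B) (δ t) t ∧
    ∀ u, 0 ≤ u → (∀ k ∉ S, ∀ B', P (insert k S) B' → ‖D B' t‖ ≤ u * ‖B'‖) →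
      ‖δ t‖ ≤ κ * (2 * S.card * u + 3 * S.card ^ 2 / N) * ‖B‖

/-- On a time interval of length `1 / (8 κ)`, the hierarchy has the supersolution `ε r ^ j`, where
`r = 1 / (1 / 2 - 2 κ s)` increases from `2` to `4` and `ε` increases at the rate `6 κ / N`. The bound
follows by downward induction on the number of particles, since there are no observables of more
than `N` particles. -/
theorem SatisfiesHierarchy.norm_le (hD : SatisfiesHierarchy P D κ) (hκ : 0 ≤ κ) {t₀ τ ε : ℝ}
    (ht₀ : 0 ≤ t₀) (hτ : 8 * κ * τ ≤ 1) (hε : 0 ≤ ε)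
    (h0 : ∀ S B, P S B → ‖D B t₀‖ ≤ ε * 2 ^ S.card * ‖B‖) :
    ∀ t ∈ Set.Icc t₀ (t₀ + τ), ∀ S B, P S B → ‖D B t‖ ≤
      (ε + 6 * κ / N * (t - t₀)) * ((1 / 2 - 2 * κ * (t - t₀))⁻¹) ^ S.card * ‖B‖ := by
  let q : ℝ → ℝ := fun t => 1 / 2 - 2 * κ * (t - t₀)
  let e : ℝ → ℝ := fun t => ε + 6 * κ / N * (t - t₀)
  have hq : ∀ t ∈ Set.Icc t₀ (t₀ + τ), 0 < q t ∧ 2 ≤ (q t)⁻¹ := by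
    intro t ht
    have h1 : κ * (t - t₀) ≤ κ * τ := mul_le_mul_of_nonneg_left (by linarith [ht.2]) hκ
    have h2 : 0 ≤ κ * (t - t₀) := mul_nonneg hκ (by linarith [ht.1])
    have h3 : 0 < q t := by
      simp only [q]
      linarith
    refine ⟨h3, ?_⟩
    rw [le_inv_comm₀ two_pos h3]
    simp only [q]
    linarith
  have he : ∀ t ∈ Set.Icc t₀ (t₀ + τ), 0 ≤ e t := fun t ht =>
    add_nonneg hε (mul_nonneg (by positivity) (by linarith [ht.1]))
  have hq' : ∀ t ∈ Set.Icc t₀ (t₀ + τ), HasDerivAt (fun s => (q s)⁻¹) (2 * κ * ((q t)⁻¹) ^ 2) t := by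
    intro t ht
    have h1 : HasDerivAt q (-(2 * κ)) t := by
      simpa using (((hasDerivAt_id t).sub_const t₀).const_mul (2 * κ)).const_sub (1 / 2)
    exact (h1.inv (hq t ht).1.ne').congr_deriv (by rw [neg_neg, inv_pow, div_eq_mul_inv])
  have he' : ∀ t, HasDerivAt e (6 * κ / N) t := fun t =>
    ((((hasDerivAt_id t).sub_const t₀).const_mul (6 * κ / N)).const_add ε).congr_deriv (mul_one _)
  -- For a set of `N` particles the bounds for one further particle are void.
  have key : ∀ m S, N + 1 - S.card = m → ∀ t ∈ Set.Icc t₀ (t₀ + τ), ∀ B, P S B →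
      ‖D B t‖ ≤ e t * ((q t)⁻¹) ^ S.card * ‖B‖ := by
    intro m
    induction m with
    | zero =>
      intro S hS
      have h1 : S.card ≤ N := by simpa using S.card_le_univ
      omega
    | succ m ih =>
      intro S hS t ht B hB
      obtain ⟨δ, hδ⟩ := hD S B hB
      set j := S.card with hj
      have hder : ∀ s ∈ Set.Icc t₀ (t₀ + τ), HasDerivAt (fun s => e s * ((q s)⁻¹) ^ j * ‖B‖)
          ((6 * κ / N * ((q s)⁻¹) ^ j +
            e s * (j * ((q s)⁻¹) ^ (j - 1) * (2 * κ * ((q s)⁻¹) ^ 2))) * ‖B‖) s := fun s hs =>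
        ((he' s).mul ((hq' s hs).pow j)).mul_const _
      refine image_norm_le_of_norm_deriv_right_le_deriv_boundary' (a := t₀) (b := t₀ + τ)
        (f' := δ) (B := fun s => e s * ((q s)⁻¹) ^ j * ‖B‖)
        (fun s hs => (hδ s (ht₀.trans hs.1)).1.continuousAt.continuousWithinAt)
        (fun s hs => (hδ s (ht₀.trans hs.1)).1.hasDerivWithinAt) ?_
        (fun s hs => (hder s hs).continuousAt.continuousWithinAt)
        (fun s hs => (hder s ⟨hs.1, hs.2.le⟩).hasDerivWithinAt) (fun s hs => ?_) ht
      · have h1 := h0 S B hB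
        simpa [e, q] using h1
      · have hs' : s ∈ Set.Icc t₀ (t₀ + τ) := ⟨hs.1, hs.2.le⟩
        have hr := (hq s hs').2
        set r := (q s)⁻¹ with hrdef
        have hr0 : 0 ≤ r := by linarith
        have h1 := (hδ s (ht₀.trans hs.1)).2 (e s * r ^ (j + 1))
          (mul_nonneg (he s hs') (by positivity)) fun k hk B' hB' => by
            have hcard : (insert k S).card = j + 1 := Finset.card_insert_of_notMem hk
            have h2 := ih (insert k S) (by omega) s hs' B' hB'
            rwa [hcard] at h2
        refine h1.trans (mul_le_mul_of_nonneg_right ?_ (norm_nonneg _))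
        have h2 : (j : ℝ) * r ^ (j - 1) * (2 * κ * r ^ 2) = 2 * κ * (j * r ^ (j + 1)) := by
          rcases j with _ | i
          · simp
          · simp only [Nat.add_sub_cancel]
            ring
        have h3 : (3 * (j : ℝ) ^ 2) / N ≤ 6 * r ^ j / N := by
          refine div_le_div_of_nonneg_right ?_ (Nat.cast_nonneg N)
          have h4 : ((j : ℝ)) ^ 2 ≤ 2 ^ (j + 1) := by exact_mod_cast sq_le_two_pow_succ j
          have h5 : (2 : ℝ) ^ j ≤ r ^ j := pow_le_pow_left₀ two_pos.le hr j
          rw [pow_succ (2 : ℝ)] at h4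
          linarith
        rw [h2]
        calc κ * (2 * j * (e s * r ^ (j + 1)) + 3 * (j : ℝ) ^ 2 / N)
            ≤ κ * (2 * j * (e s * r ^ (j + 1)) + 6 * r ^ j / N) :=
              mul_le_mul_of_nonneg_left (by linarith) hκ
          _ = _ := by ring
  exact fun t ht S B hB => key _ S rfl t ht B hB

/-- Iteration over `m` time steps: at the end of each step, interpolation with the trivial bound `2`
restores the growth `2 ^ j` in the number of particles, at the cost of halving the exponent
of `N`. -/
theorem SatisfiesHierarchy.norm_le_iterate (hN : 0 < N) (hD : SatisfiesHierarchy P D κ)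
    (hκ : 0 ≤ κ) {τ : ℝ} (hτ0 : 0 ≤ τ) (hτ : 8 * κ * τ ≤ 1)
    (h2 : ∀ t, 0 ≤ t → ∀ S B, P S B → ‖D B t‖ ≤ 2 * ‖B‖)
    (h0 : ∀ S B, P S B → D B 0 = 0) (m : ℕ) : ∀ S B, P S B →
      ‖D B (m * τ)‖ ≤ 4 * (N : ℝ) ^ (-(1 / 2 : ℝ) ^ m) * 2 ^ S.card * ‖B‖ := by
  have hN1 : (1 : ℝ) ≤ N := Nat.one_le_cast.2 hN
  have hN0 : (0 : ℝ) < N := by linarith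
  induction m with
  | zero =>
    intro S B hB
    rw [Nat.cast_zero, zero_mul, h0 S B hB, norm_zero]
    positivity
  | succ m ih =>
    intro S B hB
    have ht : 0 ≤ (m : ℝ) * τ := by positivity
    have hmem : ((m + 1 : ℕ) : ℝ) * τ ∈ Set.Icc (m * τ) (m * τ + τ) := by
      push_cast
      constructor <;> linarith
    have h1 := hD.norm_le hκ ht hτ (by positivity) ih _ hmem S B hB
    have h3 : ((m + 1 : ℕ) : ℝ) * τ - m * τ = τ := by
      push_cast
      ring
    rw [h3] at h1
    set z := (N : ℝ) ^ (-(1 / 2 : ℝ) ^ m) with hz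
    have hz0 : 0 < z := Real.rpow_pos_of_pos hN0 _
    have hzN : 1 / (N : ℝ) ≤ z := by
      rw [one_div, ← Real.rpow_neg_one]
      exact Real.rpow_le_rpow_of_exponent_le hN1
        (neg_le_neg (pow_le_one₀ (by norm_num) (by norm_num)))
    have h4 : 6 * κ / N * τ ≤ z := by
      refine le_trans ?_ hzN
      rw [div_mul_eq_mul_div]
      exact div_le_div_of_nonneg_right (by linarith) hN0.le
    have h5 : (1 / 2 - 2 * κ * τ)⁻¹ ≤ 4 := by
      rw [inv_le_comm₀ (by linarith) (by norm_num)]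
      linarith
    have h6 : 0 ≤ (1 / 2 - 2 * κ * τ)⁻¹ := inv_nonneg.2 (by linarith)
    have h7 : ‖D B (((m + 1 : ℕ) : ℝ) * τ)‖ ≤ 5 * z * 4 ^ S.card * ‖B‖ := by
      refine h1.trans ?_
      gcongr
      linarith
    have h8 := h2 (((m + 1 : ℕ) : ℝ) * τ) (by positivity) S B hB
    set y := (N : ℝ) ^ (-(1 / 2 : ℝ) ^ (m + 1)) with hy
    have hy0 : 0 < y := Real.rpow_pos_of_pos hN0 _
    have hyz : y ^ 2 = z := by
      rw [hy, hz, ← Real.rpow_natCast, ← Real.rpow_mul hN0.le, pow_succ]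
      congr 1
      push_cast
      ring
    have h9 : ((4 : ℝ) ^ S.card) = (2 ^ S.card) ^ 2 := by
      rw [← pow_mul, mul_comm, pow_mul]
      norm_num
    -- Interpolation: the square of the norm is bounded by the product of the bounds `h8` and `h7`.
    refine abs_le_of_sq_le_sq' ?_ (by positivity) |>.2
    have h10 := mul_le_mul h8 h7 (norm_nonneg _) (by positivity)
    have h11 : 0 ≤ z * 4 ^ S.card * ‖B‖ ^ 2 := by positivity
    calc ‖D B (((m + 1 : ℕ) : ℝ) * τ)‖ ^ 2 ≤ 2 * ‖B‖ * (5 * z * 4 ^ S.card * ‖B‖) := by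
          rw [sq]
          exact h10
      _ = 10 * (z * 4 ^ S.card * ‖B‖ ^ 2) := by ring
      _ ≤ 16 * (z * 4 ^ S.card * ‖B‖ ^ 2) := by linarith
      _ = (4 * y * 2 ^ S.card * ‖B‖) ^ 2 := by
          rw [h9, ← hyz]
          ring

/-- The numerical comparison of the bound after `⌊x⌋ + 1` steps with the final rate. The lower bound
`128` matters only for `⌊x⌋ = 0`, where the two prefactors differ by the factor `2`. -/
theorem iterate_bound_le {N : ℝ} (hN : 128 ≤ N) {x : ℝ} (hx : 0 ≤ x) (j : ℕ) :
    4 * N ^ (-(1 / 2 : ℝ) ^ (⌊x⌋₊ + 1)) * 2 ^ j ≤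
      (2 : ℝ) ^ ((j : ℝ) + 1 + 2 * x) / N ^ ((2 : ℝ) ^ (-1 - 2 * x) * Real.log 2) := by
  have hN0 : 0 < N := by linarith
  have hlog := Real.log_two_lt_d9
  have hlog0 : 0 < Real.log 2 := Real.log_pos one_lt_two
  rw [div_eq_mul_inv _ (N ^ _), ← Real.rpow_neg hN0.le, add_assoc, Real.rpow_add two_pos, Real.rpow_natCast]
  set k := ⌊x⌋₊ with hk
  have hkx : (k : ℝ) ≤ x := Nat.floor_le hx
  have hexp : (2 : ℝ) ^ (-1 - 2 * x) ≤ (2 : ℝ) ^ (-1 - 2 * (k : ℝ)) :=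
    Real.rpow_le_rpow_of_exponent_le one_le_two (by linarith)
  have hpow : (2 : ℝ) ^ (1 + 2 * (k : ℝ)) ≤ (2 : ℝ) ^ (1 + 2 * x) :=
    Real.rpow_le_rpow_of_exponent_le one_le_two (by linarith)
  have hmono : ∀ {a b : ℝ}, a ≤ b → N ^ a ≤ N ^ b := fun h =>
    Real.rpow_le_rpow_of_exponent_le (by linarith) h
  suffices h : 4 * N ^ (-(1 / 2 : ℝ) ^ (k + 1)) ≤
      2 ^ (1 + 2 * (k : ℝ)) * N ^ (-((2 : ℝ) ^ (-1 - 2 * (k : ℝ)) * Real.log 2)) by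
    calc 4 * N ^ (-(1 / 2 : ℝ) ^ (k + 1)) * 2 ^ j
        ≤ (2 ^ (1 + 2 * (k : ℝ)) * N ^ (-((2 : ℝ) ^ (-1 - 2 * (k : ℝ)) * Real.log 2))) * 2 ^ j := by
          gcongr
      _ ≤ (2 ^ (1 + 2 * x) * N ^ (-((2 : ℝ) ^ (-1 - 2 * x) * Real.log 2))) * 2 ^ j := by
          exact mul_le_mul_of_nonneg_right (mul_le_mul hpow (hmono (neg_le_neg
            (mul_le_mul_of_nonneg_right hexp hlog0.le))) (by positivity) (by positivity))
              (by positivity)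
      _ = _ := by ring
  rcases Nat.eq_zero_or_pos k with h0 | h0
  · rw [h0]
    -- The exponent `log 2 / 2` of the rate is smaller than `1 / 2`. The gain makes up for the factor `2`,
    -- since `7 * (1 - log 2) / 2 ≥ 1` and `128 = 2 ^ 7`.
    have h1 : (2 : ℝ) ≤ N ^ ((1 - Real.log 2) / 2) := by
      calc (2 : ℝ) = (2 : ℝ) ^ (1 : ℝ) := (Real.rpow_one _).symm
        _ ≤ (2 : ℝ) ^ (7 * ((1 - Real.log 2) / 2)) :=
          Real.rpow_le_rpow_of_exponent_le one_le_two (by linarith)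
        _ = (128 : ℝ) ^ ((1 - Real.log 2) / 2) := by
          rw [Real.rpow_mul two_pos.le]
          norm_num
        _ ≤ _ := Real.rpow_le_rpow (by norm_num) hN (by linarith)
    have h2 : N ^ (-((2 : ℝ) ^ (-1 - 2 * ((0 : ℕ) : ℝ)) * Real.log 2)) =
        N ^ ((1 - Real.log 2) / 2) * N ^ (-(1 / 2 : ℝ)) := by
      rw [← Real.rpow_add hN0]
      congr 1
      norm_num [Real.rpow_neg_one]
      ring
    rw [h2]
    norm_num
    have h3 : 0 ≤ N ^ (-(1 / 2 : ℝ)) := Real.rpow_nonneg hN0.le _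
    nlinarith
  · have hk1 : (1 : ℝ) ≤ k := Nat.one_le_cast.2 h0
    have h1 : (4 : ℝ) ≤ 2 ^ (1 + 2 * (k : ℝ)) := by
      calc (4 : ℝ) = 2 ^ (2 : ℝ) := by norm_num
        _ ≤ _ := Real.rpow_le_rpow_of_exponent_le one_le_two (by linarith)
    have h2 : (2 : ℝ) ^ (-1 - 2 * (k : ℝ)) * Real.log 2 ≤ (1 / 2 : ℝ) ^ (k + 1) := by
      have h3 : (1 / 2 : ℝ) ^ (k + 1) = 2 ^ (-((k : ℝ) + 1)) := by
        rw [Real.rpow_neg two_pos.le, one_div, inv_pow]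
        norm_cast
      rw [h3]
      calc (2 : ℝ) ^ (-1 - 2 * (k : ℝ)) * Real.log 2 ≤ (2 : ℝ) ^ (-1 - 2 * (k : ℝ)) :=
            mul_le_of_le_one_right (by positivity) (by linarith)
        _ ≤ _ := Real.rpow_le_rpow_of_exponent_le one_le_two (by linarith)
    exact mul_le_mul h1 (hmono (neg_le_neg h2)) (by positivity) (by positivity)

end Iteration

/-! ### Marginals -/

section Marginal

open TraceClass

variable {d n j r : ℕ}

theorem prodTensor_split_append (φ : Fin j → L2 (Space d)) (χ : Fin r → L2 (Space d)) :
    prodTensor (measurePreserving_splitEquiv j r) (tensorVec φ) (tensorVec χ) =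
      tensorVec (Fin.append φ χ) := by
  rw [← prodTensor_split_tensorVec]
  simp only [Fin.append_left, Fin.append_right]

theorem amp_tensorOp (A : Fin j → Op (Space d)) :
    (isTensorProduct_split d j r).amp (tensorOp A) = tensorOp (extendByOne (j + r) A) :=
  clm_ext_tensorVec fun ψ => by
    rw [tensorOp_tensorVec, ← prodTensor_split_tensorVec ψ, IsTensorProduct.amp_map,
      tensorOp_tensorVec, ← prodTensor_split_tensorVec fun i => extendByOne (j + r) A i (ψ i)]
    simp [extendByOne]

theorem siteOp_natAdd_prodTensor (i : Fin r) (A : Op (Space d)) (φ : L2 (Conf d j))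
    (χ : L2 (Conf d r)) :
    siteOp (Fin.natAdd j i) A (prodTensor (measurePreserving_splitEquiv j r) φ χ) =
      prodTensor (measurePreserving_splitEquiv j r) φ (siteOp i A χ) := by
  have hm := isTensorProduct_split d j r
  have h1 : ∀ (φ : Fin j → L2 (Space d)) (χ : Fin r → L2 (Space d)),
      siteOp (Fin.natAdd j i) A (prodTensor (measurePreserving_splitEquiv j r) (tensorVec φ)
        (tensorVec χ)) =
      prodTensor (measurePreserving_splitEquiv j r) (tensorVec φ) (siteOp i A (tensorVec χ)) := by
    intro φ χ
    rw [prodTensor_split_append, siteOp_tensorVec, siteOp_tensorVec, prodTensor_split_append,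
      Fin.append_right]
    congr 1
    ext1 k
    refine Fin.addCases (fun k => ?_) (fun k => ?_) k
    · rw [Function.update_of_ne (by simp [Fin.ext_iff]; omega), Fin.append_left, Fin.append_left]
    · by_cases hk : k = i
      · subst hk
        simp
      · rw [Function.update_of_ne (by simpa [Fin.ext_iff] using hk), Fin.append_right,
          Fin.append_right, Function.update_of_ne hk]
  have h2 : ∀ φ : Fin j → L2 (Space d), siteOp (Fin.natAdd j i) A ∘L hm.rightL (tensorVec φ) =
      hm.rightL (tensorVec φ) ∘L siteOp i A := fun φ => clm_ext_tensorVec fun χ => h1 φ χ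
  have h3 : siteOp (Fin.natAdd j i) A ∘L hm.leftL χ = hm.leftL (siteOp i A χ) :=
    clm_ext_tensorVec fun φ => congrArg (fun T : L2 (Conf d r) →L[ℂ] L2 (Conf d (j + r)) => T χ)
      (h2 φ)
  exact congrArg (fun T : L2 (Conf d j) →L[ℂ] L2 (Conf d (j + r)) => T φ) h3

/-- The first `j` of `j + r` particles. -/
def firstSites (j r : ℕ) : Finset (Fin (j + r)) := Finset.univ.map (Fin.castAddEmb r)

theorem card_firstSites (j r : ℕ) : (firstSites j r).card = j := by simp [firstSites]

/-- Observables of the first `j` particles are local in the sense of commutation. -/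
theorem isLocal_amp (B : Op (Conf d j)) :
    IsLocal (firstSites j r) ((isTensorProduct_split d j r).amp B) := by
  intro k hk A
  have hk' : ∃ i : Fin r, k = Fin.natAdd j i := by
    refine Fin.addCases (motive := fun k => k ∉ firstSites j r → ∃ i : Fin r, k = Fin.natAdd j i)
      (fun i hi => absurd (Finset.mem_map.2 ⟨i, Finset.mem_univ _, rfl⟩) hi)
      (fun i _ => ⟨i, rfl⟩) k hk
  obtain ⟨i, rfl⟩ := hk'
  refine (isTensorProduct_split d j r).clm_ext fun φ χ => ?_
  rw [ContinuousLinearMap.comp_apply, ContinuousLinearMap.comp_apply, siteOp_natAdd_prodTensor,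
    IsTensorProduct.amp_map, IsTensorProduct.amp_map, siteOp_natAdd_prodTensor]

theorem tensorOp_rankOne (x y : Fin n → L2 (Space d)) :
    tensorOp (fun i => InnerProductSpace.rankOne ℂ (x i) (y i)) =
      InnerProductSpace.rankOne ℂ (tensorVec x) (tensorVec y) :=
  clm_ext_inner_tensorVec fun φ ψ => by
    rw [tensorOp_tensorVec, inner_tensorVec, InnerProductSpace.rankOne_apply, inner_smul_right,
      inner_tensorVec, inner_tensorVec, ← Finset.prod_mul_distrib]
    simp only [InnerProductSpace.rankOne_apply, inner_smul_right]

theorem tr_rmul_rankOne {H : Type*} [NormedAddCommGroup H] [InnerProductSpace ℂ H]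
    [CompleteSpace H] (A : TraceClass H) (x y : H) :
    tr (rmul (InnerProductSpace.rankOne ℂ x y) A) = inner ℂ y (A.op x) := by
  rw [← tr_rankOne]
  refine congrArg tr (op_injective ?_)
  rw [op_rmul, op_rankOne]
  ext z
  simp

/-- Product observables determine a trace class operator. -/
theorem eq_of_tr_rmul_tensorOp {A A' : TraceClass (L2 (Conf d n))}
    (h : ∀ B : Fin n → Op (Space d), tr (rmul (tensorOp B) A) = tr (rmul (tensorOp B) A')) :
    A = A' := by
  refine op_injective (clm_ext_inner_tensorVec fun φ ψ => ?_)
  have h1 := h fun i => InnerProductSpace.rankOne ℂ (ψ i) (φ i)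
  rwa [tensorOp_rankOne, tr_rmul_rankOne, tr_rmul_rankOne] at h1

/-- A trace class operator with the right expectations is the marginal. -/
theorem marginal_eq {N : ℕ} {D : TraceClass (L2 (Conf d N))} {A : TraceClass (L2 (Conf d j))}
    (h : ∀ B : Fin j → Op (Space d),
      tr (rmul (tensorOp (extendByOne N B)) D) = tr (rmul (tensorOp B) A)) :
    marginal j D.op = A.op := by
  have hA : ∃ Dj : Op (Conf d j), IsMarginal D.op Dj := ⟨A.op, A.traceNorm_op_lt_top, h⟩
  rw [marginal, dif_pos hA]
  obtain ⟨h1, h2⟩ := hA.choose_spec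
  have h3 : (⟨hA.choose, h1⟩ : TraceClass (L2 (Conf d j))) = A :=
    eq_of_tr_rmul_tensorOp fun B => (h2 B).symm.trans (h B)
  exact congrArg op h3

theorem rmul_tensorOp_tensorTC (B : Fin n → Op (Space d)) (A : Fin n → TraceClass (L2 (Space d))) :
    rmul (tensorOp B) (tensorTC A) = tensorTC fun i => rmul (B i) (A i) :=
  op_injective (by
    rw [op_rmul, op_tensorTC, tensorOp_comp]
    rfl)

/-- The expectations of a product state of `j + r` particles in the observables of the first `j`
particles are those of the product state of `j` particles. -/
theorem tr_rmul_amp_tensorTC {G : TraceClass (L2 (Space d))} (hG : tr G = 1)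
    (B : Op (Conf d j)) :
    tr (rmul ((isTensorProduct_split d j r).amp B) (tensorTC fun _ => G)) =
      tr (rmul B (tensorTC fun _ => G)) := by
  obtain ⟨A, hA⟩ := (isTensorProduct_split d j r).exists_partialTrace (tensorTC fun _ => G)
  have h1 : A = tensorTC fun _ => G := eq_of_tr_rmul_tensorOp fun B => by
    rw [hA, amp_tensorOp, rmul_tensorOp_tensorTC, rmul_tensorOp_tensorTC, tr_tensorTC, tr_tensorTC,
      Fin.prod_univ_add]
    have h2 : ∀ i : Fin r, tr (rmul (extendByOne (j + r) B (Fin.natAdd j i)) G) = 1 := fun i => by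
      rw [← hG]
      exact congrArg tr (op_injective (by simp [extendByOne]))
    simp only [h2, Finset.prod_const_one, mul_one]
    simp [extendByOne]
  rw [← hA, h1]

/-- Marginals are compared in trace norm by testing with the observables of the first `j`
particles. -/
theorem traceNorm_marginal_sub_le {D : TraceClass (L2 (Conf d (j + r)))}
    {G : TraceClass (L2 (Space d))} (hG : tr G = 1) {c : ℝ} (hc : 0 ≤ c)
    (h : ∀ B, IsLocal (firstSites j r) B →
      ‖tr (rmul B D) - tr (rmul B (tensorTC fun _ => G))‖ ≤ c * ‖B‖) :
    traceNorm (marginal j D.op - tensorPow G.op j) ≤ ENNReal.ofReal c := by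
  obtain ⟨A, hA⟩ := (isTensorProduct_split d j r).exists_partialTrace D
  have h1 : marginal j D.op = A.op := marginal_eq fun B => by rw [hA, amp_tensorOp]
  have h2 : marginal j D.op - tensorPow G.op j = (A - tensorTC fun _ => G).op := by
    rw [h1]
    rfl
  rw [h2, ← TraceClass.ofReal_norm]
  refine ENNReal.ofReal_le_ofReal ?_
  obtain ⟨B, hB, hBn⟩ := exists_tr_rmul_eq_norm (A - tensorTC fun _ => G)
  have h3 := h _ (isLocal_amp B)
  rw [← hA, tr_rmul_amp_tensorTC hG, ← map_sub, ← map_sub, hBn, Complex.norm_real, norm_norm] at h3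
  exact h3.trans (mul_le_of_le_one_right hc ((IsTensorProduct.norm_amp_le _ _).trans hB))

end Marginal

/-! ### The mean-field limit -/

section MeanFieldLimit

open TraceClass

variable {d : ℕ}

/-- The interaction picture of a solution of the `N`-body equation with initial datum `G ⊗ ⋯ ⊗ G`. -/
theorem IsNBodySolution.exists_flow {ħ : ℝ} {Φ Ψ : Space d → ℝ} (hΨΦ : Ψ =ᵐ[volume] Φ)
    (hΨ : Measurable Ψ) {L : ℝ} (hL : ∀ x, |Ψ x| ≤ L) {N : ℕ} {G : TraceClass (L2 (Space d))}
    (hG : ‖G‖ ≤ 1) {FN : ℝ → Op (Conf d N)} (h : IsNBodySolution ħ Φ N (tensorPow G.op N) FN) :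
    ∃ K : ℝ → TraceClass (L2 (Conf d N)), K 0 = (tensorTC fun _ => G) ∧
      (∀ t, 0 ≤ t → (evo ħ t (K t)).op = FN t) ∧
      IsNBodyFlow ħ (mulOp fun x : Conf d N => (meanFieldPotential Φ N x : ℂ)) K := by
  obtain ⟨K, hK0, hK, hder⟩ := h.exists_interaction continuousOn_const
  have hK0' : K 0 = tensorTC fun _ => G := op_injective hK0
  refine ⟨K, hK0', fun t ht => ?_, hder, fun t ht => ?_⟩
  · rw [op_evo, hK t ht, freeEvolution_freeEvolution_neg]
  · refine (norm_le_of_hasDerivAt_comm hder (fun s _ => ?_) ht).trans ?_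
    · rw [adjoint_freeEvolution, adjoint_mulOp_meanFieldPotential hΨΦ hΨ hL]
    · rw [hK0']
      exact norm_tensorTC_le_one hG

/-- The deviation of the `N`-body flow from the Hartree flow, tested with the observables of finitely
many particles, satisfies the hierarchy of differential inequalities. -/
theorem satisfiesHierarchy_deviation {N : ℕ} (hN : 0 < N) {ħ : ℝ} (hħ : 0 < ħ) {Φ Ψ : Space d → ℝ}
    (hΨΦ : Ψ =ᵐ[volume] Φ) (hΨ : Measurable Ψ) {L : ℝ} (hL : ∀ x, |Ψ x| ≤ L)
    (hev : ∀ x, Ψ (-x) = Ψ x) {J : ℝ → TraceClass (L2 (Space d))} {ρ : ℝ → Space d → ℂ}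
    (hJ : IsHartreeFlow ħ (pairPotential Ψ) J ρ) {K : ℝ → TraceClass (L2 (Conf d N))}
    (hK : IsNBodyFlow ħ (mulOp fun x : Conf d N => (meanFieldPotential Φ N x : ℂ)) K) :
    SatisfiesHierarchy (IsLocal (d := d) (n := N))
      (fun B t => tr (rmul B (K t)) - tr (rmul B (tensorTC fun _ => J t))) (L / ħ) := by
  intro S B hB
  obtain ⟨a, ha⟩ := mulOp_meanFieldPotential (n := N) hΨΦ hΨ hL
  obtain ⟨δ, hδ⟩ := exists_hasDerivAt_deviation hN hħ hΨ hL hev hJ ha hK hB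
  refine ⟨δ, fun t ht => ⟨(hδ t ht).1, fun u hu h => ((hδ t ht).2 u hu h).trans (le_of_eq ?_)⟩⟩
  field_simp

/-- The mean-field limit with its rate, for every number of particles that is at least `128` and at
least the number of particles of the marginal. -/
theorem traceNorm_marginal_sub_tensorPow_le {Φ : Space d → ℝ} (hΦ : MemLp Φ ∞ volume)
    (hev : ∀ᵐ x, Φ (-x) = Φ x) {ħ : ℝ} (hħ : 0 < ħ) {F₀ : Op (Space d)} (hF₀ : IsDensityOperator F₀)
    {F : ℝ → Op (Space d)} (hF : IsHartreeSolution ħ Φ F₀ F) {N : ℕ} {FN : ℝ → Op (Conf d N)}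
    (hFN : IsNBodySolution ħ Φ N (tensorPow F₀ N) FN) {t : ℝ} (ht : 0 ≤ t) (hN : (128 : ℝ) ≤ N)
    {j : ℕ} (hjN : j ≤ N) :
    traceNorm (marginal j (FN t) - tensorPow (F t) j) ≤
      ENNReal.ofReal ((2 : ℝ) ^ ((j : ℝ) + 1 + 16 * t * supNorm Φ / ħ) /
        (N : ℝ) ^ ((2 : ℝ) ^ (-1 - 16 * t * supNorm Φ / ħ) * Real.log 2)) := by
  obtain ⟨Ψ, hΨ, hL, hΨev, hΨΦ⟩ := exists_even_representative hΦ hev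
  set L := supNorm Φ with hLdef
  have hL0 : 0 ≤ L := (abs_nonneg _).trans (hL 0)
  have hN0 : 0 < N := by
    have : (0 : ℝ) < N := by linarith
    exact_mod_cast this
  obtain ⟨J, ρ, hJ0, hJF, hJ⟩ := hF.exists_flow hħ hΨΦ hΨ hL hF₀
  rw [← hJ0] at hFN
  obtain ⟨K, hK0, hKF, hK⟩ := hFN.exists_flow hΨΦ hΨ hL (hJ.norm_le_one 0 le_rfl)
  have hD := satisfiesHierarchy_deviation hN0 hħ hΨΦ hΨ hL hΨev hJ hK
  set x := 8 * (L / ħ) * t with hx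
  have hx0 : 0 ≤ x := by positivity
  have hk0 : (0 : ℝ) < (⌊x⌋₊ : ℝ) + 1 := by positivity
  -- The time interval is divided into the least number of steps that the hierarchy allows.
  have hiter := hD.norm_le_iterate hN0 (by positivity) (τ := t / (⌊x⌋₊ + 1)) (by positivity)
    (by
      rw [← mul_div_assoc, div_le_one hk0]
      exact (Nat.lt_floor_add_one x).le)
    (fun s hs S B _ => by
      have h1 := norm_tr_rmul_le B (K s)
      have h2 := norm_tr_rmul_le B (tensorTC fun _ : Fin N => J s)
      have h3 : ‖B‖ * ‖K s‖ ≤ ‖B‖ :=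
        mul_le_of_le_one_right (norm_nonneg _) (hK.norm_le_one s hs)
      have h4 : ‖B‖ * ‖(tensorTC fun _ : Fin N => J s)‖ ≤ ‖B‖ :=
        mul_le_of_le_one_right (norm_nonneg _) (norm_tensorTC_le_one (hJ.norm_le_one s hs))
      refine (norm_sub_le _ _).trans ?_
      linarith)
    (fun S B _ => by rw [hK0, sub_self]) (⌊x⌋₊ + 1)
  have htime : ((⌊x⌋₊ + 1 : ℕ) : ℝ) * (t / (⌊x⌋₊ + 1)) = t := by
    push_cast
    exact mul_div_cancel₀ _ hk0.ne'
  rw [htime] at hiter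
  -- The hierarchy controls the interaction picture. The observables are evolved freely, which preserves
  -- locality, to return to the Schrödinger picture.
  obtain ⟨r, rfl⟩ := Nat.exists_eq_add_of_le hjN
  have hfinal := traceNorm_marginal_sub_le (D := evo ħ t (K t)) (G := evo ħ t (J t))
    (c := 4 * ((j + r : ℕ) : ℝ) ^ (-(1 / 2 : ℝ) ^ (⌊x⌋₊ + 1)) * 2 ^ j)
    ((tr_evo ħ t _).trans (hJ.tr_eq_one t ht)) (by positivity) fun B hB => by
      have h1 := hiter (firstSites j r) (freeEvolution ħ (-t) B) fun k hk =>
        (hB k hk).freeEvolution ħ (-t)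
      rw [card_firstSites, ← tr_rmul_evo ħ t, ← tr_rmul_evo ħ t _ (tensorTC _),
        freeEvolution_freeEvolution_neg, evo_tensorTC] at h1
      exact h1.trans (mul_le_mul_of_nonneg_left (norm_freeEvolution_le _ _ _) (by positivity))
  rw [hKF t ht, hJF t ht] at hfinal
  refine hfinal.trans (ENNReal.ofReal_le_ofReal ?_)
  have h2x : 16 * t * L / ħ = 2 * x := by
    rw [hx]
    ring
  rw [h2x]
  exact iterate_bound_le hN hx0 j

/-- The lower bound for the number of particles exceeds the number of particles of the marginal. -/
theorem le_of_exp_le {s : ℝ} (hs : 0 ≤ s) {j N : ℕ}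
    (h : Real.exp ((2 : ℝ) ^ (s + 1) * (j : ℝ)) ≤ N) : j ≤ N := by
  have h1 : (1 : ℝ) ≤ 2 ^ (s + 1) := Real.one_le_rpow one_le_two (by linarith)
  have h2 := Real.add_one_le_exp ((2 : ℝ) ^ (s + 1) * (j : ℝ))
  have h3 : (j : ℝ) ≤ 2 ^ (s + 1) * (j : ℝ) := le_mul_of_one_le_left (Nat.cast_nonneg j) h1
  have h4 : (j : ℝ) ≤ N := by linarith
  exact_mod_cast h4

end MeanFieldLimit

end MeanField

end

theorem mainTheorem4 (j : ℕ) (hj : 1 ≤ j) :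
    ∃ N₀ : ℕ, 1 ≤ N₀ ∧
      ∀ (d : ℕ) (Φ : MeanField.Space d → ℝ),
        MemLp Φ ∞ volume → (∀ᵐ x, Φ (-x) = Φ x) →
      ∀ (ħ : ℝ), 0 < ħ →
      ∀ (F₀ : MeanField.Op (MeanField.Space d)), MeanField.IsDensityOperator F₀ →
      ∀ (F : ℝ → MeanField.Op (MeanField.Space d)), MeanField.IsHartreeSolution ħ Φ F₀ F →
      ∀ (N : ℕ) (FN : ℝ → MeanField.Op (MeanField.Conf d N)),
        MeanField.IsNBodySolution ħ Φ N (MeanField.tensorPow F₀ N) FN →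
      ∀ (t : ℝ), 0 ≤ t →
        max (N₀ : ℝ)
          (Real.exp ((2 : ℝ) ^ (16 * MeanField.supNorm Φ * t / ħ + 1) * (j : ℝ))) ≤ (N : ℝ) →
        MeanField.traceNorm (MeanField.marginal j (FN t) - MeanField.tensorPow (F t) j) ≤
          ENNReal.ofReal
            ((2 : ℝ) ^ ((j : ℝ) + 1 + 16 * t * MeanField.supNorm Φ / ħ) /
              (N : ℝ) ^ ((2 : ℝ) ^ (-1 - 16 * t * MeanField.supNorm Φ / ħ) * Real.log 2)) := by
  -- The value `128` comes from the comparison of constants in `iterate_bound_le`.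
  refine ⟨128, by norm_num, fun d Φ hΦ hev ħ hħ F₀ hF₀ F hF N FN hFN t ht hNmax => ?_⟩
  have hs : 0 ≤ 16 * MeanField.supNorm Φ * t / ħ :=
    div_nonneg (mul_nonneg (mul_nonneg (by norm_num) ENNReal.toReal_nonneg) ht) hħ.le
  exact MeanField.traceNorm_marginal_sub_tensorPow_le hΦ hev hħ hF₀ hF hFN ht
    (by exact_mod_cast (le_max_left _ _).trans hNmax)
    (MeanField.le_of_exp_le hs ((le_max_right _ _).trans hNmax))
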